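/- **Conventions.** Let $\pi$ be a group and $w:\pi\to\{\pm1\}$ the trivial homomorphism (for instance $\pi=\pi_1(\Sigma)$ for an orientable surface $\Sigma$, where $w$ is its orientation character). A *Gauss diagram on $\pi$* of degree $n$ is an oriented circle, up to orientation-preserving homeomorphism, with $n$ signed oriented arrows joining $2n$ distinct points in pairs. If $n\ge 1$, each of the $2n$ edges of the circle carries an element of $\pi$; if $n=0$, the circle carries a conjugacy class of $\pi$. When arrows are removed, edges that merge receive the product of their decorations (only its conjugacy class if no arrow remains). *Virtual knot types* on $(\pi,w)$ are the classes of Gauss diagrams under the following moves. - $R_1$: creation or removal of an isolated arrow surrounding an edge decorated by $1$. - $R_2$: creation or removal of two arrows of opposite signs with consecutive tails and consecutive heads, the two surrounded edges being decorated by $1$. - $R_3$: for three disjoint edges $e$ decorated by $1$, such that each two are joined by an arrow, exchange of the two ends of each of them. Let $\mathrm w(e)$ be the product of the signs of the two arrows that bound $e$, $\uparrow(e)$ the number of arrowheads that bound $e$, and $\varepsilon(e)=\pm(-1)^{\uparrow(e)}$ with sign $+$ if and only if these two arrows cross. It is required that $\mathrm w(e)\varepsilon(e)$ be the same for the three edges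 and that the numbers $\uparrow(e)$ be pairwise different. - Conjugacy moves: for an arrow and $g\in\pi$, multiply the edges that arrive at its two ends by $g$ on the right and those that leave them by $g^{-1}$ on the left; reverse the arrow if and only if $w(g)=-1$ (which never happens here). An *arrow diagram* is a Gauss diagram without its signs. In every type of diagrams, a diagram is an orbit of rigid diagrams (ends at the $2n$-th roots of unity) under $\mathbb Z/2n$ (the trivial group if $n=0$), and $\operatorname{Aut}$ denotes the stabilizer of a rigid representative. A *Gauss series* (*arrow series*) is a formal series of bounded degree with rational coefficients of Gauss (arrow) diagrams. Let $\langle\,,\rangle$ be the pairing of Gauss series with finite linear combinations of Gauss diagrams for which different diagrams are orthogonal and $\langle G,G\rangle=|\operatorname{Aut}G|$. Let $I(G)$ be the sum of all subdiagrams of $G$, let $T_a(G)$ be $G$ without its signs, let $\operatorname{sign}(G)$ be the product of the signs of the arrows, and put $$S(A)=\sum_{T_a(G)=A}\operatorname{sign}(G)\,\frac{|\operatorname{Aut}A|}{|\operatorname{Aut}G|}\,G ,$$ extended to arrow series. A Gauss series $\mathcal G$ is an *arrow diagram formula for virtual knots* if it lies in the image of $S$ and $G\mapsto\langle\mathcal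 G,I(G)\rangle$ depends only on the virtual knot type of $G$. **The planar chain series.** Let $n\ge0$ and let $\Gamma=(\gamma_1,\dots,\gamma_{n+1})$ be conjugacy classes of $\pi$. A *naked arrow diagram* consists of the circle and the oriented arrows only; it is *planar* if no two arrows intersect. The arrows of a planar diagram of degree $n$ cut the disc (with its circle oriented counterclockwise) into $n+1$ regions. A *chain presentation* is a bijective numbering of the regions by $1,\dots,n+1$ that increases from the left to the right of every arrow. Let $U_n$ be the sum of all chain presentations of planar naked diagrams of degree $n$, up to planar isotopy (rotation), and let $\Phi_\Gamma$ be the sum of decorated planar diagrams obtained from $U_n$ by decorating the region number $i$ with $\gamma_i$, with multiplicities. A planar arrow diagram on $\pi$ induces a decorated planar diagram: each region receives the conjugacy class of the product of the decorations of the edges at its boundary, in the order of the circle. Let $S_\Gamma^a$ be the linear map that sends a decorated planar diagram with a rigid representative $D$ to the formal sum, over all rigid planar arrow diagrams on $\pi$ that induce $D$, of the arrow diagrams that they represent. Put $\widetilde\Phi_\Gamma=S_\Gamma^a(\Phi_\Gamma)$, an arrow series of degree $n$. **Theorem.** For every $n\ge0$ and every system $\Gamma=(\gamma_1,\dots,\gamma_{n+1})$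 of non-trivial conjugacy classes of $\pi$, some of which may coincide, the Gauss series $S(\widetilde\Phi_\Gamma)$ is an arrow diagram formula for virtual knots. In particular $G\mapsto\langle S(\widetilde\Phi_\Gamma),I(G)\rangle$ is an invariant of virtual knots on $(\pi,w)$. -/

import Mathlib

/-!
Gauss diagrams and arrow diagrams decorated by a group, their Reidemeister moves and conjugacy
moves, Gauss diagram formulas, symmetry-preserving maps, and the universal planar chain.
-/

namespace GaussKnot

universe u

/-! ### Symmetry-preserving maps between sets with an action of a finite abelian group -/

section Symmetry

variable (K : Type*) [CommGroup K]

/-- Diagrams of a given type: rigid diagrams up to rotation. -/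
abbrev Diag (X : Type*) [MulAction K X] : Type _ := MulAction.orbitRel.Quotient K X

variable {K} {X Y : Type*} [MulAction K X] [MulAction K Y]

/-- The diagram represented by a rigid diagram. -/
def diag (x : X) : Diag K X := Quotient.mk _ x

/-- The order of the group of symmetries of a diagram: the stabilizer of any rigid
representative. -/
noncomputable def autOrder (D : Diag K X) : ℕ :=
  Quotient.liftOn D (fun x : X => Nat.card (MulAction.stabilizer K x)) (by
    rintro x y ⟨k, rfl⟩
    have : MulAction.stabilizer K (k • y) = MulAction.stabilizer K y := by
      ext g
      simp only [MulAction.mem_stabilizer_iff]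
      rw [smul_comm]
      exact (MulAction.injective k).eq_iff
    simp only [this])

/-- An equivariant map of rigid diagrams induces a map of diagrams. -/
def forget (f : X →[K] Y) : Diag K X → Diag K Y :=
  Quotient.map (sa := MulAction.orbitRel K X) (sb := MulAction.orbitRel K Y) f (by
    rintro x y ⟨k, rfl⟩
    exact ⟨k, (map_smul f k y).symm⟩)

/-- The forgetful projection, on finite linear combinations of diagrams. -/
noncomputable def projection (f : X →[K] Y) : (Diag K X →₀ ℚ) →ₗ[ℚ] (Diag K Y →₀ ℚ) :=
  Finsupp.lmapDomain ℚ ℚ (forget f)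

/-- The number of rigid representatives of `D` lying over one given rigid representative of the
image of `D`: the coefficient of `D` in the sum of everything that projects to that rigid
representative. -/
noncomputable def fibreCount (f : X →[K] Y) (D : Diag K X) : ℕ :=
  Quotient.liftOn D
    (fun x : X => Nat.card {x' : X // x' ∈ MulAction.orbit K x ∧ f x' = f x}) (by
    rintro x y ⟨k, rfl⟩
    refine Nat.card_congr (Equiv.subtypeEquiv (MulAction.toPerm k⁻¹) fun a => ?_)
    have h : MulAction.orbit K (k • y) = MulAction.orbit K y := MulAction.orbit_smul k y
    simp only [MulAction.toPerm_apply, h, map_smul]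
    have h' : k⁻¹ • a ∈ MulAction.orbit K y ↔ a ∈ MulAction.orbit K y := by
      rw [← MulAction.orbit_eq_iff, MulAction.orbit_smul, MulAction.orbit_eq_iff]
    rw [h', inv_smul_eq_iff])

/-- The symmetry-preserving map on formal series: a rigid diagram of the target type is sent to
the formal sum of all rigid diagrams lying over it. -/
noncomputable def symPres (f : X →[K] Y) : (Diag K Y → ℚ) →ₗ[ℚ] (Diag K X → ℚ) where
  toFun s := fun D => fibreCount f D * s (forget f D)
  map_add' s t := by ext D; simp [mul_add]
  map_smul' c s := by ext D; simp; ring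

end Symmetry

/-! ### Rigid diagrams -/

/-- The number of edges of a diagram with `n` arrows: `2 * n`, or `1` (the whole circle) if there
is no arrow. -/
def size (n : ℕ) : ℕ := max 1 (2 * n)

instance (n : ℕ) : NeZero (size n) := ⟨by unfold size; omega⟩

/-- The marked points of the oriented circle, in cyclic order. They are the arrow ends if `n ≠ 0`;
a circle without arrows has one auxiliary marked point. The same type indexes the edges:
the edge `i` goes from the point `i` to the point `i + 1`. -/
abbrev Pt (n : ℕ) : Type := Fin (size n)

/-- The rotations of a rigid diagram of degree `n`. -/
abbrev Rot (n : ℕ) : Type := Multiplicative (Pt n)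

/-- A rigid naked arrow diagram: `partner` exchanges the ends of each arrow, and `dir` is `1` at
the tail and `-1` at the head of an arrow (and `0` only at the auxiliary point of the circle
without arrows). -/
@[ext]
structure Naked (n : ℕ) where
  partner : Pt n → Pt n
  dir : Pt n → SignType
  partner_partner : ∀ i, partner (partner i) = i
  dir_partner : ∀ i, dir (partner i) = -dir i
  dir_eq_zero : ∀ i, dir i = 0 ↔ n = 0

/-- The decorations of the edges by elements of `π`; a diagram without arrows is decorated by a
conjugacy class. -/
def Marking (π : Type u) [Group π] : ℕ → Type u
  | 0 => ConjClasses π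
  | n + 1 => Pt (n + 1) → π

/-- A rigid arrow diagram on `π`. -/
@[ext]
structure RigidArrow (π : Type u) [Group π] (n : ℕ) extends Naked n where
  mark : Marking π n

/-- A rigid Gauss diagram on `π`: a rigid arrow diagram with a sign on each arrow. -/
@[ext]
structure RigidGauss (π : Type u) [Group π] (n : ℕ) extends RigidArrow π n where
  writhe : Pt n → SignType
  writhe_partner : ∀ i, writhe (partner i) = writhe i
  writhe_eq_zero : ∀ i, writhe i = 0 ↔ n = 0

section Marking

variable {π : Type u} [Group π]

/-- The decoration of an edge in a diagram with arrows (the value is irrelevant if `n = 0`). -/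
def Marking.at : {n : ℕ} → Marking π n → Pt n → π
  | 0, _, _ => 1
  | _ + 1, μ, e => μ e

/-- The conjugacy class of the whole circle. -/
def Marking.total : {n : ℕ} → Marking π n → ConjClasses π
  | 0, c => c
  | n + 1, μ => ConjClasses.mk ((List.finRange (size (n + 1))).map μ).prod

/-- Change the decoration of each edge (nothing happens if there is no arrow). -/
def Marking.modify : {n : ℕ} → (Pt n → π → π) → Marking π n → Marking π n
  | 0, _, c => c
  | _ + 1, f, μ => fun e => f e (μ e)

/-- Rotate the decorations. -/
def Marking.rotate : {n : ℕ} → Pt n → Marking π n → Marking π n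
  | 0, _, c => c
  | _ + 1, k, μ => fun e => μ (e - k)

theorem Marking.rotate_zero {n : ℕ} (μ : Marking π n) : μ.rotate 0 = μ := by
  cases n with
  | zero => rfl
  | succ n => funext e; simp [Marking.rotate]

theorem Marking.rotate_add {n : ℕ} (k l : Pt n) (μ : Marking π n) :
    μ.rotate (k + l) = (μ.rotate l).rotate k := by
  cases n with
  | zero => rfl
  | succ n => funext e; simp only [Marking.rotate, sub_sub]

end Marking

/-! ### Rotations -/

/-- Rotate a naked diagram. -/
def Naked.rotate {n : ℕ} (k : Pt n) (D : Naked n) : Naked n where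
  partner i := D.partner (i - k) + k
  dir i := D.dir (i - k)
  partner_partner i := by simp [D.partner_partner]
  dir_partner i := by simp [D.dir_partner]
  dir_eq_zero i := D.dir_eq_zero _

theorem Naked.rotate_zero {n : ℕ} (D : Naked n) : D.rotate 0 = D := by
  ext i <;> simp [Naked.rotate]

theorem Naked.rotate_add {n : ℕ} (k l : Pt n) (D : Naked n) :
    D.rotate (k + l) = (D.rotate l).rotate k := by
  ext i
  · simp only [Naked.rotate, sub_sub, add_assoc, add_comm l k]
  · simp only [Naked.rotate, sub_sub]

instance (n : ℕ) : MulAction (Rot n) (Naked n) where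
  smul k D := D.rotate k.toAdd
  one_smul D := D.rotate_zero
  mul_smul k l D := D.rotate_add k.toAdd l.toAdd

theorem Naked.smul_def {n : ℕ} (k : Rot n) (D : Naked n) : k • D = D.rotate k.toAdd := rfl

section Actions

variable {π : Type u} [Group π]

instance (n : ℕ) : MulAction (Rot n) (RigidArrow π n) where
  smul k A := { toNaked := k • A.toNaked, mark := A.mark.rotate k.toAdd }
  one_smul A := congrArg₂ RigidArrow.mk (one_smul _ A.toNaked) A.mark.rotate_zero
  mul_smul k l A := congrArg₂ RigidArrow.mk (mul_smul k l A.toNaked)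
    (A.mark.rotate_add k.toAdd l.toAdd)

theorem RigidArrow.toNaked_smul {n : ℕ} (k : Rot n) (A : RigidArrow π n) :
    (k • A).toNaked = k • A.toNaked := rfl

theorem RigidArrow.mark_smul {n : ℕ} (k : Rot n) (A : RigidArrow π n) :
    (k • A).mark = A.mark.rotate k.toAdd := rfl

/-- Rotate a Gauss diagram. -/
def RigidGauss.rotate {n : ℕ} (k : Pt n) (G : RigidGauss π n) : RigidGauss π n where
  toRigidArrow := Multiplicative.ofAdd k • G.toRigidArrow
  writhe i := G.writhe (i - k)
  writhe_partner i := by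
    show G.writhe (G.partner (i - k) + k - k) = _
    simp [G.writhe_partner]
  writhe_eq_zero i := G.writhe_eq_zero _

theorem RigidGauss.ext_arrow {n : ℕ} {G H : RigidGauss π n}
    (h : G.toRigidArrow = H.toRigidArrow) (h' : G.writhe = H.writhe) : G = H := by
  obtain ⟨A, v, _, _⟩ := G
  obtain ⟨B, v', _, _⟩ := H
  simp only at h h'
  subst h h'
  rfl

instance (n : ℕ) : MulAction (Rot n) (RigidGauss π n) where
  smul k G := G.rotate k.toAdd
  one_smul G := RigidGauss.ext_arrow (one_smul _ G.toRigidArrow)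
    (funext fun i => congrArg G.writhe (sub_zero i))
  mul_smul k l G := RigidGauss.ext_arrow (mul_smul k l G.toRigidArrow)
    (funext fun i => congrArg G.writhe (sub_sub i k.toAdd l.toAdd).symm)

theorem RigidGauss.smul_def {n : ℕ} (k : Rot n) (G : RigidGauss π n) :
    k • G = G.rotate k.toAdd := rfl

end Actions

/-- Gauss diagrams on `π` of degree `n`. -/
abbrev GaussDiagram (π : Type u) [Group π] (n : ℕ) : Type u := Diag (Rot n) (RigidGauss π n)

/-- Arrow diagrams on `π` of degree `n`. -/
abbrev ArrowDiagram (π : Type u) [Group π] (n : ℕ) : Type u := Diag (Rot n) (RigidArrow π n)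

/-- Formal series of Gauss diagrams of bounded degree. -/
abbrev GaussSeries (π : Type u) [Group π] : Type u :=
  DFinsupp fun n : ℕ => GaussDiagram π n → ℚ

/-- Formal series of arrow diagrams of bounded degree. -/
abbrev ArrowSeries (π : Type u) [Group π] : Type u :=
  DFinsupp fun n : ℕ => ArrowDiagram π n → ℚ

/-- Finite linear combinations of Gauss diagrams. -/
abbrev GaussSpace (π : Type u) [Group π] : Type u :=
  (Σ n : ℕ, GaussDiagram π n) →₀ ℚ

/-! ### Arrow series as Gauss series -/

section Formulas

variable {π : Type u} [Group π]

/-- The product of the signs of the arrows. -/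
def RigidGauss.sign {n : ℕ} (G : RigidGauss π n) : ℚ :=
  ∏ i, if G.dir i = 1 then (G.writhe i : ℚ) else 1

/-- The sign of a Gauss diagram. -/
def gaussSign {n : ℕ} (G : GaussDiagram π n) : ℚ :=
  Quotient.liftOn G RigidGauss.sign (by
    rintro x y ⟨k, rfl⟩
    exact Equiv.prod_comp (Equiv.subRight k.toAdd)
      (fun i => if y.dir i = 1 then (y.writhe i : ℚ) else 1))

/-- Forget the signs of the arrows. -/
def forgetSigns (π : Type u) [Group π] (n : ℕ) : RigidGauss π n →[Rot n] RigidArrow π n where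
  toFun G := G.toRigidArrow
  map_smul' _ _ := rfl

/-- The signed symmetry-preserving map from arrow series to Gauss series: an arrow diagram `A` is
sent to the sum of the `sign G * |Aut A| / |Aut G| • G` over all `G` that become `A` when the
signs are forgotten. -/
noncomputable def signedSymPres (𝒜 : ArrowSeries π) : GaussSeries π :=
  DFinsupp.mapRange
    (fun n (s : ArrowDiagram π n → ℚ) (G : GaussDiagram π n) =>
      gaussSign G * ((autOrder (forget (forgetSigns π n) G) : ℚ) / (autOrder G : ℚ)) *
        s (forget (forgetSigns π n) G))
    (fun n => by funext G; simp) 𝒜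

/-- The normalized pairing, for which the diagrams are orthogonal and the square of a diagram is
the order of its group of symmetries. -/
noncomputable def pairing (𝒢 : GaussSeries π) (x : GaussSpace π) : ℚ :=
  x.sum fun G q => (autOrder G.2 : ℚ) * 𝒢 G.1 G.2 * q

/-! ### Subdiagrams -/

/-- The arrows of a diagram, given by their tails. -/
def Naked.arrows {n : ℕ} (D : Naked n) : Finset (Pt n) := Finset.univ.filter fun i => D.dir i = 1

/-- The ends of a set of arrows. -/
def Naked.ends {n : ℕ} (D : Naked n) (s : Finset (Pt n)) : Finset (Pt n) := s ∪ s.image D.partner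

theorem Naked.partner_mem_ends {n : ℕ} (D : Naked n) (s : Finset (Pt n)) {i : Pt n}
    (hi : i ∈ D.ends s) : D.partner i ∈ D.ends s := by
  simp only [Naked.ends, Finset.mem_union, Finset.mem_image] at hi ⊢
  rcases hi with hi | ⟨j, hj, rfl⟩
  · exact Or.inr ⟨i, hi, rfl⟩
  · exact Or.inl (by rwa [D.partner_partner])

theorem Naked.dir_ne_zero_of_mem_ends {n : ℕ} (D : Naked n) {s : Finset (Pt n)}
    (hs : s ⊆ D.arrows) {i : Pt n} (hi : i ∈ D.ends s) : D.dir i ≠ 0 := by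
  simp only [Naked.ends, Finset.mem_union, Finset.mem_image] at hi
  rcases hi with hi | ⟨j, hj, rfl⟩
  · have := hs hi
    simp only [Naked.arrows, Finset.mem_filter] at this
    simp [this.2]
  · have := hs hj
    simp only [Naked.arrows, Finset.mem_filter] at this
    simp [D.dir_partner, this.2]

theorem Naked.card_ends {n : ℕ} (D : Naked n) {s : Finset (Pt n)} (hs : s ⊆ D.arrows) {m : ℕ}
    (hm : s.card = m + 1) : (D.ends s).card = size (m + 1) := by
  have hinj : Function.Injective D.partner := fun a b h => by
    rw [← D.partner_partner a, h, D.partner_partner]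
  have hdisj : Disjoint s (s.image D.partner) := by
    rw [Finset.disjoint_left]
    intro a ha hb
    obtain ⟨b, hb', rfl⟩ := Finset.mem_image.1 hb
    have h1 := hs ha
    have h2 := hs hb'
    simp only [Naked.arrows, Finset.mem_filter, D.dir_partner] at h1 h2
    rw [h2.2] at h1
    exact absurd h1.2 (by decide)
  rw [Naked.ends, Finset.card_union_of_disjoint hdisj, Finset.card_image_of_injective _ hinj, hm,
    size]
  omega

/-- The subdiagram with `m` given arrows. The points that remain are numbered again in increasing
order; the edges that merge are decorated by the product of their decorations, and only the
conjugacy class of this product is kept if no arrow is left. -/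
noncomputable def RigidGauss.subAux {n : ℕ} (G : RigidGauss π n) (s : Finset (Pt n))
    (hs : s ⊆ G.arrows) : (m : ℕ) → s.card = m → RigidGauss π m
  | 0, _ =>
    { partner := id
      dir := fun _ => 0
      partner_partner := fun _ => rfl
      dir_partner := fun _ => by simp
      dir_eq_zero := fun _ => by simp
      mark := (G.mark.total : ConjClasses π)
      writhe := fun _ => 0
      writhe_partner := fun _ => rfl
      writhe_eq_zero := fun _ => by simp }
  | m + 1, hm =>
    let ι : Pt (m + 1) ≃o G.ends s := (G.ends s).orderIsoOfFin (G.card_ends hs hm)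
    { partner := fun j => ι.symm ⟨G.partner (ι j), G.partner_mem_ends s (ι j).2⟩
      dir := fun j => G.dir (ι j)
      partner_partner := fun j => by simp [G.partner_partner]
      dir_partner := fun j => by simp [G.dir_partner]
      dir_eq_zero := fun j => by simpa using G.dir_ne_zero_of_mem_ends hs (ι j).2
      mark := fun j : Pt (m + 1) =>
        ((List.range ((ι (j + 1) : Pt n) - (ι j : Pt n)).val).map fun k =>
          G.mark.at ((ι j : Pt n) + Fin.ofNat (size n) k)).prod
      writhe := fun j => G.writhe (ι j)
      writhe_partner := fun j => by simp [G.writhe_partner]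
      writhe_eq_zero := fun j => by
        have h := G.dir_ne_zero_of_mem_ends hs (ι j).2
        rw [Ne, G.dir_eq_zero] at h
        simpa [G.writhe_eq_zero] using h }

/-- The subdiagram consisting of the arrows in `s`. -/
noncomputable def RigidGauss.sub {n : ℕ} (G : RigidGauss π n) (s : Finset (Pt n))
    (hs : s ⊆ G.arrows) : RigidGauss π s.card :=
  G.subAux s hs s.card rfl

/-- Remove the arrows in `s`. -/
noncomputable def RigidGauss.remove {n : ℕ} (G : RigidGauss π n) (s : Finset (Pt n)) :
    RigidGauss π (G.arrows \ s).card :=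
  G.sub (G.arrows \ s) Finset.sdiff_subset

/-- The sum of all subdiagrams. -/
noncomputable def subdiagramSum {n : ℕ} (G : RigidGauss π n) : GaussSpace π :=
  ∑ s ∈ G.arrows.powerset.attach,
    Finsupp.single
      (⟨s.1.card, diag (G.sub s.1 (Finset.mem_powerset.1 s.2))⟩ : Σ n : ℕ, GaussDiagram π n) 1

/-! ### Moves -/

/-- The edge `e` lies on the arc that goes, along the orientation of the circle, from the point
`i` to the other end of its arrow. -/
def Naked.OnArc {n : ℕ} (D : Naked n) (i e : Pt n) : Prop := e - i < D.partner i - i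

instance {n : ℕ} (D : Naked n) (i e : Pt n) : Decidable (D.OnArc i e) :=
  inferInstanceAs (Decidable (e - i < D.partner i - i))

/-- The arrows ending at `i` and `j` (two different arrows) intersect: exactly one end of the
second one lies on the arc from `i` to the other end of the first one. -/
def Naked.Cross {n : ℕ} (D : Naked n) (i j : Pt n) : Prop :=
  j ≠ i ∧ j ≠ D.partner i ∧ ¬ (D.OnArc i j ↔ D.OnArc i (D.partner j))

instance {n : ℕ} (D : Naked n) (i j : Pt n) : Decidable (D.Cross i j) :=
  inferInstanceAs (Decidable (j ≠ i ∧ j ≠ D.partner i ∧ ¬ (D.OnArc i j ↔ D.OnArc i (D.partner j))))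

/-- The number of arrowheads at the boundary of the edge `e`. -/
def Naked.heads {n : ℕ} (D : Naked n) (e : Pt n) : ℕ :=
  (if D.dir e = -1 then 1 else 0) + (if D.dir (e + 1) = -1 then 1 else 0)

/-- The sign `ε` of the edge `e`. -/
def Naked.eps {n : ℕ} (D : Naked n) (e : Pt n) : ℤ :=
  (if D.Cross e (e + 1) then 1 else -1) * (-1) ^ D.heads e

/-- The product of the signs of the two arrows at the boundary of the edge `e`. -/
def RigidGauss.edgeWrithe {n : ℕ} (G : RigidGauss π n) (e : Pt n) : ℤ :=
  (G.writhe e : ℤ) * (G.writhe (e + 1) : ℤ)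

/-- Move the arrow ends by a permutation of the points, keeping the decorations of the edges. -/
def RigidGauss.permute {n : ℕ} (G : RigidGauss π n) (σ : Equiv.Perm (Pt n)) : RigidGauss π n where
  partner i := σ (G.partner (σ.symm i))
  dir i := G.dir (σ.symm i)
  partner_partner i := by simp [G.partner_partner]
  dir_partner i := by simp [G.dir_partner]
  dir_eq_zero i := G.dir_eq_zero _
  mark := G.mark
  writhe i := G.writhe (σ.symm i)
  writhe_partner i := by simp [G.writhe_partner]
  writhe_eq_zero i := G.writhe_eq_zero _

/-- The conjugacy move by `g` on the arrow with ends `i` and `partner i`: the incoming edges are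
multiplied by `g` on the right, the outgoing edges by `g⁻¹` on the left, and the arrow is reversed
if and only if `w g = -1`. -/
def RigidGauss.conjugate (w : π →* ℤˣ) {n : ℕ} (G : RigidGauss π n) (i : Pt n) (g : π) :
    RigidGauss π n where
  partner := G.partner
  dir j := if (j = i ∨ j = G.partner i) ∧ w g = -1 then -G.dir j else G.dir j
  partner_partner := G.partner_partner
  dir_partner j := by
    have h1 : G.partner j = G.partner i ↔ j = i :=
      ⟨fun h => by rw [← G.partner_partner j, h, G.partner_partner], fun h => by rw [h]⟩
    have h2 : G.partner j = i ↔ j = G.partner i :=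
      ⟨fun h => by rw [← h, G.partner_partner], fun h => by rw [h, G.partner_partner]⟩
    have h3 : ((G.partner j = i ∨ G.partner j = G.partner i) ∧ w g = -1) ↔
        ((j = i ∨ j = G.partner i) ∧ w g = -1) := by rw [h1, h2, or_comm]
    by_cases h : (j = i ∨ j = G.partner i) ∧ w g = -1
    · rw [if_pos h, if_pos (h3.2 h), G.dir_partner]
    · rw [if_neg h, if_neg (fun h' => h (h3.1 h')), G.dir_partner]
  dir_eq_zero j := by
    split_ifs
    · rw [← G.dir_eq_zero j]; cases G.dir j <;> decide
    · exact G.dir_eq_zero j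
  mark := G.mark.modify fun e x =>
    (if e = i ∨ e = G.partner i then g⁻¹ else 1) * x *
      (if e + 1 = i ∨ e + 1 = G.partner i then g else 1)
  writhe := G.writhe
  writhe_partner := G.writhe_partner
  writhe_eq_zero := G.writhe_eq_zero

/-- The arrow with tail `a` is isolated and surrounds an edge decorated by `1`. -/
def RigidGauss.IsR1 {n : ℕ} (G : RigidGauss π n) (a : Pt n) : Prop :=
  a ∈ G.arrows ∧
    ((G.partner a = a + 1 ∧ G.mark.at a = 1) ∨
      (a = G.partner a + 1 ∧ G.mark.at (G.partner a) = 1))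

/-- The arrows with tails `a` and `b` have opposite signs, their tails are consecutive as well as
their heads, and the two surrounded edges are decorated by `1`. -/
def RigidGauss.IsR2 {n : ℕ} (G : RigidGauss π n) (a b : Pt n) : Prop :=
  a ∈ G.arrows ∧ b ∈ G.arrows ∧ a ≠ b ∧ G.writhe a = -G.writhe b ∧
    (b = a + 1 ∧ G.mark.at a = 1) ∧
    ((G.partner b = G.partner a + 1 ∧ G.mark.at (G.partner a) = 1) ∨
      (G.partner a = G.partner b + 1 ∧ G.mark.at (G.partner b) = 1))

/-- The three disjoint edges `e 0`, `e 1`, `e 2` are decorated by `1`, each two of them are joined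
by an arrow, the product of the signs `w` and `ε` is the same for all three, and their numbers of
arrowheads are pairwise different. -/
def RigidGauss.IsR3 {n : ℕ} (G : RigidGauss π n) (e : Fin 3 → Pt n) : Prop :=
  Function.Injective (fun p : Fin 3 × Bool => if p.2 then e p.1 + 1 else e p.1) ∧
  (∀ k, G.mark.at (e k) = 1) ∧
  (∀ k l, k ≠ l → ∃ a, (a = e k ∨ a = e k + 1) ∧
    (G.partner a = e l ∨ G.partner a = e l + 1)) ∧
  (∀ k l, G.edgeWrithe (e k) * G.eps (e k) = G.edgeWrithe (e l) * G.eps (e l)) ∧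
  (∀ k l, k ≠ l → G.heads (e k) ≠ G.heads (e l))

/-- Exchange the two ends of each of three edges. -/
def swapEnds {n : ℕ} (e : Fin 3 → Pt n) : Equiv.Perm (Pt n) :=
  Equiv.swap (e 0) (e 0 + 1) * Equiv.swap (e 1) (e 1 + 1) * Equiv.swap (e 2) (e 2 + 1)

/-- Rotations, Reidemeister moves and conjugacy moves on Gauss diagrams on the weighted group
`(π, w)`, on rigid representatives. -/
inductive Move (w : π →* ℤˣ) : (Σ n : ℕ, RigidGauss π n) → (Σ n : ℕ, RigidGauss π n) → Prop
  | rotate {n : ℕ} (G : RigidGauss π n) (k : Rot n) : Move w ⟨n, G⟩ ⟨n, k • G⟩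
  | r1 {n : ℕ} (G : RigidGauss π n) (a : Pt n) (h : G.IsR1 a) :
      Move w ⟨n, G⟩ ⟨_, G.remove {a}⟩
  | r2 {n : ℕ} (G : RigidGauss π n) (a b : Pt n) (h : G.IsR2 a b) :
      Move w ⟨n, G⟩ ⟨_, G.remove {a, b}⟩
  | r3 {n : ℕ} (G : RigidGauss π n) (e : Fin 3 → Pt n) (h : G.IsR3 e) :
      Move w ⟨n, G⟩ ⟨n, G.permute (swapEnds e)⟩
  | conj {n : ℕ} (G : RigidGauss π n) (i : Pt n) (hi : i ∈ G.arrows) (g : π) :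
      Move w ⟨n, G⟩ ⟨n, G.conjugate w i g⟩

/-- Virtual knot types on the weighted group `(π, w)`: the quotient by the equivalence relation
generated by the moves. -/
def VirtualKnot (w : π →* ℤˣ) : Type u := Quot (Move w)

/-- The virtual knot type of a Gauss diagram. -/
def knotType (w : π →* ℤˣ) {n : ℕ} (G : RigidGauss π n) : VirtualKnot w := Quot.mk _ ⟨n, G⟩

/-- `𝒢` is a Gauss diagram formula: the weighted count of subdiagrams defines an invariant of
virtual knots. -/
def IsGaussDiagramFormula (w : π →* ℤˣ) (𝒢 : GaussSeries π) : Prop :=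
  ∃ ν : VirtualKnot w → ℚ, ∀ (n : ℕ) (G : RigidGauss π n),
    ν (knotType w G) = pairing 𝒢 (subdiagramSum G)

/-- An arrow diagram formula is a Gauss diagram formula that comes from an arrow series. -/
def IsArrowDiagramFormula (w : π →* ℤˣ) (𝒢 : GaussSeries π) : Prop :=
  IsGaussDiagramFormula w 𝒢 ∧ 𝒢 ∈ Set.range (signedSymPres (π := π))

end Formulas

/-! ### Planar diagrams -/

/-- No two arrows intersect. -/
def Naked.Planar {n : ℕ} (D : Naked n) : Prop := ∀ i j, ¬ D.Cross i j

/-- The edges `e` and `f` are not separated by any arrow. In a planar diagram this means that they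
lie at the boundary of the same complementary region of the arrows in the disc, and the regions
are the equivalence classes. -/
def Naked.SameRegion {n : ℕ} (D : Naked n) (e f : Pt n) : Prop :=
  ∀ i, D.OnArc i e ↔ D.OnArc i f

instance {n : ℕ} (D : Naked n) (e f : Pt n) : Decidable (D.SameRegion e f) :=
  inferInstanceAs (Decidable (∀ i, D.OnArc i e ↔ D.OnArc i f))

theorem Naked.onArc_rotate {n : ℕ} (D : Naked n) (k i e : Pt n) :
    (D.rotate k).OnArc i e ↔ D.OnArc (i - k) (e - k) := by
  simp only [Naked.OnArc, Naked.rotate]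
  have h1 : e - k - (i - k) = e - i := by abel
  have h2 : D.partner (i - k) - (i - k) = D.partner (i - k) + k - i := by abel
  rw [h1, h2]

theorem Naked.sameRegion_rotate {n : ℕ} (D : Naked n) (k e f : Pt n) :
    (D.rotate k).SameRegion e f ↔ D.SameRegion (e - k) (f - k) := by
  simp only [Naked.SameRegion, Naked.onArc_rotate]
  exact ⟨fun h i => by simpa using h (i + k), fun h i => h _⟩

theorem Naked.Planar.rotate {n : ℕ} {D : Naked n} (h : D.Planar) (k : Pt n) :
    (D.rotate k).Planar := by
  intro i j hc
  apply h (i - k) (j - k)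
  obtain ⟨h1, h2, h3⟩ := hc
  refine ⟨fun h => h1 (sub_left_injective h), fun h => h2 ?_, fun h => h3 ?_⟩
  · simp only [Naked.rotate]; rw [← h]; abel
  · rw [Naked.onArc_rotate, Naked.onArc_rotate]
    simpa [Naked.rotate] using h

section Planar

variable {π : Type u} [Group π]

/-- A rigid planar arrow diagram on `π`. -/
def PlanarArrow (π : Type u) [Group π] (n : ℕ) : Type u := {A : RigidArrow π n // A.Planar}

instance (n : ℕ) : MulAction (Rot n) (PlanarArrow π n) where
  smul k A := ⟨k • A.1, A.2.rotate k.toAdd⟩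
  one_smul A := Subtype.ext (one_smul _ A.1)
  mul_smul k l A := Subtype.ext (mul_smul k l A.1)

/-- The inclusion of planar arrow diagrams into arrow diagrams. -/
def planarIncl (π : Type u) [Group π] (n : ℕ) : PlanarArrow π n →[Rot n] RigidArrow π n where
  toFun A := A.1
  map_smul' _ _ := rfl

/-- A rigid planar naked diagram with a conjugacy class assigned to each region, as a function of
the edges at the boundary of the region. -/
@[ext]
structure Decorated (π : Type u) [Group π] (n : ℕ) extends Naked n where
  planar : toNaked.Planar
  label : Pt n → ConjClasses π
  label_eq : ∀ e f, toNaked.SameRegion e f → label e = label f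

theorem Decorated.ext_naked {n : ℕ} {D E : Decorated π n} (h : D.toNaked = E.toNaked)
    (h' : D.label = E.label) : D = E := by
  obtain ⟨A, _, v, _⟩ := D
  obtain ⟨B, _, v', _⟩ := E
  simp only at h h'
  subst h h'
  rfl

instance (n : ℕ) : MulAction (Rot n) (Decorated π n) where
  smul k D :=
    { toNaked := k • D.toNaked
      planar := D.planar.rotate k.toAdd
      label := fun e => D.label (e - k.toAdd)
      label_eq := fun _ _ h => D.label_eq _ _ ((D.toNaked.sameRegion_rotate _ _ _).1 h) }
  one_smul D := Decorated.ext_naked (one_smul _ D.toNaked)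
    (funext fun i => congrArg D.label (sub_zero i))
  mul_smul k l D := Decorated.ext_naked (mul_smul k l D.toNaked)
    (funext fun i => congrArg D.label (sub_sub i k.toAdd l.toAdd).symm)

/-- A rigid chain presentation of a planar naked diagram of degree `n`: a numbering of the regions
from `0` to `n`, increasing from the left to the right of each arrow. The circle is oriented
counterclockwise, so the edge that ends at the tail of an arrow is on its left, and the edge that
starts at the tail is on its right. -/
@[ext]
structure Chain (n : ℕ) extends Naked n where
  planar : toNaked.Planar
  num : Pt n → Fin (n + 1)
  num_eq : ∀ e f, num e = num f ↔ toNaked.SameRegion e f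
  num_surjective : Function.Surjective num
  num_lt : ∀ t, dir t = 1 → num (t - 1) < num t

theorem Chain.ext_naked {n : ℕ} {C C' : Chain n} (h : C.toNaked = C'.toNaked)
    (h' : C.num = C'.num) : C = C' := by
  obtain ⟨A, _, v, _, _, _⟩ := C
  obtain ⟨B, _, v', _, _, _⟩ := C'
  simp only at h h'
  subst h h'
  rfl

instance (n : ℕ) : MulAction (Rot n) (Chain n) where
  smul k C :=
    { toNaked := k • C.toNaked
      planar := C.planar.rotate k.toAdd
      num := fun e => C.num (e - k.toAdd)
      num_eq := fun e f => (C.num_eq _ _).trans (C.toNaked.sameRegion_rotate _ _ _).symm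
      num_surjective := C.num_surjective.comp (Equiv.subRight k.toAdd).surjective
      num_lt := fun t ht => by
        have h := C.num_lt (t - k.toAdd) ht
        rwa [sub_right_comm] at h }
  one_smul C := Chain.ext_naked (one_smul _ C.toNaked)
    (funext fun i => congrArg C.num (sub_zero i))
  mul_smul k l C := Chain.ext_naked (mul_smul k l C.toNaked)
    (funext fun i => congrArg C.num (sub_sub i k.toAdd l.toAdd).symm)

instance (n : ℕ) : Finite (Chain n) :=
  Finite.of_injective (fun C : Chain n => (C.partner, C.dir, C.num)) (by
    intro C C' h
    simp only [Prod.mk.injEq] at h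
    exact Chain.ext_naked (Naked.ext h.1 h.2.1) h.2.2)

instance (n : ℕ) : Finite (Diag (Rot n) (Chain n)) := Quotient.finite _

/-- The edges at the boundary of the region of `e`, in the order of the circle, starting
from `e`. -/
def Naked.regionEdges {n : ℕ} (D : Naked n) (e : Pt n) : List (Pt n) :=
  ((List.finRange (size n)).map (e + ·)).filter fun f => decide (D.SameRegion e f)

/-- The conjugacy class of the product of the decorations at the boundary of the region of `e`,
in the order of the circle. -/
def RigidArrow.regionClass : {n : ℕ} → RigidArrow π n → Pt n → ConjClasses π
  | 0, A, _ => A.mark.total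
  | _ + 1, A, e => ConjClasses.mk ((A.regionEdges e).map A.mark.at).prod

theorem map_add_finRange_isRotated (N : ℕ) [NeZero N] (e f : Fin N) :
    ((List.finRange N).map (e + ·)).IsRotated ((List.finRange N).map (f + ·)) := by
  refine ⟨(f - e).val, List.ext_getElem (by simp) fun i h1 h2 => ?_⟩
  have hN : i < N := by simpa using h2
  simp only [List.getElem_rotate, List.getElem_map, List.getElem_finRange, List.length_map,
    List.length_finRange]
  have : (⟨(i + (f - e).val) % N, Nat.mod_lt _ (NeZero.pos N)⟩ : Fin N) = ⟨i, hN⟩ + (f - e) :=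
    Fin.ext (by rw [Fin.val_add])
  calc e + (⟨(i + (f - e).val) % N, _⟩ : Fin N) = e + (⟨i, hN⟩ + (f - e)) := by rw [this]
    _ = f + ⟨i, hN⟩ := by abel

theorem conjClasses_prod_of_isRotated {l l' : List π} (h : l.IsRotated l') :
    ConjClasses.mk l.prod = ConjClasses.mk l'.prod := by
  obtain ⟨k, rfl⟩ := h
  rw [ConjClasses.mk_eq_mk_iff_isConj, isConj_iff]
  rw [List.rotate_eq_drop_append_take_mod, List.prod_append]
  conv in l.prod => rw [← List.take_append_drop (k % l.length) l, List.prod_append]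
  exact ⟨((l.take (k % l.length)).prod)⁻¹, by group⟩

theorem filter_isRotated {α : Type*} (p : α → Bool) {l l' : List α} (h : l.IsRotated l') :
    (l.filter p).IsRotated (l'.filter p) := by
  obtain ⟨k, rfl⟩ := h
  rw [List.rotate_eq_drop_append_take_mod, List.filter_append]
  conv in l.filter p => rw [← List.take_append_drop (k % l.length) l, List.filter_append]
  exact List.isRotated_append

theorem RigidArrow.regionClass_eq {n : ℕ} (A : RigidArrow π n) (e f : Pt n)
    (h : A.SameRegion e f) : A.regionClass e = A.regionClass f := by
  cases n with
  | zero => rfl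
  | succ n =>
    apply conjClasses_prod_of_isRotated
    apply List.IsRotated.map
    have hp : (fun g => decide (A.SameRegion e g)) = fun g => decide (A.SameRegion f g) := by
      funext g
      exact decide_eq_decide.2
        ⟨fun h' i => (h i).symm.trans (h' i), fun h' i => (h i).trans (h' i)⟩
    rw [Naked.regionEdges, Naked.regionEdges, hp]
    exact filter_isRotated _ (map_add_finRange_isRotated _ e f)

theorem RigidArrow.regionClass_smul {n : ℕ} (k : Rot n) (A : RigidArrow π n) (e : Pt n) :
    (k • A).regionClass e = A.regionClass (e - k.toAdd) := by
  cases n with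
  | zero => rfl
  | succ n =>
    have h : (A.regionEdges (e - k.toAdd)) =
        ((k • A).regionEdges e).map (fun f => f - k.toAdd) := by
      have h1 : (List.finRange (size (n + 1))).map (e - k.toAdd + ·) =
          ((List.finRange (size (n + 1))).map (e + ·)).map (fun f => f - k.toAdd) := by
        rw [List.map_map]
        exact List.map_congr_left fun i _ => sub_add_eq_add_sub _ _ _
      rw [Naked.regionEdges, Naked.regionEdges, h1, List.filter_map]
      congr 2
      funext f
      exact decide_eq_decide.2 (A.toNaked.sameRegion_rotate k.toAdd e f).symm
    show ConjClasses.mk _ = ConjClasses.mk _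
    rw [h, List.map_map]
    rfl

/-- A planar arrow diagram on `π` induces a decoration of its regions. -/
def inducedDecoration (π : Type u) [Group π] (n : ℕ) :
    PlanarArrow π n →[Rot n] Decorated π n where
  toFun A :=
    { toNaked := A.1.toNaked
      planar := A.2
      label := A.1.regionClass
      label_eq := A.1.regionClass_eq }
  map_smul' k A := Decorated.ext_naked rfl (funext fun e => A.1.regionClass_smul k e)

/-- Decorate the region number `i` of a chain presentation by `Γ i`. -/
def chainDecoration {n : ℕ} (Γ : Fin (n + 1) → ConjClasses π) :
    Chain n →[Rot n] Decorated π n where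
  toFun C :=
    { toNaked := C.toNaked
      planar := C.planar
      label := fun e => Γ (C.num e)
      label_eq := fun e f h => by rw [(C.num_eq e f).2 h] }
  map_smul' _ _ := rfl

/-- The universal planar chain of degree `n`: the sum of all chain presentations up to rotation. -/
noncomputable def universalChain (n : ℕ) : Diag (Rot n) (Chain n) →₀ ℚ :=
  Finsupp.equivFunOnFinite.symm fun _ => 1

/-- The planar chain `Φ_Γ`: decorate every diagram of the universal planar chain by `Γ`. -/
noncomputable def planarChain {n : ℕ} (Γ : Fin (n + 1) → ConjClasses π) :
    Diag (Rot n) (Decorated π n) →₀ ℚ :=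
  projection (chainDecoration Γ) (universalChain n)

/-- The lifted planar chain: the image of `Φ_Γ` in the formal series of arrow diagrams on `π`,
under the symmetry-preserving map to planar arrow diagrams (extended by zero to all arrow
diagrams). It is homogeneous of degree `n`. -/
noncomputable def liftedPlanarChain {n : ℕ} (Γ : Fin (n + 1) → ConjClasses π) : ArrowSeries π :=
  DFinsupp.single n
    (Function.extend (forget (planarIncl π n))
      (symPres (inducedDecoration π n) ⇑(planarChain Γ)) 0)

end Planar

end GaussKnot

namespace GaussKnot

universe u

/-! ### Colorings of the edges -/

section Coloring

variable {N : ℕ}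

/-! The weighted count of subdiagrams is a state sum on the whole diagram `G`
(`pairing_subdiagramSum`). A state colors the edges of `G` with `n + 1` colors. At each arrow,
either the color changes at neither end, or the colors are those of the two strands obtained by
smoothing the arrow and increase from its left to its right; the arrow is then called a jump. There
are exactly `n` jumps, the product of the decorations of color `k` has class `Γ k`, and the weight
is the product of the signs of the jumps. A chain presentation of a subdiagram gives a state of `G`:
each edge takes the number of the region that contains it. Chain presentations have no symmetry
(`Chain.smul_eq_self`), so all the automorphism factors of the symmetry-preserving maps and of the
pairing cancel, and the pairing counts states with their weights.

Consider the graph whose vertices are the colors and whose edges are the jumps. No `Γ i` is trivial,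
so every color is used (`Marking.surjective_of_colorProd`). Following the circle shows that the
graph is connected, hence has at least `n` edges (`Naked.IsColoring.le_card_jumps`); for a state it
is a tree. Two consequences carry the proof. Minimality: a state cannot be recolored on edges
decorated by `1` so as to lose jumps (`RigidArrow.IsState.not_ssubset_jumps`). Separation: removing
one jump cuts the tree of colors exactly as its arrow cuts the circle
(`Naked.IsColoring.onArc_iff`); hence jumps do not cross, color classes are regions, and no two
jumps join the same pair of colors.

A conjugacy move alters the product of a color class by a gauge transformation, thanks to
separation. By minimality no state jumps at the arrow of an R1 move, nor at both arrows of an R2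
move; the states that jump at one arrow of an R2 move cancel in pairs, by an involution that
exchanges the two arrows. For R3, the states with at most one jump among the three arrows correspond
bijectively before and after the move, by flipping the colors of the three small edges. Three jumps
are impossible. A state with two jumps is determined by its colors outside the small edges, where
three regions meet in one of two cyclic orders, with one of two positions of the middle color. These
four outer sums are common to both diagrams; crossing arrows cannot both jump, which kills the sums
of the wrong cyclic order, and the sign condition of R3 is what balances the other two
(`exchange_identity`). -/

theorem eq_of_forall_pred_eq {M : ℕ} [NeZero M] {α : Type*} (f : Fin M → α)
    (h : ∀ i, f (i - 1) = f i) (i j : Fin M) : f i = f j := by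
  have key : ∀ k : ℕ, ∀ i : Fin M, f (i - Fin.ofNat M k) = f i := by
    intro k
    induction k with
    | zero => intro i; simp
    | succ k ih =>
      intro i
      have e : (Fin.ofNat M (k + 1)) = Fin.ofNat M k + 1 := by
        apply Fin.ext; simp [Fin.val_add]
      rw [e, ← sub_sub, h, ih]
  have := key (i - j).val i
  simp at this
  exact this.symm

theorem fin_val_sub {M : ℕ} (a b : Fin M) :
    (a - b).val = if b.val ≤ a.val then a.val - b.val else M + a.val - b.val := by
  rw [Fin.val_sub]
  have ha := a.isLt
  have hb := b.isLt
  split_ifs with h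
  · rw [show M - b.val + a.val = (a.val - b.val) + M by omega, Nat.add_mod_right,
      Nat.mod_eq_of_lt (by omega)]
  · rw [Nat.mod_eq_of_lt (by omega)]; omega

theorem Naked.dir_ne_zero (D : Naked N) (hN : N ≠ 0) (i : Pt N) : D.dir i ≠ 0 :=
  fun h => hN ((D.dir_eq_zero i).1 h)

theorem Naked.mem_arrows (D : Naked N) (t : Pt N) : t ∈ D.arrows ↔ D.dir t = 1 := by
  simp [Naked.arrows]

theorem Naked.ne_zero_of_dir (D : Naked N) {t : Pt N} (ht : D.dir t = 1) : N ≠ 0 := by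
  rintro h
  rw [(D.dir_eq_zero t).2 h] at ht
  exact absurd ht (by decide)

theorem Naked.partner_ne (D : Naked N) {i : Pt N} (hi : D.dir i ≠ 0) : D.partner i ≠ i := by
  intro h
  have := D.dir_partner i
  rw [h] at this
  revert this hi
  cases D.dir i <;> decide

theorem Naked.partner_injective (D : Naked N) : Function.Injective D.partner := fun a b h => by
  rw [← D.partner_partner a, h, D.partner_partner]

theorem Naked.dir_cases (D : Naked N) (i : Pt N) (hN : N ≠ 0) :
    D.dir i = 1 ∨ D.dir (D.partner i) = 1 := by
  have h := D.dir_ne_zero hN i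
  rw [D.dir_partner]
  revert h
  cases D.dir i <;> decide

theorem Naked.onArc_self (D : Naked N) {t : Pt N} (ht : D.dir t ≠ 0) : D.OnArc t t := by
  have h : D.partner t - t ≠ 0 := sub_ne_zero.2 (D.partner_ne ht)
  rw [Naked.OnArc, sub_self]
  exact Fin.lt_def.2 (Nat.pos_of_ne_zero fun h' => h (Fin.ext h'))

theorem Naked.not_onArc_partner (D : Naked N) (t : Pt N) : ¬ D.OnArc t (D.partner t) :=
  lt_irrefl _

theorem size_eq (hN : N ≠ 0) : size N = 2 * N := by unfold size; omega

theorem fin_val_pred {M : ℕ} [NeZero M] (a : Fin M) :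
    (a - 1).val = if a = 0 then M - 1 else a.val - 1 := by
  have hM := NeZero.pos M
  have ha := a.isLt
  have h0 : a = 0 ↔ a.val = 0 := Fin.ext_iff
  simp only [fin_val_sub, Fin.val_one', h0]
  rcases Nat.lt_or_ge 1 M with h | h
  · rw [Nat.mod_eq_of_lt h]; split_ifs <;> omega
  · have : M = 1 := by omega
    subst this
    simp

/-- The arc is an interval whose only boundary points are the two ends of its arrow. This allows the
side of an arrow to be compared with the colors point by point. -/
theorem Naked.onArc_pred (D : Naked N) {t i : Pt N} (h1 : i ≠ t) (h2 : i ≠ D.partner t) :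
    D.OnArc t (i - 1) ↔ D.OnArc t i := by
  have e : i - 1 - t = i - t - 1 := sub_right_comm _ _ _
  rw [Naked.OnArc, Naked.OnArc, e, Fin.lt_def, Fin.lt_def, fin_val_pred,
    if_neg (sub_ne_zero.2 h1)]
  have h3 : (i - t).val ≠ (D.partner t - t).val := fun h => h2 (sub_left_injective (Fin.ext h))
  have h4 : (i - t).val ≠ 0 := fun h => (sub_ne_zero.2 h1) (Fin.ext h)
  omega

theorem Naked.not_onArc_pred_self (D : Naked N) (t : Pt N) : ¬ D.OnArc t (t - 1) := by
  have e : t - 1 - t = 0 - 1 := by abel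
  rw [Naked.OnArc, e, Fin.lt_def, fin_val_pred, if_pos rfl]
  have := (D.partner t - t).isLt
  omega

theorem Naked.onArc_pred_partner (D : Naked N) {t : Pt N} (ht : D.dir t ≠ 0) :
    D.OnArc t (D.partner t - 1) := by
  have h : D.partner t - t ≠ 0 := sub_ne_zero.2 (D.partner_ne ht)
  rw [Naked.OnArc, sub_right_comm, Fin.lt_def, fin_val_pred, if_neg h]
  have : (D.partner t - t).val ≠ 0 := fun h' => h (Fin.ext h')
  omega

theorem Naked.onArc_partner (D : Naked N) {t : Pt N} (ht : D.dir t ≠ 0) (e : Pt N) :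
    D.OnArc (D.partner t) e ↔ ¬ D.OnArc t e := by
  have h : (D.partner t).val ≠ t.val := fun h => D.partner_ne ht (Fin.ext h)
  simp only [Naked.OnArc, D.partner_partner, Fin.lt_def, fin_val_sub]
  have h1 := e.isLt
  have h2 := t.isLt
  have h3 := (D.partner t).isLt
  split_ifs <;> omega

/-- The rule at each arrow `t`: either the colors do not change at its two ends, or the color
increases at the tail and the colors match those of the diagram smoothed at `t`. -/
def Naked.IsColoring {K : Type*} [LinearOrder K] (D : Naked N) (c : Pt N → K) : Prop :=
  ∀ t, D.dir t = 1 →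
    (c (t - 1) = c t ∧ c (D.partner t - 1) = c (D.partner t)) ∨
    (c (t - 1) < c t ∧ c (D.partner t - 1) = c t ∧ c (D.partner t) = c (t - 1))

/-- The arrows at which the color changes. -/
def Naked.jumps {K : Type*} [DecidableEq K] (D : Naked N) (c : Pt N → K) : Finset (Pt N) :=
  D.arrows.filter fun t => c (t - 1) ≠ c t

section
variable {K : Type*} [LinearOrder K] {D : Naked N} {c : Pt N → K}

theorem Naked.mem_jumps {t : Pt N} : t ∈ D.jumps c ↔ D.dir t = 1 ∧ c (t - 1) ≠ c t := by
  simp [Naked.jumps, Naked.arrows]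

theorem Naked.IsColoring.of_mem_jumps (hc : D.IsColoring c) {t : Pt N} (ht : t ∈ D.jumps c) :
    c (t - 1) < c t ∧ c (D.partner t - 1) = c t ∧ c (D.partner t) = c (t - 1) := by
  rw [Naked.mem_jumps] at ht
  exact (hc t ht.1).resolve_left fun h => ht.2 h.1

/-- With the order of the colors forgotten, the rule is symmetric in the two ends of the arrow, so
heads and tails can be treated alike. The second alternative says that the color is constant along
the two strands of the smoothed arrow. -/
theorem Naked.IsColoring.smooth (hc : D.IsColoring c) (i : Pt N) :
    (c (i - 1) = c i ∧ c (D.partner i - 1) = c (D.partner i)) ∨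
    (c (D.partner i - 1) = c i ∧ c (D.partner i) = c (i - 1)) := by
  by_cases hN : N = 0
  · subst hN
    have : ∀ a b : Pt 0, a = b := fun a b => Subsingleton.elim (α := Fin 1) a b
    left
    exact ⟨by rw [this (i - 1) i], by rw [this (D.partner i - 1) (D.partner i)]⟩
  rcases D.dir_cases i hN with h | h
  · rcases hc i h with h | h
    · exact Or.inl h
    · exact Or.inr h.2
  · rcases hc _ h with h | h
    · rw [D.partner_partner] at h; exact Or.inl h.symm
    · rw [D.partner_partner] at h; exact Or.inr ⟨h.2.2.symm, h.2.1.symm⟩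

/-- A function of the color that does not change at the jumps is constant. -/
theorem Naked.IsColoring.comp_const (hc : D.IsColoring c) {β : Type*} (φ : K → β)
    (h : ∀ t ∈ D.jumps c, φ (c (t - 1)) = φ (c t)) (e f : Pt N) : φ (c e) = φ (c f) := by
  refine eq_of_forall_pred_eq (fun e => φ (c e)) (fun i => ?_) e f
  by_cases hi : c (i - 1) = c i
  · simp only [hi]
  have hN : N ≠ 0 := by
    rintro rfl
    exact hi (congrArg c (Subsingleton.elim (α := Fin 1) _ _))
  rcases D.dir_cases i hN with hd | hd
  · exact h i (Naked.mem_jumps.2 ⟨hd, hi⟩)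
  · have h1 := (hc.smooth i).resolve_left fun h => hi h.1
    have h2 : D.partner i ∈ D.jumps c :=
      Naked.mem_jumps.2 ⟨hd, by rw [h1.1, h1.2]; exact fun h => hi h.symm⟩
    have := h _ h2
    rw [h1.1, h1.2] at this
    exact this.symm

end

/-! ### The tree formed by the colors and the jumps -/

section Tree

variable {D : Naked N} {n : ℕ} {c : Pt N → Fin (n + 1)}

/-- The variation at the jumps of a function of the color. -/
def Naked.variation (D : Naked N) (c : Pt N → Fin (n + 1)) :
    (Fin (n + 1) → ℚ) →ₗ[ℚ] (D.jumps c → ℚ) where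
  toFun φ t := φ (c t) - φ (c (t - 1))
  map_add' φ ψ := by ext t; simp; ring
  map_smul' a φ := by ext t; simp; ring

/-- Along the circle the color changes only at ends of jumps, so the graph of colors and jumps is
connected. The variation is the coboundary of this graph, and its kernel consists of constants. -/
theorem Naked.IsColoring.ker_variation (hc : D.IsColoring c) (hs : Function.Surjective c)
    {φ : Fin (n + 1) → ℚ} (h : D.variation c φ = 0) (k l : Fin (n + 1)) : φ k = φ l := by
  obtain ⟨e, rfl⟩ := hs k
  obtain ⟨f, rfl⟩ := hs l
  refine hc.comp_const φ (fun t ht => ?_) e f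
  have := congrFun h ⟨t, ht⟩
  simp only [Naked.variation, LinearMap.coe_mk, AddHom.coe_mk, Pi.zero_apply] at this
  linarith

/-- Rank-nullity: the source has dimension `n + 1` and the kernel lies in the line of constants. -/
theorem Naked.IsColoring.le_finrank_range (hc : D.IsColoring c) (hs : Function.Surjective c) :
    n ≤ Module.finrank ℚ (LinearMap.range (D.variation c)) := by
  have h1 := LinearMap.finrank_range_add_finrank_ker (D.variation c)
  have h2 : LinearMap.ker (D.variation c) ≤ Submodule.span ℚ {fun _ => (1 : ℚ)} := by
    intro φ hφ
    rw [Submodule.mem_span_singleton]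
    refine ⟨φ 0, ?_⟩
    ext k
    simp [hc.ker_variation hs (LinearMap.mem_ker.1 hφ) k 0]
  have h3 := Submodule.finrank_mono h2
  have h4 : Module.finrank ℚ (Submodule.span ℚ {fun _ : Fin (n + 1) => (1 : ℚ)}) ≤ 1 :=
    (finrank_span_le_card _).trans (by simp)
  rw [Module.finrank_fin_fun] at h1
  omega

/-- The colors are connected by the jumps. -/
theorem Naked.IsColoring.le_card_jumps (hc : D.IsColoring c) (hs : Function.Surjective c) :
    n ≤ (D.jumps c).card := by
  have h1 := hc.le_finrank_range hs
  have h2 := Submodule.finrank_le (LinearMap.range (D.variation c))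
  simp only [Module.finrank_fintype_fun_eq_card, Fintype.card_coe] at h2
  omega

/-- A connected graph with `n + 1` vertices and `n` edges is a tree, so any function on its edges
integrates to a function on its vertices. -/
theorem Naked.IsColoring.exists_variation (hc : D.IsColoring c) (hs : Function.Surjective c)
    (hn : (D.jumps c).card = n) (f : D.jumps c → ℚ) : ∃ φ, D.variation c φ = f := by
  have h1 := hc.le_finrank_range hs
  have h2 := Submodule.finrank_le (LinearMap.range (D.variation c))
  have h3 : Module.finrank ℚ (D.jumps c → ℚ) = n := by
    simp only [Module.finrank_fintype_fun_eq_card, Fintype.card_coe, hn]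
  have h4 : LinearMap.range (D.variation c) = ⊤ :=
    Submodule.eq_top_of_finrank_eq (by omega)
  exact LinearMap.range_eq_top.1 h4 f

/-- The indicator of the arc of a jump is a function of the color. -/
theorem Naked.IsColoring.exists_indicator (hc : D.IsColoring c) (hs : Function.Surjective c)
    (hn : (D.jumps c).card = n) {t : Pt N} (ht : t ∈ D.jumps c) :
    ∃ φ : Fin (n + 1) → ℚ, (∀ t' ∈ D.jumps c, φ (c t') - φ (c (t' - 1)) = if t' = t then 1 else 0) ∧
      ∀ e, φ (c e) = if D.OnArc t e then 1 else 0 := by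
  obtain ⟨φ, hφ⟩ := hc.exists_variation hs hn (fun t' => if t'.1 = t then 1 else 0)
  have hv : ∀ t' ∈ D.jumps c, φ (c t') - φ (c (t' - 1)) = if t' = t then 1 else 0 :=
    fun t' ht' => congrFun hφ ⟨t', ht'⟩
  have hdt : D.dir t ≠ 0 := by rw [(Naked.mem_jumps.1 ht).1]; decide
  have hN := D.ne_zero_of_dir (Naked.mem_jumps.1 ht).1
  have hjt := hc.of_mem_jumps ht
  -- Both terms change only at the two ends of `t`, by `1` at the tail and by `-1` at the head, so
  -- their difference is constant around the circle.
  have key : ∀ i, φ (c (i - 1)) - (if D.OnArc t (i - 1) then 1 else 0) =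
      φ (c i) - (if D.OnArc t i then 1 else 0) := by
    intro i
    by_cases h1 : i = t
    · subst h1
      rw [if_neg (D.not_onArc_pred_self i), if_pos (D.onArc_self hdt)]
      have := hv i ht
      rw [if_pos rfl] at this
      linarith
    by_cases h2 : i = D.partner t
    · subst h2
      rw [if_pos (D.onArc_pred_partner hdt), if_neg (D.not_onArc_partner t), hjt.2.1, hjt.2.2]
      have := hv t ht
      rw [if_pos rfl] at this
      linarith
    have h3 : φ (c (i - 1)) = φ (c i) := by
      by_cases hi : c (i - 1) = c i
      · rw [hi]
      rcases D.dir_cases i hN with hd | hd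
      · have := hv i (Naked.mem_jumps.2 ⟨hd, hi⟩)
        rw [if_neg h1] at this
        linarith
      · have h4 := (hc.smooth i).resolve_left fun h => hi h.1
        have := hv _ (Naked.mem_jumps.2 ⟨hd, by rw [h4.1, h4.2]; exact fun h => hi h.symm⟩)
        rw [if_neg (by rintro rfl; exact h2 (D.partner_partner i).symm), h4.1, h4.2] at this
        linarith
    rw [h3]
    simp only [D.onArc_pred h1 h2]
  have hconst := eq_of_forall_pred_eq
    (fun i => φ (c i) - (if D.OnArc t i then 1 else 0)) key
  -- The constant is fixed at the edge `t - 1`, which is off the arc of `t`. The variations are kept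
  -- in the conclusion because the arc indicators also serve as a basis dual to the jumps.
  refine ⟨fun k => φ k - φ (c (t - 1)), fun t' ht' => by rw [← hv t' ht']; ring, fun e => ?_⟩
  have := hconst e (t - 1)
  rw [if_neg (D.not_onArc_pred_self t)] at this
  linarith

/-- Removing the jump `t` from the tree of colors leaves two components, and these are the colors on
the two sides of the arrow. -/
theorem Naked.IsColoring.onArc_iff (hc : D.IsColoring c) (hs : Function.Surjective c)
    (hn : (D.jumps c).card = n) {t : Pt N} (ht : t ∈ D.jumps c) {e f : Pt N} (h : c e = c f) :
    D.OnArc t e ↔ D.OnArc t f := by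
  obtain ⟨φ, -, hφ⟩ := hc.exists_indicator hs hn ht
  have h1 := hφ e
  rw [h, hφ f] at h1
  by_cases h2 : D.OnArc t e <;> by_cases h3 : D.OnArc t f <;> simp_all

/-- The color classes are the regions of the diagram of the jumps. -/
theorem Naked.IsColoring.eq_iff (hc : D.IsColoring c) (hs : Function.Surjective c)
    (hn : (D.jumps c).card = n) {e f : Pt N} :
    c e = c f ↔ ∀ t ∈ D.jumps c, D.OnArc t e ↔ D.OnArc t f := by
  refine ⟨fun h t ht => hc.onArc_iff hs hn ht h, fun h => ?_⟩
  choose φ hφ hφ' using fun t : D.jumps c => hc.exists_indicator hs hn t.2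
  -- Up to a constant, the indicator `ψ` of one color is a combination of the arc indicators `φ t`,
  -- since both have the same variation. Edges that no jump separates are therefore not
  -- distinguished by `ψ`.
  set ψ : Fin (n + 1) → ℚ := fun k => if k = c e then 1 else 0 with hψ
  have h1 : D.variation c (ψ - ∑ t, D.variation c ψ t • φ t) = 0 := by
    rw [map_sub, map_sum, sub_eq_zero]
    ext t
    rw [Finset.sum_apply, Finset.sum_eq_single t]
    · have := hφ t t.1 t.2
      rw [if_pos rfl] at this
      rw [map_smul, Pi.smul_apply]
      show _ = _ • (φ t (c t) - φ t (c (t - 1)))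
      rw [this]; simp
    · intro t' _ hne
      have := hφ t' t.1 t.2
      rw [if_neg fun h => hne (Subtype.ext h.symm)] at this
      rw [map_smul, Pi.smul_apply]
      show _ • (φ t' (c t) - φ t' (c (t - 1))) = _
      rw [this]; simp
    · simp
  have h2 := hc.ker_variation hs h1 (c e) (c f)
  have h3 : ∀ t, φ t (c e) = φ t (c f) := fun t => by
    rw [hφ' t, hφ' t]; simp only [h t t.2]
  simp only [Pi.sub_apply, Finset.sum_apply, Pi.smul_apply, h3, sub_left_inj, hψ, if_true] at h2
  by_contra hne
  rw [if_neg fun h => hne h.symm] at h2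
  exact one_ne_zero h2

/-- A tree has no double edge: the arc of `t` separates the two colors of `t`, but no change of side
occurs at the tail of another arrow. -/
theorem Naked.IsColoring.jump_injective (hc : D.IsColoring c) (hs : Function.Surjective c)
    (hn : (D.jumps c).card = n) {t t' : Pt N} (ht : t ∈ D.jumps c) (ht' : t' ∈ D.jumps c)
    (h1 : c (t - 1) = c (t' - 1)) (h2 : c t = c t') : t = t' := by
  by_contra hne
  have hdt : D.dir t = 1 := (Naked.mem_jumps.1 ht).1
  have h3 : t' ≠ D.partner t := by
    rintro rfl
    have := (Naked.mem_jumps.1 ht').1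
    rw [D.dir_partner, hdt] at this
    exact absurd this (by decide)
  have h4 := D.onArc_pred (Ne.symm hne) h3
  rw [← hc.onArc_iff hs hn ht h1, ← hc.onArc_iff hs hn ht h2] at h4
  exact D.not_onArc_pred_self t (h4.2 (D.onArc_self (by rw [hdt]; decide)))

/-- Two ends of jumps do not intersect. -/
theorem Naked.IsColoring.not_cross (hc : D.IsColoring c) (hs : Function.Surjective c)
    (hn : (D.jumps c).card = n) {i j : Pt N} (hi : c (i - 1) ≠ c i) (hj : c (j - 1) ≠ c j) :
    ¬ D.Cross i j := by
  rintro ⟨h1, h2, h3⟩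
  apply h3
  have hN : N ≠ 0 := by
    rintro rfl
    exact hi (congrArg c (Subsingleton.elim (α := Fin 1) _ _))
  have hji := (hc.smooth j).resolve_left fun h => hj h.1
  have hii := (hc.smooth i).resolve_left fun h => hi h.1
  have h5 : D.partner j ≠ i := by rintro rfl; exact h2 (D.partner_partner j).symm
  have h6 : D.partner j ≠ D.partner i := fun h => h1 (D.partner_injective h)
  -- The edge `partner j - 1` has the color of the edge `j`, because they belong to the same strand
  -- of the smoothing; and away from the ends of `t` it is on the same side as the edge `partner j`.
  have main : ∀ t ∈ D.jumps c, j ≠ t → j ≠ D.partner t → D.partner j ≠ t →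
      D.partner j ≠ D.partner t → (D.OnArc t j ↔ D.OnArc t (D.partner j)) := by
    intro t ht _ _ h7 h8
    rw [← D.onArc_pred h7 h8]
    exact hc.onArc_iff hs hn ht hji.1.symm
  rcases D.dir_cases i hN with hd | hd
  · exact main i (Naked.mem_jumps.2 ⟨hd, hi⟩) h1 h2 h5 h6
  · have := main (D.partner i)
      (Naked.mem_jumps.2 ⟨hd, by rw [hii.1, hii.2]; exact fun h => hi h.symm⟩) h2
      (by rwa [D.partner_partner]) h6 (by rwa [D.partner_partner])
    rw [D.onArc_partner (D.dir_ne_zero hN i), D.onArc_partner (D.dir_ne_zero hN i)] at this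
    exact not_iff_not.1 this

end Tree

end Coloring

/-! ### States -/

section State

variable {π : Type u} [Group π]

/-- The conjugacy class of the product of the decorations of the edges of color `k`, in the order
of the circle. -/
def Marking.colorProd {K : Type*} [DecidableEq K] :
    {N : ℕ} → Marking π N → (Pt N → K) → K → ConjClasses π
  | 0, x, c, k => if c 0 = k then x else ConjClasses.mk 1
  | N + 1, μ, c, k =>
    ConjClasses.mk ((List.finRange (size (N + 1))).map fun e => if c e = k then μ e else 1).prod

theorem Marking.colorProd_of_ne {K : Type*} [DecidableEq K] {N : ℕ} (μ : Marking π N)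
    {c : Pt N → K} {k : K} (h : ∀ e, c e ≠ k) : μ.colorProd c k = ConjClasses.mk 1 := by
  cases N with
  | zero => exact if_neg (h 0)
  | succ N => simp [Marking.colorProd, h]

/-- Edges decorated by `1` are invisible in the products and may be recolored freely; every
Reidemeister move relies on this. On a circle without arrows `Marking.at` only has the default value
`1`, hence the condition `N ≠ 0`. -/
theorem Marking.colorProd_congr {K : Type*} [DecidableEq K] {N : ℕ} (hN : N ≠ 0)
    (μ : Marking π N) {c c' : Pt N → K} (h : ∀ e, c e ≠ c' e → μ.at e = 1) (k : K) :
    μ.colorProd c k = μ.colorProd c' k := by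
  cases N with
  | zero => exact absurd rfl hN
  | succ N =>
    simp only [Marking.colorProd]
    congr 3
    funext e
    by_cases he : c e = c' e
    · rw [he]
    · have : μ e = 1 := h e he
      simp [this]

theorem list_prod_map_filter {α M : Type*} [Monoid M] (l : List α) (p : α → Bool) (f : α → M) :
    ((l.filter p).map f).prod = (l.map fun x => if p x then f x else 1).prod := by
  induction l with
  | nil => rfl
  | cons a l ih => by_cases h : p a <;> simp [h, ih]

/-- One product starts at `e`, the other at the base point of the circle; they differ by a cyclic
rotation, which a conjugacy class does not see. -/
theorem RigidArrow.regionClass_eq_colorProd {K : Type*} [DecidableEq K] {N : ℕ}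
    (A : RigidArrow π N) {c : Pt N → K} (h : ∀ e f, c e = c f ↔ A.SameRegion e f) (e : Pt N) :
    A.regionClass e = A.mark.colorProd c (c e) := by
  cases N with
  | zero =>
    obtain ⟨D, μ⟩ := A
    have : c 0 = c e := congrArg c (Subsingleton.elim (α := Fin 1) _ _)
    exact (if_pos this).symm
  | succ N =>
    show ConjClasses.mk _ = ConjClasses.mk _
    rw [Naked.regionEdges, list_prod_map_filter]
    refine conjClasses_prod_of_isRotated ?_
    have h1 := (map_add_finRange_isRotated (size (N + 1)) e 0).map
      fun x => if decide (A.SameRegion e x) = true then A.mark.at x else 1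
    convert h1 using 1
    rw [List.map_map]
    refine List.map_congr_left fun x _ => ?_
    simp only [Function.comp, zero_add, decide_eq_true_eq, ← h, eq_comm (a := c e)]
    rfl

/-- A state: a coloring of the edges with exactly `n` jumps, such that the products of the
decorations of the color classes are prescribed. -/
structure RigidArrow.IsState {N n : ℕ} (A : RigidArrow π N) (Γ : Fin (n + 1) → ConjClasses π)
    (c : Pt N → Fin (n + 1)) : Prop where
  coloring : A.IsColoring c
  card_jumps : (A.jumps c).card = n
  colorProd : ∀ k, A.mark.colorProd c k = Γ k

/-- The product of the signs of the jumps. -/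
def RigidGauss.weight {K : Type*} [DecidableEq K] {N : ℕ} (G : RigidGauss π N) (c : Pt N → K) : ℚ :=
  ∏ t ∈ G.jumps c, (G.writhe t : ℚ)

open Classical in
/-- The states of a diagram. -/
noncomputable def RigidArrow.states {N n : ℕ} (A : RigidArrow π N)
    (Γ : Fin (n + 1) → ConjClasses π) : Finset (Pt N → Fin (n + 1)) :=
  Finset.univ.filter fun c => A.IsState Γ c

theorem RigidArrow.mem_states {N n : ℕ} {A : RigidArrow π N} {Γ : Fin (n + 1) → ConjClasses π}
    {c : Pt N → Fin (n + 1)} : c ∈ A.states Γ ↔ A.IsState Γ c := by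
  simp [RigidArrow.states]

/-- The state sum. -/
noncomputable def RigidGauss.stateSum {N n : ℕ} (G : RigidGauss π N)
    (Γ : Fin (n + 1) → ConjClasses π) : ℚ :=
  ∑ c ∈ G.states Γ, G.weight c

/-- An unused color would have an empty product, of class `1`. This is how the non-triviality of the
classes `Γ i` enters the proof. -/
theorem Marking.surjective_of_colorProd {N n : ℕ} {μ : Marking π N}
    {Γ : Fin (n + 1) → ConjClasses π} (hΓ : ∀ i, Γ i ≠ ConjClasses.mk 1)
    {c : Pt N → Fin (n + 1)} (h : ∀ k, μ.colorProd c k = Γ k) : Function.Surjective c := by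
  intro k
  by_contra hk
  push Not at hk
  exact hΓ k (by rw [← h k, μ.colorProd_of_ne hk])

theorem Naked.card_arrows {N : ℕ} (D : Naked N) : D.arrows.card = N := by
  by_cases hN : N = 0
  · subst hN
    rw [Finset.card_eq_zero, Finset.eq_empty_iff_forall_notMem]
    intro t ht
    exact D.ne_zero_of_dir ((D.mem_arrows t).1 ht) rfl
  · have h1 : D.arrows ∪ D.arrows.image D.partner = Finset.univ := by
      ext i
      simp only [Finset.mem_union, Finset.mem_image, Finset.mem_univ, iff_true]
      rcases D.dir_cases i hN with h | h
      · exact Or.inl ((D.mem_arrows i).2 h)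
      · exact Or.inr ⟨_, (D.mem_arrows _).2 h, D.partner_partner i⟩
    obtain ⟨m, hm⟩ : ∃ m, D.arrows.card = m + 1 := by
      refine Nat.exists_eq_succ_of_ne_zero fun h => ?_
      rw [Finset.card_eq_zero] at h
      rw [h] at h1
      have := h1 ▸ Finset.mem_univ (0 : Pt N)
      simp at this
    have h2 := D.card_ends (Finset.Subset.refl _) hm
    rw [Naked.ends, h1, Finset.card_univ, Fintype.card_fin, size_eq hN, size_eq (by omega)] at h2
    omega

/-- There are as many jumps as arrows when the diagram has degree `n`, so every arrow jumps. -/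
theorem RigidArrow.IsState.jumps_eq {n : ℕ} {A : RigidArrow π n}
    {Γ : Fin (n + 1) → ConjClasses π} {c : Pt n → Fin (n + 1)} (h : A.IsState Γ c) :
    A.jumps c = A.arrows :=
  Finset.eq_of_subset_of_card_le (Finset.filter_subset _ _) (by rw [h.card_jumps, A.card_arrows])

theorem Naked.Planar.onArc_iff {N : ℕ} {D : Naked N} (h : D.Planar) {i j : Pt N} (h1 : j ≠ i)
    (h2 : j ≠ D.partner i) : D.OnArc i j ↔ D.OnArc i (D.partner j) :=
  not_not.1 fun h3 => h i j ⟨h1, h2, h3⟩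

/-- These two edges run along the same side of the arrow of `t`, and by planarity no other arrow
separates the two ends of that arrow. -/
theorem Naked.Planar.sameRegion_pred_partner {N : ℕ} {D : Naked N} (h : D.Planar) {t : Pt N}
    (ht : D.dir t ≠ 0) : D.SameRegion (D.partner t - 1) t := by
  intro i
  have hpt : D.dir (D.partner t) ≠ 0 := by
    rw [D.dir_partner]; revert ht; cases D.dir t <;> decide
  by_cases h1 : t = i
  · subst h1
    exact iff_of_true (D.onArc_pred_partner ht) (D.onArc_self ht)
  by_cases h2 : t = D.partner i
  · have h3 : i = D.partner t := by rw [h2, D.partner_partner]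
    subst h3
    rw [D.onArc_partner ht, D.onArc_partner ht]
    exact iff_of_false (not_not.2 (D.onArc_pred_partner ht)) (not_not.2 (D.onArc_self ht))
  · rw [h.onArc_iff h1 h2]
    exact D.onArc_pred (fun h3 => h2 (by rw [← h3, D.partner_partner]))
      fun h3 => h1 (D.partner_injective h3)

/-- Each side of an arrow of a planar diagram borders a single region, so smoothing the arrow
respects the numbering, and the chain condition is the required inequality. -/
theorem Chain.isColoring {n : ℕ} (C : Chain n) : C.toNaked.IsColoring C.num := by
  intro t ht
  have h0 : C.dir t ≠ 0 := by rw [ht]; decide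
  have h1 : C.dir (C.partner t) ≠ 0 := by rw [C.dir_partner, ht]; decide
  refine Or.inr ⟨C.num_lt t ht, (C.num_eq _ _).2 (C.planar.sameRegion_pred_partner h0), ?_⟩
  have h2 := (C.num_eq _ _).2 (C.planar.sameRegion_pred_partner h1)
  rw [C.partner_partner] at h2
  exact h2.symm

theorem RigidArrow.IsState.ne_pred {n : ℕ} {A : RigidArrow π n}
    {Γ : Fin (n + 1) → ConjClasses π} {c : Pt n → Fin (n + 1)} (h : A.IsState Γ c) (hn : n ≠ 0)
    (i : Pt n) : c (i - 1) ≠ c i := by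
  rcases A.dir_cases i hn with hd | hd
  · exact (Naked.mem_jumps.1 (h.jumps_eq ▸ (A.mem_arrows i).2 hd)).2
  · have h1 : A.partner i ∈ A.jumps c := h.jumps_eq ▸ (A.mem_arrows _).2 hd
    have h2 := h.coloring.of_mem_jumps h1
    rw [A.partner_partner] at h2
    rw [h2.2.1, h2.2.2]
    exact h2.1.ne'

/-- The chain of a state of full degree. -/
def RigidArrow.IsState.chain {n : ℕ} {A : RigidArrow π n}
    {Γ : Fin (n + 1) → ConjClasses π} (hΓ : ∀ i, Γ i ≠ ConjClasses.mk 1)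
    {c : Pt n → Fin (n + 1)} (h : A.IsState Γ c) : Chain n where
  toNaked := A.toNaked
  planar := fun i j hij => by
    have hn : n ≠ 0 := by
      rintro rfl
      exact hij.1 (Subsingleton.elim (α := Fin 1) _ _)
    exact h.coloring.not_cross (Marking.surjective_of_colorProd hΓ h.colorProd) h.card_jumps
      (h.ne_pred hn i) (h.ne_pred hn j) hij
  num := c
  num_eq := fun e f => by
    rw [h.coloring.eq_iff (Marking.surjective_of_colorProd hΓ h.colorProd) h.card_jumps,
      h.jumps_eq]
    refine ⟨fun H i => ?_, fun H t _ => H t⟩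
    by_cases hn : n = 0
    · subst hn
      rw [show e = f from Subsingleton.elim (α := Fin 1) _ _]
    rcases A.dir_cases i hn with hd | hd
    · exact H i ((A.mem_arrows i).2 hd)
    · have := H _ ((A.mem_arrows _).2 hd)
      rw [A.onArc_partner (A.dir_ne_zero hn i), A.onArc_partner (A.dir_ne_zero hn i)] at this
      exact not_iff_not.1 this
  num_surjective := Marking.surjective_of_colorProd hΓ h.colorProd
  num_lt := fun t ht => (h.coloring.of_mem_jumps (h.jumps_eq ▸ (A.mem_arrows t).2 ht)).1

theorem RigidArrow.IsState.planar {n : ℕ} {A : RigidArrow π n}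
    {Γ : Fin (n + 1) → ConjClasses π} (hΓ : ∀ i, Γ i ≠ ConjClasses.mk 1)
    {c : Pt n → Fin (n + 1)} (h : A.IsState Γ c) : A.Planar :=
  (h.chain hΓ).planar

/-- The chains that induce the decoration of a planar arrow diagram are its states. -/
theorem card_chains_eq {n : ℕ} (A : PlanarArrow π n) (Γ : Fin (n + 1) → ConjClasses π)
    (hΓ : ∀ i, Γ i ≠ ConjClasses.mk 1) :
    Nat.card {C : Chain n // chainDecoration Γ C = inducedDecoration π n A} =
      (A.1.states Γ).card := by
  rw [← Nat.subtype_card (A.1.states Γ) fun _ => RigidArrow.mem_states]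
  refine Nat.card_congr
    { toFun := fun C => ⟨C.1.num, ?_⟩
      invFun := fun c => ⟨c.2.chain hΓ, Decorated.ext_naked rfl (funext fun e => ?_)⟩
      left_inv := ?_
      right_inv := fun c => rfl }
  · have h1 : C.1.toNaked = A.1.toNaked := congrArg Decorated.toNaked C.2
    have h2 : ∀ e, Γ (C.1.num e) = A.1.regionClass e := congrFun (congrArg Decorated.label C.2)
    have h3 := C.1.num_eq
    have h4 := C.1.isColoring
    have h5 := C.1.num_lt
    rw [h1] at h3 h4 h5
    refine ⟨h4, ?_, fun k => ?_⟩
    · rw [Naked.jumps, Finset.filter_true_of_mem, A.1.card_arrows]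
      exact fun t ht => (h5 t ((Naked.mem_arrows _ t).1 ht)).ne
    · obtain ⟨e, rfl⟩ := C.1.num_surjective k
      rw [h2, A.1.regionClass_eq_colorProd h3]
  · show Γ (c.1 e) = A.1.regionClass e
    rw [A.1.regionClass_eq_colorProd (c.2.chain hΓ).num_eq, ← c.2.colorProd]
    rfl
  · rintro ⟨C, hC⟩
    exact Subtype.ext (Chain.ext_naked (congrArg Decorated.toNaked hC).symm rfl)

end State

/-! ### Counting symmetries -/

section Aut

variable {K : Type*} [CommGroup K] {X Y : Type*} [MulAction K X] [MulAction K Y]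

theorem forget_diag (f : X →[K] Y) (x : X) : forget f (diag x : Diag K X) = diag (f x) := rfl

theorem diag_eq_iff (x y : X) : (diag x : Diag K X) = diag y ↔ ∃ k : K, k • y = x :=
  (@Quotient.eq'' _ (MulAction.orbitRel K X) x y).trans (by rfl)

theorem autOrder_diag (x : X) :
    autOrder (diag x : Diag K X) = Nat.card (MulAction.stabilizer K x) := rfl

/-- Orbit-stabilizer: the stabilizer of `f x` acts transitively on the points of the orbit of `x`
that lie over `f x`, and it contains the stabilizer of `x`. -/
theorem autOrder_mul_fibreCount [Finite K] (f : X →[K] Y) (x : X) :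
    autOrder (diag x : Diag K X) * fibreCount f (diag x) =
      Nat.card (MulAction.stabilizer K (f x)) := by
  show Nat.card (MulAction.stabilizer K x) *
    Nat.card {x' : X // x' ∈ MulAction.orbit K x ∧ f x' = f x} = _
  rw [← Nat.card_prod]
  choose r hr using fun x' : {x' : X // x' ∈ MulAction.orbit K x ∧ f x' = f x} => x'.2.1
  replace hr : ∀ x', r x' • x = x'.1 := hr
  have key : ∀ x' (k : MulAction.stabilizer K x), (r x' * k.1) • x = x'.1 := fun x' k => by
    rw [mul_smul, MulAction.mem_stabilizer_iff.1 k.2, hr]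
  refine Nat.card_congr (Equiv.ofBijective
    (fun p => ⟨r p.2 * p.1.1, MulAction.mem_stabilizer_iff.2 ?_⟩) ⟨?_, ?_⟩)
  · rw [← map_smul, key, p.2.2.2]
  · rintro ⟨k, x'⟩ ⟨l, y'⟩ h
    have h1 : r x' * k.1 = r y' * l.1 := congrArg Subtype.val h
    have h2 : x' = y' := Subtype.ext (by rw [← key x' k, ← key y' l, h1])
    subst h2
    simpa using h1
  · rintro ⟨k, hk⟩
    have hk' : f (k • x) = f x := by rw [map_smul]; exact hk
    refine ⟨(⟨(r ⟨k • x, ⟨k, rfl⟩, hk'⟩)⁻¹ * k, ?_⟩, ⟨k • x, ⟨k, rfl⟩, hk'⟩), ?_⟩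
    · rw [MulAction.mem_stabilizer_iff, mul_smul, inv_smul_eq_iff, hr]
    · simp

/-- The stabilizer of `y` acts freely on the fibre over `y`, and its orbits there are the diagrams
that map to the class of `y`. -/
theorem card_stabilizer_mul_card_forget [Finite K] (f : X →[K] Y) (y : Y)
    (hfree : ∀ (k : K) (x : X), k • x = x → k = 1) :
    Nat.card (MulAction.stabilizer K y) * Nat.card {Q : Diag K X // forget f Q = diag y} =
      Nat.card {x : X // f x = y} := by
  rw [← Nat.card_prod]
  have hex : ∀ Q : {Q : Diag K X // forget f Q = diag y}, ∃ x : X, diag x = Q.1 ∧ f x = y := by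
    rintro ⟨Q, hQ⟩
    induction Q using Quotient.inductionOn with
    | h x =>
      obtain ⟨k, hk⟩ := (diag_eq_iff (K := K) y (f x)).1 hQ.symm
      exact ⟨k • x, (diag_eq_iff (K := K) _ _).2 ⟨k, rfl⟩, by rw [map_smul, hk]⟩
  choose r hr hr' using hex
  refine Nat.card_congr (Equiv.ofBijective (fun p => ⟨p.1.1 • r p.2, ?_⟩) ⟨?_, ?_⟩)
  · rw [map_smul, hr', MulAction.mem_stabilizer_iff.1 p.1.2]
  · rintro ⟨k, P⟩ ⟨l, Q⟩ h
    have h1 : k.1 • r P = l.1 • r Q := congrArg Subtype.val h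
    have h2 : P = Q := by
      refine Subtype.ext ?_
      rw [← hr P, ← hr Q, diag_eq_iff]
      exact ⟨k.1⁻¹ * l.1, by rw [mul_smul, ← h1, inv_smul_smul]⟩
    subst h2
    have h3 : k.1⁻¹ * l.1 = 1 := hfree _ (r P) (by rw [mul_smul, ← h1, inv_smul_smul])
    rw [inv_mul_eq_one] at h3
    simp [Subtype.ext h3]
  · rintro ⟨x, hx⟩
    have hQ : forget f (diag x : Diag K X) = diag y := by rw [forget_diag, hx]
    obtain ⟨k, hk⟩ := (diag_eq_iff (K := K) x (r ⟨diag x, hQ⟩)).1 (hr ⟨diag x, hQ⟩).symm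
    refine ⟨(⟨k, ?_⟩, ⟨diag x, hQ⟩), Subtype.ext hk⟩
    have h1 := congrArg f hk
    rwa [map_smul, hr', hx] at h1

end Aut

/-- A chain presentation has no symmetry. -/
theorem Chain.smul_eq_self {n : ℕ} (k : Rot n) (C : Chain n) (h : k • C = C) : k = 1 := by
  by_contra hk
  have hn : n ≠ 0 := by
    rintro rfl
    exact hk (Subsingleton.elim (α := Fin 1) _ _)
  have hp : ∀ i, C.partner (i - k.toAdd) + k.toAdd = C.partner i :=
    congrFun (congrArg (fun C : Chain n => C.partner) h)
  have hd : ∀ i, C.dir (i - k.toAdd) = C.dir i :=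
    congrFun (congrArg (fun C : Chain n => C.dir) h)
  have hnum : ∀ i, C.num (i - k.toAdd) = C.num i :=
    congrFun (congrArg (fun C : Chain n => C.num) h)
  have hr := fun i => (C.num_eq _ _).1 (hnum i)
  -- A rotation that preserves the numbering keeps each edge in its region. So the edge `0 - k` is
  -- on the arc of the arrow at `0`, like the edge `0`, whereas the edge `partner 0 - k` is off it,
  -- like the edge `partner 0`. The arrows at `0` and `0 - k` thus cross, unless they coincide;
  -- their directions then force `k = 1`.
  have h0 := C.dir_ne_zero hn 0
  have h1 : C.OnArc 0 (0 - k.toAdd) := (hr 0 0).2 (C.onArc_self h0)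
  have h2 : ¬ C.OnArc 0 (C.partner (0 - k.toAdd)) := by
    rw [eq_sub_of_add_eq (hp 0)]
    exact fun h => C.not_onArc_partner 0 ((hr _ 0).1 h)
  refine C.planar 0 (0 - k.toAdd) ⟨fun h => hk ?_, fun h => ?_, fun h => h2 (h.1 h1)⟩
  · rw [zero_sub, neg_eq_zero] at h
    exact h
  · have := hd 0
    rw [h, C.dir_partner] at this
    revert this h0
    cases C.dir 0 <;> decide

/-! ### Coefficients of the lifted chain as numbers of states -/

section Pairing

variable {π : Type u} [Group π]

theorem planarChain_diag {n : ℕ} (Γ : Fin (n + 1) → ConjClasses π) (D : Decorated π n) :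
    planarChain Γ (diag D) =
      Nat.card {Q : Diag (Rot n) (Chain n) // forget (chainDecoration Γ) Q = diag D} := by
  classical
  have : Fintype (Diag (Rot n) (Chain n)) := Fintype.ofFinite _
  rw [planarChain, projection, Finsupp.lmapDomain_apply, Finsupp.mapDomain, Finsupp.sum_apply,
    Finsupp.sum_fintype _ _ (by simp), Nat.card_eq_fintype_card, Fintype.card_subtype]
  simp [universalChain, Finsupp.single_apply]

/-- Let `D` be the decorated diagram induced by a planar `A`. The order of `Aut A` times the fibre
count is the order of `Aut D`; multiplied by the number of chain diagrams over `D`, it gives the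
number of rigid chains over `D`, since chains have no symmetry. These chains are the states of `A`.
A diagram that is not planar has coefficient zero and no states. -/
theorem autOrder_mul_liftedPlanarChain {n : ℕ} (Γ : Fin (n + 1) → ConjClasses π)
    (hΓ : ∀ i, Γ i ≠ ConjClasses.mk 1) (A : RigidArrow π n) :
    (autOrder (diag A : ArrowDiagram π n) : ℚ) * liftedPlanarChain Γ n (diag A) =
      (A.states Γ).card := by
  rw [liftedPlanarChain, DFinsupp.single_eq_same]
  have hinj : Function.Injective (forget (planarIncl π n)) := by
    intro P Q h
    induction P using Quotient.inductionOn with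
    | h P =>
      induction Q using Quotient.inductionOn with
      | h Q =>
        obtain ⟨k, hk⟩ := (diag_eq_iff (K := Rot n) P.1 Q.1).1 h
        exact (diag_eq_iff (K := Rot n) P Q).2 ⟨k, Subtype.ext hk⟩
  by_cases hA : A.Planar
  · obtain ⟨P, rfl⟩ : ∃ P : PlanarArrow π n, P.1 = A := ⟨⟨A, hA⟩, rfl⟩
    have h1 : (diag P.1 : ArrowDiagram π n) = forget (planarIncl π n) (diag P) := rfl
    rw [h1, hinj.extend_apply, ← h1]
    have h2 := autOrder_mul_fibreCount (K := Rot n) (inducedDecoration π n) P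
    have h3 := card_stabilizer_mul_card_forget (K := Rot n) (chainDecoration Γ)
      (inducedDecoration π n P) Chain.smul_eq_self
    rw [card_chains_eq _ Γ hΓ, ← h2] at h3
    have h4 : autOrder (diag P.1 : ArrowDiagram π n) =
        autOrder (diag P : Diag (Rot n) (PlanarArrow π n)) := by
      rw [autOrder_diag, autOrder_diag]
      refine Nat.card_congr (Equiv.subtypeEquivRight fun k => ?_)
      rw [MulAction.mem_stabilizer_iff, MulAction.mem_stabilizer_iff]
      exact ⟨fun h => Subtype.ext h, fun h => congrArg Subtype.val h⟩
    rw [← h3, h4]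
    show _ * ((_ : ℚ) * _) = _
    rw [forget_diag, planarChain_diag]
    push_cast
    ring
  · rw [Function.extend_apply', Pi.zero_apply, mul_zero, eq_comm, Nat.cast_eq_zero,
      Finset.card_eq_zero, Finset.eq_empty_iff_forall_notMem]
    · exact fun c hc => hA ((RigidArrow.mem_states.1 hc).planar hΓ)
    · rintro ⟨P, hP⟩
      induction P using Quotient.inductionOn with
      | h P =>
        obtain ⟨k, hk⟩ := (diag_eq_iff (K := Rot n) P.1 A).1 hP
        have h1 : A = k⁻¹ • P.1 := by rw [← hk, inv_smul_smul]
        rw [h1] at hA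
        exact hA (P.2.rotate _)

theorem RigidArrow.IsState.weight_eq {n : ℕ} {G : RigidGauss π n}
    {Γ : Fin (n + 1) → ConjClasses π} {c : Pt n → Fin (n + 1)} (h : G.IsState Γ c) :
    G.weight c = G.sign := by
  rw [RigidGauss.weight, h.jumps_eq, RigidGauss.sign, Naked.arrows, Finset.prod_filter]

theorem autOrder_ne_zero {n : ℕ} {X : Type*} [MulAction (Rot n) X] (D : Diag (Rot n) X) :
    autOrder D ≠ 0 := by
  induction D using Quotient.inductionOn with
  | h x => exact Nat.card_pos.ne'

/-- The pairing with a single diagram. -/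
theorem pairing_single_diag {n m : ℕ} (Γ : Fin (n + 1) → ConjClasses π)
    (hΓ : ∀ i, Γ i ≠ ConjClasses.mk 1) (G : RigidGauss π m) :
    pairing (signedSymPres (liftedPlanarChain Γ)) (Finsupp.single ⟨m, diag G⟩ 1) =
      if m = n then G.stateSum Γ else 0 := by
  rw [pairing, Finsupp.sum_single_index (by simp), mul_one]
  by_cases h : m = n
  · subst h
    rw [if_pos rfl, signedSymPres, DFinsupp.mapRange_apply, RigidGauss.stateSum,
      Finset.sum_congr rfl fun c hc => (RigidArrow.mem_states.1 hc).weight_eq, Finset.sum_const,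
      nsmul_eq_mul, ← autOrder_mul_liftedPlanarChain Γ hΓ]
    have h1 : (autOrder (diag G : GaussDiagram π m) : ℚ) ≠ 0 :=
      Nat.cast_ne_zero.2 (autOrder_ne_zero _)
    have h2 : gaussSign (diag G : GaussDiagram π m) = G.sign := rfl
    have h3 : forget (forgetSigns π m) (diag G) = diag G.toRigidArrow := rfl
    simp only [h2, h3]
    field_simp
  · rw [if_neg h, signedSymPres, DFinsupp.mapRange_apply, liftedPlanarChain,
      DFinsupp.single_eq_of_ne h]
    simp

end Pairing

/-! ### States of subdiagrams -/

section Circle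

theorem forall_of_pred {M : ℕ} [NeZero M] {Q : Fin M → Prop} (h : ∀ i, Q (i - 1) → Q i)
    {i₀ : Fin M} (h₀ : Q i₀) (i : Fin M) : Q i := by
  have key : ∀ k : ℕ, Q (i₀ + Fin.ofNat M k) := by
    intro k
    induction k with
    | zero => simpa using h₀
    | succ k ih =>
      apply h
      have e : (Fin.ofNat M (k + 1)) = Fin.ofNat M k + 1 := by
        apply Fin.ext; simp [Fin.val_add]
      rwa [e, ← add_assoc, add_sub_cancel_right]
  have := key (i - i₀).val
  simpa using this

theorem ofNat_add {M : ℕ} [NeZero M] (a b : ℕ) :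
    Fin.ofNat M (a + b) = Fin.ofNat M a + Fin.ofNat M b := by
  apply Fin.ext; simp [Fin.val_add]

theorem ofNat_self {M : ℕ} [NeZero M] : Fin.ofNat M M = 0 := by
  apply Fin.ext; simp

/-- Collapse the points of a circle that are not in a given set. -/
theorem exists_collapse {N M : ℕ} [NeZero N] [NeZero M] (E : Finset (Fin N)) (ι : Fin M ≃o E) :
    ∃ ρ : Fin N → Fin M, (∀ j, ρ (ι j) = j) ∧ (∀ j, ρ (ι j - 1) = j - 1) ∧
      ∀ i ∉ E, ρ (i - 1) = ρ i := by
  -- The edge `e` collapses to the edge that starts at the last chosen point up to `e`, of index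
  -- `cnt e - 1` modulo `M`. Edges before the first chosen point have count `0` and go to the last
  -- edge, as they should on a circle.
  set cnt : Fin N → ℕ := fun e => (E.filter (· ≤ e)).card with hcnt
  have hE : E.card = M := by
    have := Fintype.card_congr ι.toEquiv
    simpa using this.symm
  have h1 : ∀ j, cnt (ι j) = j.val + 1 := by
    intro j
    rw [← Fin.card_Iic j, hcnt]
    symm
    refine Finset.card_bij (fun a _ => (ι a : Fin N)) ?_ ?_ ?_
    · intro a ha
      simp only [Finset.mem_filter, Finset.coe_mem, true_and]
      exact ι.monotone (Finset.mem_Iic.1 ha)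
    · intro a _ b _ h
      exact ι.injective (Subtype.ext h)
    · intro b hb
      rw [Finset.mem_filter] at hb
      refine ⟨ι.symm ⟨b, hb.1⟩, Finset.mem_Iic.2 ?_, by simp⟩
      rw [OrderIso.symm_apply_le]
      exact hb.2
  have h2 : ∀ i, Fin.ofNat M (cnt i) = Fin.ofNat M (cnt (i - 1)) + if i ∈ E then 1 else 0 := by
    intro i
    by_cases hi : i = 0
    -- At the base point the count falls from `M` back to `0` or `1`, which is invisible modulo `M`.
    · subst hi
      have h3 : cnt (0 - 1) = M := by
        rw [← hE]
        show (E.filter (· ≤ (0 - 1 : Fin N))).card = E.card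
        congr 1
        refine Finset.filter_true_of_mem fun e _ => ?_
        rw [Fin.le_def, fin_val_pred, if_pos rfl]
        have := e.isLt
        omega
      have h4 : cnt 0 = if (0 : Fin N) ∈ E then 1 else 0 := by
        rw [hcnt]
        split_ifs with h
        · rw [Finset.card_eq_one]
          refine ⟨0, ?_⟩
          ext e
          simp only [Finset.mem_filter, Finset.mem_singleton, nonpos_iff_eq_zero]
          exact ⟨fun h' => h'.2, fun h' => ⟨h' ▸ h, h'⟩⟩
        · rw [Finset.card_eq_zero, Finset.eq_empty_iff_forall_notMem]
          intro e he
          simp only [Finset.mem_filter, nonpos_iff_eq_zero] at he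
          exact h (he.2 ▸ he.1)
      rw [h3, h4, ofNat_self, zero_add]
      split_ifs <;> (apply Fin.ext; simp)
    · have hv : (i - 1).val + 1 = i.val := by
        rw [fin_val_pred, if_neg hi]
        have : i.val ≠ 0 := fun h => hi (Fin.ext h)
        omega
      have h3 : cnt i = cnt (i - 1) + if i ∈ E then 1 else 0 := by
        rw [hcnt]
        have h5 : E.filter (· ≤ i) = E.filter (· ≤ i - 1) ∪ E.filter (· = i) := by
          ext e
          simp only [Finset.mem_union, Finset.mem_filter, Fin.le_def, Fin.ext_iff, ← and_or_left]
          refine and_congr_right fun _ => ?_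
          omega
        simp only [h5]
        rw [Finset.card_union_of_disjoint, Finset.filter_eq']
        · split_ifs <;> simp
        · rw [Finset.disjoint_left]
          intro e he he'
          simp only [Finset.mem_filter, Fin.le_def] at he he'
          rw [he'.2] at he
          omega
      rw [h3, ofNat_add]
      split_ifs
      · congr 1
      · congr 1
  refine ⟨fun e => Fin.ofNat M (cnt e) - 1, fun j => ?_, fun j => ?_, fun i hi => ?_⟩
  · simp only [h1]
    rw [ofNat_add, show Fin.ofNat M 1 = 1 from rfl, add_sub_cancel_right]
    simp
  · have := h2 (ι j)
    rw [if_pos (ι j).2, h1, ofNat_add, show Fin.ofNat M 1 = 1 from rfl] at this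
    simp only
    rw [← add_right_cancel this]
    simp
  · have := h2 i
    rw [if_neg hi, add_zero] at this
    simp only [this]

theorem prod_range_segments {π : Type*} [Monoid π] (F : ℕ → π) (q : ℕ → ℕ) (h0 : q 0 = 0) (M : ℕ)
    (hq : ∀ j < M, q j ≤ q (j + 1)) :
    ((List.range M).map fun j =>
      ((List.range (q (j + 1) - q j)).map fun k => F (q j + k)).prod).prod =
      ((List.range (q M)).map F).prod := by
  induction M with
  | zero => simp [h0]
  | succ M ih =>
    have h1 := hq M (Nat.lt_succ_self M)
    obtain ⟨d, hd⟩ := Nat.exists_eq_add_of_le h1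
    rw [List.range_succ, List.map_append, List.prod_append,
      ih fun j hj => hq j (hj.trans (Nat.lt_succ_self M)), hd, List.range_add, List.map_append,
      List.prod_append, List.map_map]
    simp [hd, Function.comp_def]

theorem map_finRange_eq {M : ℕ} [NeZero M] {α : Type*} (f : Fin M → α) :
    (List.finRange M).map f = (List.range M).map fun j => f (Fin.ofNat M j) := by
  refine List.ext_getElem (by simp) fun i h1 h2 => ?_
  have : i < M := by simpa using h1
  simp only [List.getElem_map, List.getElem_finRange, List.getElem_range]
  congr 1
  apply Fin.ext
  simp [Nat.mod_eq_of_lt this]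

/-- The circle is the concatenation of the segments between successive points of a subset. -/
theorem prod_segments {π : Type*} [Monoid π] {N M : ℕ} [NeZero N] [NeZero M] (hM : 2 ≤ M)
    (ι : Fin M → Fin N) (hι : StrictMono ι) (F : Fin N → π) :
    ((List.finRange M).map fun j => ((List.range (ι (j + 1) - ι j).val).map fun k =>
      F (ι j + Fin.ofNat N k)).prod).prod =
      ((List.finRange N).map fun x => F (ι 0 + x)).prod := by
  -- Distances of the chosen points from `ι 0`; the value `N` at `J = M` closes the circle. With a
  -- single chosen point, `ι (j + 1) - ι j` would be `0` instead of a full turn, hence `2 ≤ M`.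
  set q : ℕ → ℕ := fun J => if J < M then (ι (Fin.ofNat M J)).val - (ι 0).val else N with hq
  have hle : ∀ j : Fin M, (ι 0).val ≤ (ι j).val := fun j =>
    Fin.le_def.1 (hι.monotone (Fin.le_def.2 (by simp)))
  have hq0 : q 0 = 0 := (if_pos (by omega)).trans (by simp)
  have hqM : q M = N := by simp [hq]
  have hgap : ∀ J < M, q J ≤ q (J + 1) ∧
      (ι (Fin.ofNat M J + 1) - ι (Fin.ofNat M J)).val = q (J + 1) - q J ∧
      ι (Fin.ofNat M J) = ι 0 + Fin.ofNat N (q J) := by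
    intro J hJ
    have hJ0 := hle (Fin.ofNat M J)
    have hJN := (ι (Fin.ofNat M J)).isLt
    have e1 : Fin.ofNat M J + 1 = Fin.ofNat M (J + 1) := by rw [ofNat_add]; rfl
    have hqJ : q J = (ι (Fin.ofNat M J)).val - (ι 0).val := if_pos hJ
    have e3 : ι (Fin.ofNat M J) = ι 0 + Fin.ofNat N (q J) := by
      apply Fin.ext
      rw [Fin.val_add, hqJ]
      simp only [Fin.val_ofNat]
      rw [Nat.mod_eq_of_lt (by omega : (ι (Fin.ofNat M J)).val - (ι 0).val < N),
        Nat.mod_eq_of_lt (by omega)]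
      omega
    rw [e1, hqJ, ← hqJ]
    by_cases hJ' : J + 1 < M
    · have hq1 : q (J + 1) = (ι (Fin.ofNat M (J + 1))).val - (ι 0).val := if_pos hJ'
      have hlt : (ι (Fin.ofNat M J)).val < (ι (Fin.ofNat M (J + 1))).val := by
        apply hι
        rw [Fin.lt_def]
        simp only [Fin.val_ofNat]
        rw [Nat.mod_eq_of_lt hJ, Nat.mod_eq_of_lt hJ']
        omega
      refine ⟨by omega, ?_, e3⟩
      rw [fin_val_sub, if_pos hlt.le]
      omega
    · have hJM : J + 1 = M := by omega
      have hq1 : q (J + 1) = N := if_neg hJ'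
      have hlt : (ι 0).val < (ι (Fin.ofNat M J)).val := by
        apply hι
        rw [Fin.lt_def]
        simp only [Fin.val_ofNat, Fin.val_zero]
        rw [Nat.mod_eq_of_lt hJ]
        omega
      refine ⟨by omega, ?_, e3⟩
      rw [fin_val_sub, hJM, ofNat_self, if_neg (by omega)]
      rw [hJM] at hq1
      omega
  have h1 := prod_range_segments (fun k => F (ι 0 + Fin.ofNat N k)) q hq0 M fun j hj => (hgap j hj).1
  rw [hqM] at h1
  rw [map_finRange_eq (M := N), ← h1, map_finRange_eq (M := M)]
  congr 1
  refine List.map_congr_left fun J hJ => ?_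
  obtain ⟨-, h2, h3⟩ := hgap J (List.mem_range.1 hJ)
  rw [h2]
  congr 1
  refine List.map_congr_left fun k _ => ?_
  rw [h3, ofNat_add, add_assoc]

/-- The segment that starts at a point of a subset contains no other point of the subset. -/
theorem sub_val_le_of_ne {N M : ℕ} [NeZero N] [NeZero M]
    (ι : Fin M → Fin N) (hι : StrictMono ι) {j j' : Fin M} (h : j' ≠ j) :
    (ι (j + 1) - ι j).val ≤ (ι j' - ι j).val := by
  have h0 := hι.monotone
  have hj := j.isLt
  have hj' := j'.isLt
  have hne : j'.val ≠ j.val := fun h' => h (Fin.ext h')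
  have b1 := (ι j).isLt
  have b2 := (ι j').isLt
  have hs : (j + 1).val = if j.val + 1 = M then 0 else j.val + 1 := by
    rw [Fin.val_add, Fin.val_one']
    rcases Nat.lt_or_ge 1 M with hM | hM
    · rw [Nat.mod_eq_of_lt hM]
      split_ifs with h1
      · rw [h1, Nat.mod_self]
      · rw [Nat.mod_eq_of_lt (by omega)]
    · omega
  have m1 : j.val < j'.val → (ι j).val < (ι j').val := fun h => hι h
  have m2 : j'.val < j.val → (ι j').val < (ι j).val := fun h => hι h
  have m3 : (j + 1).val ≤ j'.val → (ι (j + 1)).val ≤ (ι j').val := fun h => h0 h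
  have m4 : (j + 1).val < j.val → (ι (j + 1)).val < (ι j).val := fun h => hι h
  have m5 : j.val < (j + 1).val → (ι j).val < (ι (j + 1)).val := fun h => hι h
  have b3 := (ι (j + 1)).isLt
  rw [fin_val_sub, fin_val_sub]
  split_ifs at hs <;> split_ifs <;> omega

end Circle

/-! ### States of a subdiagram inside the whole diagram -/

section Transfer

variable {π : Type u} [Group π]

/-- The diagram `H` is obtained from `G` by removing all arrows but those of `s`: `ι` embeds the
points of `H` and `ρ` sends an edge of `G` to the edge of `H` that contains it. -/
structure IsSubdiagram {N M : ℕ} (G : RigidGauss π N) (s : Finset (Pt N)) (H : RigidGauss π M)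
    (ι : Pt M → Pt N) (ρ : Pt N → Pt M) : Prop where
  injective : Function.Injective ι
  mem_ends : ∀ i, i ∈ G.ends s ↔ ∃ j, ι j = i
  collapse : ∀ j, ρ (ι j) = j
  collapse_pred : ∀ j, ρ (ι j - 1) = j - 1
  collapse_of_notMem : ∀ i ∉ G.ends s, ρ (i - 1) = ρ i
  dir : ∀ j, H.dir j = G.dir (ι j)
  partner : ∀ j, ι (H.partner j) = G.partner (ι j)
  writhe : ∀ j, H.writhe j = G.writhe (ι j)
  colorProd : ∀ {K : Type} [DecidableEq K] (c : Pt M → K) (k : K),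
    G.mark.colorProd (c ∘ ρ) k = H.mark.colorProd c k

/-- The only substantial point is the product over a color class: an edge of the subdiagram is a
segment of edges of `G` and carries the product of their decorations, so pulling colors back along
the collapse merely regroups the factors. -/
theorem exists_isSubdiagram {N : ℕ} (G : RigidGauss π N) (s : Finset (Pt N)) (hs : s ⊆ G.arrows)
    (m : ℕ) (hm : s.card = m + 1) :
    ∃ ι ρ, IsSubdiagram G s (G.subAux s hs (m + 1) hm) ι ρ := by
  set o : Pt (m + 1) ≃o G.ends s := (G.ends s).orderIsoOfFin (G.card_ends hs hm) with ho
  obtain ⟨ρ, h1, h2, h3⟩ := exists_collapse (G.ends s) o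
  have hmono : StrictMono fun j => (o j : Pt N) := o.strictMono
  refine ⟨fun j => o j, ρ, fun a b h => o.injective (Subtype.ext h), fun i => ⟨fun h => ?_, ?_⟩,
    h1, h2, h3, fun j => rfl, fun j => ?_, fun j => rfl, ?_⟩
  · exact ⟨o.symm ⟨i, h⟩, by simp⟩
  · rintro ⟨j, rfl⟩
    exact (o j).2
  · exact congrArg Subtype.val (o.apply_symm_apply _)
  intro K _ c k
  have hN : N ≠ 0 := by
    obtain ⟨t, ht⟩ : s.Nonempty := Finset.card_pos.1 (by omega)
    exact G.ne_zero_of_dir ((G.mem_arrows t).1 (hs ht))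
  obtain ⟨N, rfl⟩ := Nat.exists_eq_succ_of_ne_zero hN
  show ConjClasses.mk _ = ConjClasses.mk _
  set F : Pt (N + 1) → π := fun e => if (c ∘ ρ) e = k then G.mark.at e else 1 with hF
  have e1 : (fun e => if (c ∘ ρ) e = k then G.mark e else 1) = F := rfl
  -- The collapse sends the whole segment between two successive remaining points to one edge, since
  -- no remaining point is met on the way.
  have hρ : ∀ j, ∀ x < ((o (j + 1) : Pt (N + 1)) - o j).val,
      ρ ((o j : Pt (N + 1)) + Fin.ofNat _ x) = j := by
    intro j x
    induction x with
    | zero => intro _; simpa using h1 j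
    | succ x ih =>
      intro hx
      have hx' := ((o (j + 1) : Pt (N + 1)) - o j).isLt
      refine Eq.trans ?_ (ih (by omega))
      have e2 : (o j : Pt (N + 1)) + Fin.ofNat _ x =
          (o j : Pt (N + 1)) + Fin.ofNat _ (x + 1) - 1 := by
        rw [ofNat_add, ← add_assoc]
        exact (add_sub_cancel_right _ _).symm
      rw [e2, h3]
      intro hmem
      obtain ⟨j', hj'⟩ : ∃ j', (o j' : Pt (N + 1)) = (o j : Pt (N + 1)) + Fin.ofNat _ (x + 1) :=
        ⟨o.symm ⟨_, hmem⟩, congrArg Subtype.val (o.apply_symm_apply _)⟩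
      have e3 : (o j' : Pt (N + 1)) - (o j : Pt (N + 1)) = Fin.ofNat _ (x + 1) := by
        rw [hj', add_sub_cancel_left]
      have e4 : ((o j' : Pt (N + 1)) - o j).val = x + 1 := by
        rw [e3]
        exact Nat.mod_eq_of_lt (by omega)
      by_cases hne : j' = j
      · subst hne
        rw [sub_self] at e4
        exact absurd e4 (Nat.succ_ne_zero x).symm
      · have := sub_val_le_of_ne _ hmono hne
        omega
  have e5 := prod_segments (by unfold size; omega) _ hmono F
  have e6 : ∀ j, ((List.range ((o (j + 1) : Pt (N + 1)) - o j).val).map fun x =>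
      F ((o j : Pt (N + 1)) + Fin.ofNat _ x)).prod =
      if c j = k then (G.subAux s hs (m + 1) hm).mark.at j else 1 := by
    intro j
    by_cases hc : c j = k
    · rw [if_pos hc]
      show _ = ((List.range ((o (j + 1) : Pt (N + 1)) - o j).val).map fun x =>
        G.mark.at ((o j : Pt (N + 1)) + Fin.ofNat _ x)).prod
      congr 1
      refine List.map_congr_left fun x hx => ?_
      simp only [hF, Function.comp, hρ j x (List.mem_range.1 hx), if_pos hc]
    · rw [if_neg hc]
      refine List.prod_eq_one fun y hy => ?_
      obtain ⟨x, hx, rfl⟩ := List.mem_map.1 hy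
      simp only [hF, Function.comp, hρ j x (List.mem_range.1 hx), if_neg hc]
  simp only [e6] at e5
  rw [e1]
  -- The segments start at the first remaining point and not at the base point; the resulting cyclic
  -- rotation is absorbed by conjugacy.
  refine Eq.trans ?_ (congrArg ConjClasses.mk e5.symm)
  refine (conjClasses_prod_of_isRotated ?_).symm
  have := (map_add_finRange_isRotated (size (N + 1)) (o 0 : Pt (N + 1)) 0).map F
  convert this using 1
  · rw [List.map_map]; rfl
  · simp

variable {N M n : ℕ} {G : RigidGauss π N} {s : Finset (Pt N)} {H : RigidGauss π M}
  {ι : Pt M → Pt N} {ρ : Pt N → Pt M} {Γ : Fin (n + 1) → ConjClasses π}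

theorem Naked.dir_of_mem_ends_iff (D : Naked N) (hs : s ⊆ D.arrows) {t : Pt N} (ht : D.dir t = 1) :
    t ∈ D.ends s ↔ t ∈ s := by
  refine ⟨fun h => ?_, fun h => Finset.mem_union_left _ h⟩
  rcases Finset.mem_union.1 h with h | h
  · exact h
  · obtain ⟨j, hj, rfl⟩ := Finset.mem_image.1 h
    rw [D.dir_partner, (D.mem_arrows j).1 (hs hj)] at ht
    exact absurd ht (by decide)

theorem Naked.partner_mem_ends_iff (D : Naked N) {i : Pt N} :
    D.partner i ∈ D.ends s ↔ i ∈ D.ends s :=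
  ⟨fun h => by simpa [D.partner_partner] using D.partner_mem_ends s h, D.partner_mem_ends s⟩

theorem IsSubdiagram.jumps_comp (h : IsSubdiagram G s H ι ρ)
    (c : Pt M → Fin (n + 1)) : G.jumps (c ∘ ρ) = (H.jumps c).image ι := by
  ext t
  simp only [Finset.mem_image, Naked.mem_jumps, h.dir]
  constructor
  · rintro ⟨h1, h2⟩
    by_cases ht : t ∈ G.ends s
    · obtain ⟨j, rfl⟩ := (h.mem_ends t).1 ht
      simp only [Function.comp, h.collapse, h.collapse_pred] at h2
      exact ⟨j, ⟨h1, h2⟩, rfl⟩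
    · exact absurd (congrArg c (h.collapse_of_notMem t ht)) h2
  · rintro ⟨j, ⟨h1, h2⟩, rfl⟩
    refine ⟨h1, ?_⟩
    simpa only [Function.comp, h.collapse, h.collapse_pred] using h2

theorem IsSubdiagram.isColoring_comp (h : IsSubdiagram G s H ι ρ)
    (c : Pt M → Fin (n + 1)) : G.IsColoring (c ∘ ρ) ↔ H.IsColoring c := by
  constructor
  · intro hc j hj
    have := hc (ι j) (by rw [← h.dir, hj])
    rw [← h.partner] at this
    simpa only [Function.comp, h.collapse, h.collapse_pred] using this
  · intro hc t ht
    by_cases hts : t ∈ G.ends s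
    · obtain ⟨j, rfl⟩ := (h.mem_ends t).1 hts
      rw [← h.partner]
      simp only [Function.comp, h.collapse, h.collapse_pred]
      exact hc j (by rw [h.dir, ht])
    · left
      simp only [Function.comp, h.collapse_of_notMem t hts,
        h.collapse_of_notMem _ (mt G.partner_mem_ends_iff.1 hts), and_self]

theorem IsSubdiagram.isState_comp (h : IsSubdiagram G s H ι ρ)
    (c : Pt M → Fin (n + 1)) : G.IsState Γ (c ∘ ρ) ↔ H.IsState Γ c := by
  have h1 : (G.jumps (c ∘ ρ)).card = (H.jumps c).card := by
    rw [h.jumps_comp, Finset.card_image_of_injective _ h.injective]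
  have h2 := h.isColoring_comp c
  have h3 := fun k => h.colorProd c k
  exact ⟨fun h' => ⟨h2.1 h'.coloring, by rw [← h1, h'.card_jumps],
      fun k => by rw [← h3, h'.colorProd]⟩,
    fun h' => ⟨h2.2 h'.coloring, by rw [h1, h'.card_jumps],
      fun k => by rw [h3, h'.colorProd]⟩⟩

theorem IsSubdiagram.weight_comp (h : IsSubdiagram G s H ι ρ)
    (c : Pt M → Fin (n + 1)) : G.weight (c ∘ ρ) = H.weight c := by
  rw [RigidGauss.weight, h.jumps_comp, Finset.prod_image fun a _ b _ hab => h.injective hab]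
  simp only [← h.writhe]
  rfl

/-- The color cannot change at an end of a removed arrow, as that arrow does not jump; so the
coloring factors through the collapse. -/
theorem IsSubdiagram.eq_comp (h : IsSubdiagram G s H ι ρ) (hs : s ⊆ G.arrows)
    {c : Pt N → Fin (n + 1)} (hc : G.IsColoring c) (hj : G.jumps c ⊆ s) : (c ∘ ι) ∘ ρ = c := by
  funext e
  refine forall_of_pred (Q := fun e => c (ι (ρ e)) = c e) (fun i hi => ?_) (i₀ := ι 0)
    (by rw [h.collapse]) e
  by_cases his : i ∈ G.ends s
  · obtain ⟨j, rfl⟩ := (h.mem_ends i).1 his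
    rw [h.collapse]
  · rw [← h.collapse_of_notMem i his, hi]
    by_contra hne
    have hN : N ≠ 0 := by
      rintro rfl
      exact hne (congrArg c (Subsingleton.elim (α := Fin 1) _ _))
    have h1 := (hc.smooth i).resolve_left fun h => hne h.1
    rcases G.dir_cases i hN with hd | hd
    · exact his (Finset.mem_union_left _ (hj (Naked.mem_jumps.2 ⟨hd, hne⟩)))
    · have h2 : G.partner i ∈ G.jumps c :=
        Naked.mem_jumps.2 ⟨hd, by rw [h1.1, h1.2]; exact fun h => hne h.symm⟩
      exact his (G.partner_mem_ends_iff.1 (Finset.mem_union_left _ (hj h2)))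

theorem IsSubdiagram.stateSum_eq (h : IsSubdiagram G s H ι ρ) (hs : s ⊆ G.arrows) :
    H.stateSum Γ = ∑ c ∈ (G.states Γ).filter (fun c => G.jumps c ⊆ s), G.weight c := by
  refine Finset.sum_bij' (fun c _ => c ∘ ρ) (fun c _ => c ∘ ι) ?_ ?_ ?_ ?_ ?_
  · intro c hc
    rw [Finset.mem_filter, RigidArrow.mem_states, h.isState_comp, h.jumps_comp]
    refine ⟨RigidArrow.mem_states.1 hc, fun t ht => ?_⟩
    obtain ⟨j, hj, rfl⟩ := Finset.mem_image.1 ht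
    have h1 : G.dir (ι j) = 1 := by rw [← h.dir, (Naked.mem_jumps.1 hj).1]
    exact (G.dir_of_mem_ends_iff hs h1).1 ((h.mem_ends _).2 ⟨j, rfl⟩)
  · intro c hc
    rw [Finset.mem_filter, RigidArrow.mem_states] at hc
    rw [RigidArrow.mem_states, ← h.isState_comp, h.eq_comp hs hc.1.coloring hc.2]
    exact hc.1
  · intro c _
    funext j
    simp [h.collapse]
  · intro c hc
    rw [Finset.mem_filter, RigidArrow.mem_states] at hc
    exact h.eq_comp hs hc.1.coloring hc.2
  · intro c _
    exact (h.weight_comp c).symm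

theorem Marking.colorProd_const {K : Type*} [DecidableEq K] (μ : Marking π N) (x k : K) :
    μ.colorProd (fun _ => x) k = if x = k then μ.total else ConjClasses.mk 1 := by
  cases N with
  | zero => rfl
  | succ N => by_cases h : x = k <;> simp [Marking.colorProd, Marking.total, h]

/-- The states of a diagram without arrows. -/
theorem stateSum_empty (G : RigidGauss π N) (H : RigidGauss π 0) (hH : H.mark = G.mark.total) :
    H.stateSum Γ = ∑ c ∈ (G.states Γ).filter (fun c => G.jumps c ⊆ ∅), G.weight c := by
  have hss : ∀ (c : Pt 0 → Fin (n + 1)) (e : Pt 0), c e = c 0 := fun c e =>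
    congrArg c (Subsingleton.elim (α := Fin 1) _ _)
  have hj : ∀ c : Pt 0 → Fin (n + 1), H.jumps c = ∅ := fun c => by
    rw [Naked.jumps, Finset.card_eq_zero.1 H.card_arrows, Finset.filter_empty]
  have hj' : ∀ x : Fin (n + 1), G.jumps (fun _ => x) = ∅ := fun x => by simp [Naked.jumps]
  have hcard : ∀ c : Pt 0 → Fin (n + 1), (H.jumps c).card = (G.jumps fun _ => c 0).card :=
    fun c => by rw [hj, hj']; rfl
  have key : ∀ c : Pt 0 → Fin (n + 1), G.IsState Γ (fun _ => c 0) ↔ H.IsState Γ c := by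
    intro c
    have h1 : ∀ k, G.mark.colorProd (fun _ => c 0) k = H.mark.colorProd c k := fun k => by
      rw [Marking.colorProd_const, ← hH]; rfl
    refine ⟨fun h => ⟨fun t ht => absurd rfl (H.ne_zero_of_dir ht), ?_, fun k => ?_⟩,
      fun h => ⟨fun t ht => Or.inl ⟨rfl, rfl⟩, ?_, fun k => ?_⟩⟩
    · rw [hcard, h.card_jumps]
    · rw [← h1, h.colorProd]
    · rw [← hcard, h.card_jumps]
    · rw [h1, h.colorProd]
  have hconst : ∀ c : Pt N → Fin (n + 1), G.IsState Γ c → G.jumps c ⊆ ∅ → (fun _ => c 0) = c := by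
    intro c hc hc'
    funext e
    refine hc.coloring.comp_const id (fun t ht => absurd (hc' ht) (by simp)) 0 e
  refine Finset.sum_bij' (fun c _ _ => c 0) (fun c _ _ => c 0) ?_ ?_ ?_ ?_ ?_
  · intro c hc
    rw [Finset.mem_filter, RigidArrow.mem_states, key, hj']
    exact ⟨RigidArrow.mem_states.1 hc, Finset.Subset.refl _⟩
  · intro c hc
    rw [Finset.mem_filter, RigidArrow.mem_states] at hc
    rw [RigidArrow.mem_states, ← key, hconst c hc.1 hc.2]
    exact hc.1
  · intro c _
    funext e
    exact (hss c e).symm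
  · intro c hc
    rw [Finset.mem_filter, RigidArrow.mem_states] at hc
    exact hconst c hc.1 hc.2
  · intro c _
    rw [RigidGauss.weight, RigidGauss.weight, hj, hj', Finset.prod_empty, Finset.prod_empty]

/-- The states of a subdiagram are the states without other jumps. -/
theorem stateSum_sub (G : RigidGauss π N) (hs : s ⊆ G.arrows) :
    (G.sub s hs).stateSum Γ =
      ∑ c ∈ (G.states Γ).filter (fun c => G.jumps c ⊆ s), G.weight c := by
  have key : ∀ m (hm : s.card = m), (G.subAux s hs m hm).stateSum Γ =
      ∑ c ∈ (G.states Γ).filter (fun c => G.jumps c ⊆ s), G.weight c := by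
    rintro (_ | m) hm
    · obtain rfl := Finset.card_eq_zero.1 hm
      exact stateSum_empty G _ rfl
    · obtain ⟨ι, ρ, h⟩ := exists_isSubdiagram G s hs m hm
      exact h.stateSum_eq hs
  exact key _ rfl

/-- The planar chain formula is a state sum. -/
theorem pairing_subdiagramSum (hΓ : ∀ i, Γ i ≠ ConjClasses.mk 1) (G : RigidGauss π N) :
    pairing (signedSymPres (liftedPlanarChain Γ)) (subdiagramSum G) = G.stateSum Γ := by
  have hadd : ∀ (T : Finset {s // s ∈ G.arrows.powerset})
      (f : {s // s ∈ G.arrows.powerset} → GaussSpace π),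
      pairing (signedSymPres (liftedPlanarChain Γ)) (∑ s ∈ T, f s) =
        ∑ s ∈ T, pairing (signedSymPres (liftedPlanarChain Γ)) (f s) := fun T f => by
    simp only [pairing]
    rw [Finsupp.sum_finsetSum_index]
    · intro a; ring
    · intro a b c; ring
  rw [subdiagramSum, hadd]
  simp only [pairing_single_diag Γ hΓ, stateSum_sub]
  -- Only the subsets with `n` arrows contribute. A state has exactly `n` jumps, so it is counted
  -- for just one of them, its own set of jumps.
  rw [Finset.sum_attach G.arrows.powerset fun s => if s.card = n then
    ∑ c ∈ (G.states Γ).filter (fun c => G.jumps c ⊆ s), G.weight c else 0,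
    ← Finset.sum_filter, RigidGauss.stateSum,
    ← Finset.sum_fiberwise_of_maps_to (g := fun c => G.jumps c)
      (t := G.arrows.powerset.filter fun s => s.card = n)]
  · refine Finset.sum_congr rfl fun s hs => ?_
    refine Finset.sum_congr (Finset.filter_congr fun c hc => ?_) fun _ _ => rfl
    have h1 := (Finset.mem_filter.1 hs).2
    have h2 := (RigidArrow.mem_states.1 hc).card_jumps
    exact ⟨fun h => Finset.eq_of_subset_of_card_le h (by omega), fun h => h.subset⟩
  · intro c hc
    rw [Finset.mem_filter, Finset.mem_powerset]
    exact ⟨Finset.filter_subset _ _, (RigidArrow.mem_states.1 hc).card_jumps⟩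

end Transfer

/-! ### Invariance under rotations and conjugacy moves -/

section Invariance

variable {π : Type u} [Group π] {N n : ℕ} {Γ : Fin (n + 1) → ConjClasses π}

theorem Marking.colorProd_rotate {K : Type*} [DecidableEq K] (μ : Marking π N) (k : Pt N)
    (c : Pt N → K) (x : K) :
    (μ.rotate k).colorProd (fun e => c (e - k)) x = μ.colorProd c x := by
  cases N with
  | zero =>
    have : c (0 - k) = c 0 := congrArg c (Subsingleton.elim (α := Fin 1) _ _)
    simp only [Marking.colorProd, Marking.rotate, this]
  | succ N =>
    refine conjClasses_prod_of_isRotated ?_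
    have := (map_add_finRange_isRotated (size (N + 1)) (-k) 0).map
      fun e => if c e = x then μ e else 1
    convert this using 1
    · rw [List.map_map]
      refine List.map_congr_left fun e _ => ?_
      simp only [Marking.rotate, Function.comp, neg_add_eq_sub]
    · simp

theorem RigidArrow.isState_smul_iff (A : RigidArrow π N) (k : Rot N) (c : Pt N → Fin (n + 1)) :
    (k • A).IsState Γ (fun e => c (e - k.toAdd)) ↔ A.IsState Γ c := by
  have hj : (k • A).jumps (fun e => c (e - k.toAdd)) =
      (A.jumps c).map (Equiv.addRight k.toAdd).toEmbedding := by
    ext t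
    rw [Finset.mem_map_equiv, Naked.mem_jumps, Naked.mem_jumps, sub_right_comm]
    simp only [Equiv.addRight_symm, Equiv.coe_addRight, ← sub_eq_add_neg]
    rfl
  have hc : (k • A).IsColoring (fun e => c (e - k.toAdd)) ↔ A.IsColoring c := by
    have h1 : ∀ t, ((k • A).partner t - k.toAdd) = A.partner (t - k.toAdd) := fun t => by
      show A.partner (t - k.toAdd) + k.toAdd - k.toAdd = _
      rw [add_sub_cancel_right]
    simp only [Naked.IsColoring, sub_right_comm _ (1 : Pt N) k.toAdd, h1]
    exact ⟨fun h t ht => by simpa using h (t + k.toAdd) (by simpa [RigidArrow.toNaked_smul,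
      Naked.smul_def, Naked.rotate] using ht), fun h t ht => h _ ht⟩
  have hm : ∀ x, (k • A).mark.colorProd (fun e => c (e - k.toAdd)) x = A.mark.colorProd c x :=
    fun x => A.mark.colorProd_rotate k.toAdd c x
  refine ⟨fun h => ⟨hc.1 h.coloring, ?_, fun x => by rw [← hm, h.colorProd]⟩,
    fun h => ⟨hc.2 h.coloring, ?_, fun x => by rw [hm, h.colorProd]⟩⟩
  · have h1 := h.card_jumps
    rwa [hj, Finset.card_map] at h1
  · rw [hj, Finset.card_map, h.card_jumps]

theorem stateSum_smul (G : RigidGauss π N) (k : Rot N) :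
    (k • G).stateSum Γ = G.stateSum Γ := by
  symm
  refine Finset.sum_bij' (fun c _ e => c (e - k.toAdd)) (fun c _ e => c (e + k.toAdd)) ?_ ?_ ?_ ?_ ?_
  · intro c hc
    rw [RigidArrow.mem_states] at hc ⊢
    exact (G.isState_smul_iff k c).2 hc
  · intro c hc
    rw [RigidArrow.mem_states] at hc ⊢
    rw [← G.isState_smul_iff k]
    simp only [sub_add_cancel]
    exact hc
  · intro c _; simp
  · intro c _; simp
  · intro c _
    rw [RigidGauss.weight, RigidGauss.weight]
    refine Finset.prod_equiv (Equiv.addRight k.toAdd) (fun t => ?_) (fun t _ => ?_)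
    · rw [Naked.mem_jumps, Naked.mem_jumps]
      have h1 : (k • G).dir (t + k.toAdd) = G.dir t := by
        show G.dir (t + k.toAdd - k.toAdd) = _
        rw [add_sub_cancel_right]
      simp only [Equiv.coe_addRight, h1, sub_right_comm _ (1 : Pt N) k.toAdd, add_sub_cancel_right]
    · show _ = ((G.writhe (t + k.toAdd - k.toAdd) : SignType) : ℚ)
      rw [add_sub_cancel_right]

/-- The factors `H (e + 1)` and `(H (e + 1))⁻¹` of consecutive edges cancel, and since the circle
closes up, the whole product is conjugated by `H 0`. -/
theorem colorProd_gauge {K : Type*} [DecidableEq K] (μ μ' : Marking π (N + 1))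
    (c : Pt (N + 1) → K) (k : K) (H : Pt (N + 1) → π)
    (h : ∀ e, (if c e = k then μ' e else 1) = (H e)⁻¹ * (if c e = k then μ e else 1) * H (e + 1)) :
    μ'.colorProd c k = μ.colorProd c k := by
  show ConjClasses.mk _ = ConjClasses.mk _
  simp only [h, map_finRange_eq]
  have key : ∀ J, ((List.range J).map fun j => (H (Fin.ofNat _ j))⁻¹ *
      (if c (Fin.ofNat _ j) = k then μ (Fin.ofNat _ j) else 1) * H (Fin.ofNat _ j + 1)).prod =
      (H 0)⁻¹ * ((List.range J).map fun j =>
        if c (Fin.ofNat _ j) = k then μ (Fin.ofNat _ j) else 1).prod * H (Fin.ofNat _ J) := by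
    intro J
    induction J with
    | zero => simp
    | succ J ih =>
      rw [List.range_succ, List.map_append, List.prod_append, ih, List.map_append,
        List.prod_append]
      have e1 : Fin.ofNat (size (N + 1)) J + 1 = Fin.ofNat _ (J + 1) := by rw [ofNat_add]; rfl
      simp only [List.map_cons, List.map_nil, List.prod_cons, List.prod_nil, mul_one, e1]
      group
  rw [key, ofNat_self, ConjClasses.mk_eq_mk_iff_isConj, isConj_iff]
  exact ⟨H 0, by group⟩

/-- Separation for either end of a jump: for the head, the arc is the complement of the arc of the
tail. The color that arrives at `i` is absent until the other end of the arrow. -/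
theorem Naked.IsColoring.not_onArc (D : Naked N) {c : Pt N → Fin (n + 1)} (hc : D.IsColoring c)
    (hs : Function.Surjective c) (hn : (D.jumps c).card = n) {i : Pt N} (hi : c (i - 1) ≠ c i)
    {e : Pt N} (he : c e = c (i - 1)) : ¬ D.OnArc i e := by
  have hN : N ≠ 0 := by
    rintro rfl
    exact hi (congrArg c (Subsingleton.elim (α := Fin 1) _ _))
  rcases D.dir_cases i hN with hd | hd
  · rw [hc.onArc_iff hs hn (Naked.mem_jumps.2 ⟨hd, hi⟩) he]
    exact D.not_onArc_pred_self i
  · have h1 := (hc.smooth i).resolve_left fun h => hi h.1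
    have h2 : D.partner i ∈ D.jumps c :=
      Naked.mem_jumps.2 ⟨hd, by rw [h1.1, h1.2]; exact fun h => hi h.symm⟩
    have h3 := D.onArc_partner (D.dir_ne_zero hN (D.partner i)) e
    rw [D.partner_partner] at h3
    rw [h3, not_not, hc.onArc_iff hs hn h2 (he.trans h1.2.symm)]
    exact D.onArc_self (D.dir_ne_zero hN _)

/-- A conjugacy move does not change the products of the color classes of a state. -/
theorem colorProd_conjugate (G : RigidGauss π N) (w : π →* ℤˣ) {i : Pt N} (hi : i ∈ G.arrows)
    (g : π) {c : Pt N → Fin (n + 1)} (hc : G.IsColoring c) (hs : Function.Surjective c)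
    (hn : (G.jumps c).card = n) (k : Fin (n + 1)) :
    (G.conjugate w i g).mark.colorProd c k = G.mark.colorProd c k := by
  have hdi : G.dir i = 1 := (G.mem_arrows i).1 hi
  have hN := G.ne_zero_of_dir hdi
  obtain ⟨N, rfl⟩ := Nat.exists_eq_succ_of_ne_zero hN
  set P : Pt (N + 1) → Prop := fun e => e = i ∨ e = G.partner i with hP
  have hmark : ∀ e, (G.conjugate w i g).mark e =
      (if P e then g⁻¹ else 1) * G.mark e * (if P (e + 1) then g else 1) := fun e => rfl
  -- If at each end both adjacent edges have color `k` or neither has, then the ends inside the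
  -- class undergo an ordinary gauge change and the others have no effect.
  by_cases hk : ∀ e, P e → (c (e - 1) = k ↔ c e = k)
  · refine colorProd_gauge _ _ c k (fun e => if P e ∧ c e = k then g else 1) fun e => ?_
    rw [hmark]
    have h1 := hk (e + 1)
    rw [add_sub_cancel_right] at h1
    by_cases h2 : c e = k <;> by_cases h3 : P e <;> by_cases h4 : P (e + 1) <;>
      simp_all
  -- Otherwise the arrow is a jump and `k` is one of its two colors. The end `j` is chosen as the
  -- one where the class of `k` is left; it is entered again at `partner j`.
  · push Not at hk
    obtain ⟨e₀, he₀, hk⟩ := hk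
    have hPp : ∀ e, P e → ∀ e', P e' ↔ e' = e ∨ e' = G.partner e := by
      rintro e (rfl | rfl) e'
      · rfl
      · rw [G.partner_partner]; exact or_comm
    obtain ⟨j, hPj, hj1, hj2⟩ : ∃ j, P j ∧ c (j - 1) = k ∧ c j ≠ k := by
      rcases hk with h | h
      · exact ⟨e₀, he₀, h⟩
      · refine ⟨G.partner e₀, ?_, ?_⟩
        · exact (hPp _ he₀ _).2 (Or.inr rfl)
        · have h1 := (hc.smooth e₀).resolve_left fun h' => h.1 (h'.1.trans h.2)
          rw [h1.1, h1.2]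
          exact h.symm
    have hjj := (hc.smooth j).resolve_left fun h' => hj2 (h'.1.symm.trans hj1)
    have hne : c (j - 1) ≠ c j := by rw [hj1]; exact hj2.symm
    have hdj := G.dir_ne_zero hN j
    have harc : ∀ e, c e = k → ¬ G.OnArc j e := fun e he =>
      hc.not_onArc _ hs hn hne (he.trans hj1.symm)
    -- The class receives `g` before `j` and `g⁻¹` after `partner j`, with nothing of color `k` in
    -- between. The gauge is `g` on the points from `j` to `partner j`; this last point is not on
    -- the half-open arc and has to be added.
    refine colorProd_gauge _ _ c k
      (fun e => if G.OnArc j e ∨ e = G.partner j then g else 1) fun e => ?_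
    rw [hmark]
    simp only [hPp j hPj]
    have a1 := G.onArc_self hdj
    have a2 := G.not_onArc_partner j
    have a3 := G.onArc_pred_partner hdj
    have a4 := G.not_onArc_pred_self j
    have a5 := fun h h' => G.onArc_pred (t := j) (i := e + 1) h h'
    rw [add_sub_cancel_right] at a5
    have hpj : j ≠ G.partner j := (G.partner_ne hdj).symm
    by_cases h1 : e + 1 = j
    · have h2 : e = j - 1 := eq_sub_of_add_eq h1
      have h3 : c e = k := h2 ▸ hj1
      have h4 : e ≠ j := by rintro rfl; exact hj2 h3
      have h5 := harc e h3
      simp only [h1, h3, h4, h5, a1, false_or, true_or, if_true]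
      split_ifs <;> simp
    · by_cases h2 : e + 1 = G.partner j
      · have h3 : e = G.partner j - 1 := eq_sub_of_add_eq h2
        have h4 : c e ≠ k := by rw [h3, hjj.1]; exact hj2
        have h5 : G.OnArc j e := h3 ▸ a3
        simp [h2, h4, h5]
      · have h3 := a5 h1 h2
        by_cases h4 : c e = k
        · have h5 := harc e h4
          have h6 : e ≠ j := by rintro rfl; exact hj2 h4
          simp only [h1, h2, h4, h5, h6, ← h3, false_or, if_true, or_self, if_false]
          split_ifs <;> simp
        · have h6 : e ≠ G.partner j := by
            rintro rfl
            exact h4 (hjj.2.trans hj1)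
          by_cases h7 : G.OnArc j (e + 1) <;> simp [h2, h4, h6, h3, h7]

/-- Since `w` is trivial no arrow is reversed: the colorings, their jumps and their weights are
literally the same, and only the products need to be compared. -/
theorem stateSum_conjugate (hΓ : ∀ i, Γ i ≠ ConjClasses.mk 1) (G : RigidGauss π N) {w : π →* ℤˣ}
    (hw : ∀ g, w g = 1) {i : Pt N} (hi : i ∈ G.arrows) (g : π) :
    (G.conjugate w i g).stateSum Γ = G.stateSum Γ := by
  have h1 : (G.conjugate w i g).toNaked = G.toNaked := by
    refine Naked.ext rfl (funext fun j => if_neg ?_)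
    rw [hw]
    exact fun h => absurd h.2 (by decide)
  have h2 : ∀ c : Pt N → Fin (n + 1), (G.conjugate w i g).IsState Γ c ↔ G.IsState Γ c := by
    intro c
    constructor
    · intro h
      have hc := h.coloring
      have hn := h.card_jumps
      have hs := Marking.surjective_of_colorProd hΓ h.colorProd
      rw [h1] at hc hn
      exact ⟨hc, hn, fun k => by rw [← h.colorProd, colorProd_conjugate G w hi g hc hs hn]⟩
    · intro h
      have hs := Marking.surjective_of_colorProd hΓ h.colorProd
      refine ⟨by rw [h1]; exact h.coloring, by rw [h1]; exact h.card_jumps, fun k => ?_⟩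
      rw [colorProd_conjugate G w hi g h.coloring hs h.card_jumps, h.colorProd]
  refine Finset.sum_congr ?_ fun c _ => ?_
  · ext c
    rw [RigidArrow.mem_states, RigidArrow.mem_states, h2]
  · rw [RigidGauss.weight, RigidGauss.weight, h1]
    rfl

end Invariance

/-! ### Recoloring -/

section Recolor

variable {π : Type u} [Group π] {N n : ℕ} {Γ : Fin (n + 1) → ConjClasses π}

/-- A state cannot be recolored on trivially decorated edges with fewer jumps. -/
theorem RigidArrow.IsState.not_ssubset_jumps (hΓ : ∀ i, Γ i ≠ ConjClasses.mk 1)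
    {A : RigidArrow π N} {c c' : Pt N → Fin (n + 1)} (h : A.IsState Γ c) (hN : N ≠ 0)
    (hc' : A.IsColoring c') (hm : ∀ e, c' e ≠ c e → A.mark.at e = 1)
    (hj : A.jumps c' ⊂ A.jumps c) : False := by
  -- The products do not change, so all the colors are still used, and connectedness requires at
  -- least `n` jumps.
  have h1 : Function.Surjective c' := Marking.surjective_of_colorProd hΓ fun k => by
    rw [← h.colorProd k, A.mark.colorProd_congr hN hm]
  have h2 := hc'.le_card_jumps h1
  have h3 := Finset.card_lt_card hj
  rw [h.card_jumps] at h3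
  omega

theorem one_ne_zero_pt (hN : N ≠ 0) : (1 : Pt N) ≠ 0 := by
  intro h
  have h1 := congrArg Fin.val h
  have h2 := size_eq hN
  rw [Fin.val_one', Fin.val_zero, Nat.mod_eq_of_lt (by omega)] at h1
  exact one_ne_zero h1

theorem add_one_ne (hN : N ≠ 0) (e : Pt N) : e + 1 ≠ e := fun h =>
  one_ne_zero_pt hN (add_eq_left.1 h)

theorem sub_one_ne (hN : N ≠ 0) (e : Pt N) : e - 1 ≠ e := fun h =>
  one_ne_zero_pt hN (sub_eq_self.1 h)

/-- Invariance under the first Reidemeister move. -/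
theorem stateSum_remove_r1 (hΓ : ∀ i, Γ i ≠ ConjClasses.mk 1) (G : RigidGauss π N) {a : Pt N}
    (h : G.IsR1 a) : (G.remove {a}).stateSum Γ = G.stateSum Γ := by
  rw [RigidGauss.remove, stateSum_sub, RigidGauss.stateSum]
  congr 1
  refine Finset.filter_true_of_mem fun c hc => ?_
  rw [RigidArrow.mem_states] at hc
  intro t ht
  refine Finset.mem_sdiff.2 ⟨Finset.filter_subset _ _ ht, fun hta => ?_⟩
  obtain rfl := Finset.mem_singleton.1 hta
  have hN := G.ne_zero_of_dir (Naked.mem_jumps.1 ht).1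
  obtain ⟨e, hpe, hme, hte⟩ : ∃ e, G.partner e = e + 1 ∧ G.mark.at e = 1 ∧
      (t = e ∨ t = G.partner e) := by
    rcases h.2 with h | h
    · exact ⟨t, h.1, h.2, Or.inl rfl⟩
    · exact ⟨G.partner t, by rw [G.partner_partner]; exact h.1, h.2,
        Or.inr (G.partner_partner t).symm⟩
  have hpe' : G.partner (e + 1) = e := by rw [← hpe, G.partner_partner]
  have hjump : c (e - 1) ≠ c e := by
    have h1 := hc.coloring.of_mem_jumps ht
    rcases hte with rfl | rfl
    · exact h1.1.ne
    · rw [G.partner_partner] at h1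
      rw [h1.2.1, h1.2.2]
      exact h1.1.ne'
  have hsm := (hc.coloring.smooth e).resolve_left fun h => hjump h.1
  rw [hpe] at hsm
  -- By smoothing, the edges before and after the small edge have the same color. Giving it to the
  -- small edge too removes the jump and contradicts minimality.
  set c' := Function.update c e (c (e - 1)) with hc'
  have u0 : c' e = c (e - 1) := Function.update_self _ _ _
  have u1 : ∀ x, x ≠ e → c' x = c x := fun x hx => Function.update_of_ne hx _ _
  have v1 : c' (e - 1) = c (e - 1) := u1 _ (sub_one_ne hN e)
  have v2 : c' (e + 1) = c (e - 1) := by rw [u1 _ (add_one_ne hN e), hsm.2]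
  have hflat : ∀ x, x = e ∨ x = e + 1 → c' (x - 1) = c' x := by
    rintro x (rfl | rfl)
    · rw [v1, u0]
    · rw [add_sub_cancel_right, u0, v2]
  have hout : ∀ x, x ≠ e → x ≠ e + 1 → c' (x - 1) = c (x - 1) ∧ c' x = c x := fun x h1 h2 =>
    ⟨u1 _ fun h => h2 (sub_eq_iff_eq_add.1 h), u1 _ h1⟩
  refine hc.not_ssubset_jumps hΓ hN (c' := c') ?_ ?_ ?_
  · intro x hx
    by_cases h1 : x = e
    · subst h1
      exact Or.inl ⟨hflat _ (Or.inl rfl), by rw [hpe]; exact hflat _ (Or.inr rfl)⟩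
    by_cases h2 : x = e + 1
    · subst h2
      exact Or.inl ⟨hflat _ (Or.inr rfl), by rw [hpe']; exact hflat _ (Or.inl rfl)⟩
    have h3 : G.partner x ≠ e := fun h => h2 (by rw [← hpe, ← h, G.partner_partner])
    have h4 : G.partner x ≠ e + 1 := fun h => h1 (by rw [← hpe', ← h, G.partner_partner])
    rw [(hout x h1 h2).1, (hout x h1 h2).2, (hout _ h3 h4).1, (hout _ h3 h4).2]
    exact hc.coloring x hx
  · intro x hx
    by_cases h1 : x = e
    · rw [h1, hme]
    · exact absurd (u1 x h1) hx
  · refine (Finset.ssubset_iff_of_subset fun x hx => ?_).2 ⟨t, ht, fun h => ?_⟩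
    · rw [Naked.mem_jumps] at hx ⊢
      have h1 : x ≠ e := fun h => hx.2 (hflat x (Or.inl h))
      have h2 : x ≠ e + 1 := fun h => hx.2 (hflat x (Or.inr h))
      rw [← (hout x h1 h2).1, ← (hout x h1 h2).2]
      exact hx
    · exact (Naked.mem_jumps.1 h).2 (hflat t (hte.imp id fun h => h.trans hpe))

end Recolor

/-! ### Flipping small edges -/

section Flip

variable {π : Type u} [Group π] {N n : ℕ} {Γ : Fin (n + 1) → ConjClasses π} {E : Finset (Pt N)}

/-- Exchange the ends of the edges in `E`. -/
def swapPoint (E : Finset (Pt N)) (i : Pt N) : Pt N :=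
  if i ∈ E then i + 1 else if i - 1 ∈ E then i - 1 else i

/-- Replace the color of each edge in `E`, if it is that of a neighbor, by that of the other
neighbor. -/
def flipColor {K : Type*} [DecidableEq K] (E : Finset (Pt N)) (c : Pt N → K) (e : Pt N) : K :=
  if e ∈ E then (if c e = c (e - 1) then c (e + 1) else c (e - 1)) else c e

/-- The color of each edge in `E` is that of a neighbor. -/
def IsTame {K : Type*} (E : Finset (Pt N)) (c : Pt N → K) : Prop :=
  ∀ e ∈ E, c (e - 1) = c e ∨ c e = c (e + 1)

theorem swapPoint_of_mem {e : Pt N} (he : e ∈ E) : swapPoint E e = e + 1 := if_pos he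

theorem swapPoint_add_one (hE : ∀ e ∈ E, e + 1 ∉ E) {e : Pt N} (he : e ∈ E) :
    swapPoint E (e + 1) = e := by
  rw [swapPoint, if_neg (hE e he), add_sub_cancel_right, if_pos he]

theorem swapPoint_of_notMem {e : Pt N} (he : e ∉ E) (he' : e - 1 ∉ E) : swapPoint E e = e := by
  rw [swapPoint, if_neg he, if_neg he']

theorem swapPoint_swapPoint (hE : ∀ e ∈ E, e + 1 ∉ E) (i : Pt N) :
    swapPoint E (swapPoint E i) = i := by
  by_cases h1 : i ∈ E
  · rw [swapPoint_of_mem h1, swapPoint_add_one hE h1]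
  by_cases h2 : i - 1 ∈ E
  · have h3 := swapPoint_add_one hE h2
    rw [sub_add_cancel] at h3
    rw [h3, swapPoint_of_mem h2, sub_add_cancel]
  · rw [swapPoint_of_notMem h1 h2, swapPoint_of_notMem h1 h2]

variable {K : Type*} [LinearOrder K] {c : Pt N → K}

theorem flipColor_of_notMem {e : Pt N} (he : e ∉ E) : flipColor E c e = c e := if_neg he

theorem sub_one_notMem (hE : ∀ e ∈ E, e + 1 ∉ E) {e : Pt N} (he : e ∈ E) : e - 1 ∉ E :=
  fun h => hE _ h (by rwa [sub_add_cancel])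

/-- Flipping colors and exchanging ends preserves the pair of colors at each jump. -/
theorem flipColor_swapPoint (hE : ∀ e ∈ E, e + 1 ∉ E) (hc : IsTame E c) (i : Pt N) :
    (flipColor E c (swapPoint E i - 1) = c (i - 1) ∧ flipColor E c (swapPoint E i) = c i) ∨
    (c (i - 1) = c i ∧ flipColor E c (swapPoint E i - 1) = flipColor E c (swapPoint E i)) := by
  by_cases h1 : i ∈ E
  · have h2 := hc i h1
    rw [swapPoint_of_mem h1, add_sub_cancel_right, flipColor_of_notMem (hE i h1), flipColor,
      if_pos h1]
    by_cases h3 : c i = c (i - 1)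
    · rw [if_pos h3]; exact Or.inr ⟨h3.symm, rfl⟩
    · rw [if_neg h3]
      exact Or.inl ⟨rfl, (h2.resolve_left fun h => h3 h.symm).symm⟩
  by_cases h2 : i - 1 ∈ E
  · have h3 := hc _ h2
    have h4 : swapPoint E i = i - 1 := by rw [swapPoint, if_neg h1, if_pos h2]
    rw [sub_add_cancel] at h3
    rw [h4, flipColor_of_notMem (sub_one_notMem hE h2), flipColor, if_pos h2, sub_add_cancel]
    by_cases h5 : c (i - 1) = c (i - 1 - 1)
    · rw [if_pos h5]; exact Or.inl ⟨h5.symm, rfl⟩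
    · rw [if_neg h5]
      exact Or.inr ⟨h3.resolve_left fun h => h5 h.symm, rfl⟩
  · rw [swapPoint_of_notMem h1 h2, flipColor_of_notMem h1, flipColor_of_notMem h2]
    exact Or.inl ⟨rfl, rfl⟩

theorem flipColor_flipColor (hE : ∀ e ∈ E, e + 1 ∉ E) (hc : IsTame E c) :
    flipColor E (flipColor E c) = c := by
  funext e
  by_cases he : e ∈ E
  · have h := hc e he
    rw [flipColor, if_pos he, flipColor_of_notMem (hE e he),
      flipColor_of_notMem (sub_one_notMem hE he), flipColor, if_pos he]
    by_cases h3 : c e = c (e - 1)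
    · rw [if_pos h3]
      by_cases h4 : c (e + 1) = c (e - 1)
      · rw [if_pos h4, h4, h3]
      · rw [if_neg h4, h3]
    · rw [if_neg h3, if_pos rfl]
      exact (h.resolve_left fun h => h3 h.symm).symm
  · rw [flipColor_of_notMem he, flipColor_of_notMem he]

theorem isTame_flipColor (hE : ∀ e ∈ E, e + 1 ∉ E) : IsTame E (flipColor E c) := by
  intro e he
  rw [flipColor_of_notMem (hE e he), flipColor_of_notMem (sub_one_notMem hE he), flipColor,
    if_pos he]
  split_ifs
  · exact Or.inr rfl
  · exact Or.inl rfl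

variable {D D' : Naked N}

/-- By `flipColor_swapPoint`, an end with a change of color keeps its pair of colors when it moves,
and an end without change stays so; the rule is transported arrow by arrow. -/
theorem isColoring_flipColor (hE : ∀ e ∈ E, e + 1 ∉ E) (hc : IsTame E c)
    (hp : ∀ i, D'.partner (swapPoint E i) = swapPoint E (D.partner i))
    (hd : ∀ i, D'.dir (swapPoint E i) = D.dir i) (h : D.IsColoring c) :
    D'.IsColoring (flipColor E c) := by
  intro t ht
  obtain ⟨t, rfl⟩ : ∃ t', swapPoint E t' = t := ⟨_, swapPoint_swapPoint hE t⟩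
  rw [hd] at ht
  rw [hp]
  have h1 := flipColor_swapPoint hE hc t
  have h2 := flipColor_swapPoint hE hc (D.partner t)
  rcases h t ht with h3 | h3
  · left
    refine ⟨?_, ?_⟩
    · rcases h1 with h1 | h1
      · rw [h1.1, h1.2, h3.1]
      · exact h1.2
    · rcases h2 with h2 | h2
      · rw [h2.1, h2.2, h3.2]
      · exact h2.2
  · right
    have h1 := h1.resolve_right fun h => h3.1.ne h.1
    have h2 := h2.resolve_right fun h => h3.1.ne (by rw [← h3.2.1, ← h3.2.2, h.1])
    rw [h1.1, h1.2, h2.1, h2.2]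
    exact h3

theorem jumps_flipColor (hE : ∀ e ∈ E, e + 1 ∉ E) (hc : IsTame E c)
    (hd : ∀ i, D'.dir (swapPoint E i) = D.dir i) :
    D'.jumps (flipColor E c) = (D.jumps c).image (swapPoint E) := by
  have key : ∀ t, swapPoint E t ∈ D'.jumps (flipColor E c) ↔ t ∈ D.jumps c := by
    intro t
    rw [Naked.mem_jumps, Naked.mem_jumps, hd]
    rcases flipColor_swapPoint hE hc t with h | h
    · rw [h.1, h.2]
    · exact and_congr_right fun _ => iff_of_false (not_not.2 h.2) (not_not.2 h.1)
  ext t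
  rw [Finset.mem_image]
  constructor
  · intro ht
    refine ⟨swapPoint E t, ?_, swapPoint_swapPoint hE t⟩
    rwa [← key, swapPoint_swapPoint hE]
  · rintro ⟨t, ht, rfl⟩
    exact (key t).2 ht

theorem swapPoint_injective (hE : ∀ e ∈ E, e + 1 ∉ E) : Function.Injective (swapPoint E) :=
  fun a b h => by rw [← swapPoint_swapPoint hE a, h, swapPoint_swapPoint hE]

theorem RigidArrow.IsState.flipColor {A A' : RigidArrow π N} {c : Pt N → Fin (n + 1)}
    (h : A.IsState Γ c) (hN : N ≠ 0) (hE : ∀ e ∈ E, e + 1 ∉ E) (hc : IsTame E c)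
    (hp : ∀ i, A'.partner (swapPoint E i) = swapPoint E (A.partner i))
    (hd : ∀ i, A'.dir (swapPoint E i) = A.dir i) (hm : A'.mark = A.mark)
    (hm1 : ∀ e ∈ E, A.mark.at e = 1) : A'.IsState Γ (flipColor E c) := by
  refine ⟨isColoring_flipColor hE hc hp hd h.coloring, ?_, fun k => ?_⟩
  · rw [jumps_flipColor hE hc hd, Finset.card_image_of_injective _ (swapPoint_injective hE),
      h.card_jumps]
  · rw [hm, ← h.colorProd k]
    refine Marking.colorProd_congr hN _ (fun e he => ?_) k
    by_cases heE : e ∈ E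
    · exact hm1 e heE
    · exact absurd (flipColor_of_notMem heE) he

theorem weight_flipColor {G G' : RigidGauss π N} (hE : ∀ e ∈ E, e + 1 ∉ E) (hc : IsTame E c)
    (hd : ∀ i, G'.dir (swapPoint E i) = G.dir i) :
    G'.weight (flipColor E c) = ∏ t ∈ G.jumps c, (G'.writhe (swapPoint E t) : ℚ) := by
  rw [RigidGauss.weight, jumps_flipColor (D := G.toNaked) hE hc hd,
    Finset.prod_image fun a _ b _ h => swapPoint_injective hE h]

end Flip

/-! ### The second Reidemeister move -/

section R2

variable {π : Type u} [Group π] {N n : ℕ} {Γ : Fin (n + 1) → ConjClasses π}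

theorem jump_iff {D : Naked N} {c : Pt N → Fin (n + 1)} (hc : D.IsColoring c) (i : Pt N) :
    c (i - 1) = c i ↔ c (D.partner i - 1) = c (D.partner i) := by
  rcases hc.smooth i with h | h
  · exact iff_of_true h.1 h.2
  · rw [h.1, h.2]; exact eq_comm

/-- The arrows of a second Reidemeister move are not both jumps of a state. -/
theorem RigidGauss.IsR2.not_both (hΓ : ∀ i, Γ i ≠ ConjClasses.mk 1) {G : RigidGauss π N}
    {a b : Pt N} (h : G.IsR2 a b) {c : Pt N → Fin (n + 1)} (hc : G.IsState Γ c) :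
    ¬ (a ∈ G.jumps c ∧ b ∈ G.jumps c) := by
  rintro ⟨ha, hb⟩
  obtain ⟨-, -, -, -, ⟨rfl, hma⟩, h⟩ := h
  have hda := (Naked.mem_jumps.1 ha).1
  have hdb := (Naked.mem_jumps.1 hb).1
  have hN := G.ne_zero_of_dir hda
  have ja := hc.coloring.of_mem_jumps ha
  have jb := hc.coloring.of_mem_jumps hb
  rw [add_sub_cancel_right] at jb
  rcases h with ⟨h, -⟩ | ⟨h, hmb⟩
  · rw [h, add_sub_cancel_right] at jb
    -- When the heads follow each other in the order of the tails, the edge between them forces the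
    -- first and the last of three increasing colors to be equal.
    exact lt_irrefl _ ((ja.1.trans jb.1).trans_eq (jb.2.1.symm.trans ja.2.2))
  · rw [h, add_sub_cancel_right] at ja
    set q := G.partner (a + 1) with hq
    have hdq : G.dir q = -1 := by rw [hq, G.dir_partner, hdb]
    have hdq1 : G.dir (q + 1) = -1 := by rw [← h, G.dir_partner, hda]
    have d1 : a ≠ q := fun h => by rw [← h, hda] at hdq; exact absurd hdq (by decide)
    have d2 : a + 1 ≠ q := fun h => by rw [← h, hdb] at hdq; exact absurd hdq (by decide)
    have d3 : a ≠ q + 1 := fun h => by rw [← h, hda] at hdq1; exact absurd hdq1 (by decide)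
    have n1 := add_one_ne hN a
    have n2 := add_one_ne hN q
    have n3 := sub_one_ne hN a
    have n4 := sub_one_ne hN q
    -- When the heads are in the opposite order, the colors form a chain `c (a - 1) < c a < c (a +
    -- 1)` at the tails and the same chain backwards at the heads. Erasing the intermediate color
    -- from both small edges leaves a single jump, from the least to the greatest.
    set c' : Pt N → Fin (n + 1) := fun e => if e = a ∨ e = q then c (a - 1) else c e with hc'
    have u1 : ∀ x, x ≠ a → x ≠ q → c' x = c x := fun x h1 h2 => if_neg (by tauto)
    have ca : c' a = c (a - 1) := if_pos (Or.inl rfl)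
    have cq : c' q = c (a - 1) := if_pos (Or.inr rfl)
    have ca0 : c' (a - 1) = c (a - 1) := u1 _ n3 fun h => d3 (sub_eq_iff_eq_add.1 h)
    have ca1 : c' (a + 1) = c (a + 1) := u1 _ n1 d2
    have cq0 : c' (q - 1) = c (q - 1) := u1 _ (fun h => d2 (sub_eq_iff_eq_add.1 h).symm) n4
    have cq1 : c' (q + 1) = c (q + 1) := u1 _ d3.symm n2
    have hpa : G.partner a = q + 1 := h
    have hout : ∀ x, x ≠ a → x ≠ q → x ≠ a + 1 → x ≠ q + 1 → c' (x - 1) = c (x - 1) ∧ c' x = c x :=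
      fun x h1 h2 h3 h4 => ⟨u1 _ (fun h => h3 (sub_eq_iff_eq_add.1 h))
        (fun h => h4 (sub_eq_iff_eq_add.1 h)), u1 _ h1 h2⟩
    refine hc.not_ssubset_jumps hΓ hN (c' := c') ?_ ?_ ?_
    · intro x hx
      have hxq : x ≠ q := fun h => by rw [← h, hx] at hdq; exact absurd hdq (by decide)
      have hxq1 : x ≠ q + 1 := fun h => by rw [← h, hx] at hdq1; exact absurd hdq1 (by decide)
      by_cases h1 : x = a
      · subst h1
        left
        rw [hpa, add_sub_cancel_right, ca0, ca, cq, cq1, ja.2.2]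
        exact ⟨rfl, rfl⟩
      by_cases h2 : x = a + 1
      · subst h2
        right
        rw [add_sub_cancel_right, ← hq, ca, ca1, cq0, cq, jb.2.1]
        exact ⟨ja.1.trans jb.1, rfl, rfl⟩
      · have hp : ∀ y, G.partner x = y → x = G.partner y := by
          rintro y rfl; rw [G.partner_partner]
        have hdx : G.dir (G.partner x) = -1 := by rw [G.dir_partner, hx]
        have h3 : G.partner x ≠ a := fun h => by rw [h, hda] at hdx; exact absurd hdx (by decide)
        have h4 : G.partner x ≠ a + 1 := fun h => by
          rw [h, hdb] at hdx; exact absurd hdx (by decide)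
        have h5 : G.partner x ≠ q := fun h => h2 (by rw [hp _ h, hq, G.partner_partner])
        have h6 : G.partner x ≠ q + 1 := fun h => h1 (by rw [hp _ h, ← hpa, G.partner_partner])
        rw [(hout x h1 hxq h2 hxq1).1, (hout x h1 hxq h2 hxq1).2, (hout _ h3 h5 h4 h6).1,
          (hout _ h3 h5 h4 h6).2]
        exact hc.coloring x hx
    · intro x hx
      by_cases h1 : x = a
      · rw [h1, hma]
      by_cases h2 : x = q
      · rw [h2, hmb]
      · exact absurd (u1 x h1 h2) hx
    · refine (Finset.ssubset_iff_of_subset fun x hx => ?_).2 ⟨a, ha, fun h => ?_⟩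
      · by_cases h2 : x = a + 1
        · rw [h2]; exact hb
        rw [Naked.mem_jumps] at hx ⊢
        have hxq : x ≠ q := fun h => by rw [← h, hx.1] at hdq; exact absurd hdq (by decide)
        have hxq1 : x ≠ q + 1 := fun h => by rw [← h, hx.1] at hdq1; exact absurd hdq1 (by decide)
        have h1 : x ≠ a := by
          rintro rfl
          exact hx.2 (by rw [ca0, ca])
        rw [← (hout x h1 hxq h2 hxq1).1, ← (hout x h1 hxq h2 hxq1).2]
        exact hx
      · exact (Naked.mem_jumps.1 h).2 (by rw [ca0, ca])

/-- The ends of the arrows of a second Reidemeister move are exchanged by a symmetry. -/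
theorem RigidGauss.IsR2.exists_swap {G : RigidGauss π N} {a b : Pt N} (h : G.IsR2 a b) :
    ∃ E : Finset (Pt N), (∀ e ∈ E, e + 1 ∉ E) ∧ (∀ e ∈ E, G.mark.at e = 1) ∧
      (∀ e ∈ E, (e = a ∨ e = b ∨ e = G.partner a ∨ e = G.partner b) ∧
        (e + 1 = a ∨ e + 1 = b ∨ e + 1 = G.partner a ∨ e + 1 = G.partner b) ∧
        ((e = a ∨ e = G.partner a) ↔ (e + 1 = b ∨ e + 1 = G.partner b))) ∧
      swapPoint E a = b ∧ swapPoint E b = a ∧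
      (∀ t, G.dir t = 1 → t ≠ a → t ≠ b → swapPoint E t = t) ∧
      (∀ i, G.partner (swapPoint E i) = swapPoint E (G.partner i)) ∧
      (∀ i, G.dir (swapPoint E i) = G.dir i) := by
  obtain ⟨ha, hb, hab, -, ⟨rfl, hma⟩, h⟩ := h
  rw [Naked.mem_arrows] at ha hb
  have hN := G.ne_zero_of_dir ha
  -- The edge `q` joins the two heads, whichever of them comes first; exchanging the ends of `a` and
  -- of `q` swaps the two arrows.
  obtain ⟨q, hmq, hq⟩ : ∃ q, G.mark.at q = 1 ∧ (q = G.partner a ∧ q + 1 = G.partner (a + 1) ∨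
      q = G.partner (a + 1) ∧ q + 1 = G.partner a) := by
    rcases h with h | h
    · exact ⟨G.partner a, h.2, Or.inl ⟨rfl, h.1.symm⟩⟩
    · exact ⟨G.partner (a + 1), h.2, Or.inr ⟨rfl, h.1.symm⟩⟩
  have hdq : G.dir q = -1 := by
    rcases hq with ⟨rfl, -⟩ | ⟨rfl, -⟩ <;> simp only [G.dir_partner, ha, hb]
  have hdq1 : G.dir (q + 1) = -1 := by
    rcases hq with ⟨-, h⟩ | ⟨-, h⟩ <;> simp only [h, G.dir_partner, ha, hb]
  have tail_ne : ∀ x y, G.dir x = 1 → G.dir y = -1 → x ≠ y := fun x y hx hy h => by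
    rw [h, hy] at hx; exact absurd hx (by decide)
  have d1 := tail_ne a q ha hdq
  have d2 := tail_ne (a + 1) q hb hdq
  have d3 := tail_ne a (q + 1) ha hdq1
  have d4 := tail_ne (a + 1) (q + 1) hb hdq1
  have n1 := add_one_ne hN a
  have n2 := add_one_ne hN q
  have hE : ∀ e ∈ ({a, q} : Finset (Pt N)), e + 1 ∉ ({a, q} : Finset (Pt N)) := by
    intro e he
    simp only [Finset.mem_insert, Finset.mem_singleton] at he ⊢
    rcases he with rfl | rfl
    · exact not_or.2 ⟨n1, d2⟩
    · exact not_or.2 ⟨d3.symm, n2⟩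
  have haE : a ∈ ({a, q} : Finset (Pt N)) := by simp
  have hqE : q ∈ ({a, q} : Finset (Pt N)) := by simp
  have s1 := swapPoint_of_mem haE
  have s2 := swapPoint_add_one hE haE
  have s3 := swapPoint_of_mem hqE
  have s4 := swapPoint_add_one hE hqE
  have s5 : ∀ x, x ≠ a → x ≠ a + 1 → x ≠ q → x ≠ q + 1 →
      swapPoint ({a, q} : Finset (Pt N)) x = x := fun x h1 h2 h3 h4 => by
    refine swapPoint_of_notMem ?_ ?_
    · simp [h1, h3]
    · simp [sub_eq_iff_eq_add, h2, h4]
  have hp : ∀ y x, G.partner x = y → x = G.partner y := by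
    rintro y x rfl; rw [G.partner_partner]
  refine ⟨{a, q}, hE, ?_, ?_, s1, s2, ?_, ?_, ?_⟩
  · intro e he
    simp only [Finset.mem_insert, Finset.mem_singleton] at he
    rcases he with rfl | rfl <;> assumption
  · intro e he
    simp only [Finset.mem_insert, Finset.mem_singleton] at he
    rcases he with rfl | rfl
    · exact ⟨Or.inl rfl, Or.inr (Or.inl rfl), iff_of_true (Or.inl rfl) (Or.inl rfl)⟩
    · rcases hq with ⟨h1, h2⟩ | ⟨h1, h2⟩
      · exact ⟨Or.inr (Or.inr (Or.inl h1)), Or.inr (Or.inr (Or.inr h2)),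
          iff_of_true (Or.inr h1) (Or.inr h2)⟩
      · refine ⟨Or.inr (Or.inr (Or.inr h1)), Or.inr (Or.inr (Or.inl h2)), iff_of_false ?_ ?_⟩
        · rintro (h | h)
          · exact d1 h.symm
          · exact n1 (G.partner_injective (h1.symm.trans h))
        · rintro (h | h)
          · exact d4 h.symm
          · exact n1 (G.partner_injective (h.symm.trans h2))
  · exact fun t ht h1 h2 => s5 t h1 h2 (tail_ne t q ht hdq) (tail_ne t _ ht hdq1)
  · intro i
    have hpa : swapPoint {a, q} (G.partner a) = G.partner (a + 1) := by
      rcases hq with ⟨h1, h2⟩ | ⟨h1, h2⟩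
      · rw [← h1, ← h2, s3]
      · rw [← h1, ← h2, s4]
    have hpb : swapPoint {a, q} (G.partner (a + 1)) = G.partner a := by
      rw [← hpa, swapPoint_swapPoint hE]
    have hpq : ∀ y, (y = q ∨ y = q + 1) → y = G.partner a ∨ y = G.partner (a + 1) := by
      rintro y (rfl | rfl)
      · exact hq.imp And.left And.left
      · exact (hq.imp And.right And.right).symm
    by_cases h1 : i = a
    · rw [h1, s1, hpa]
    by_cases h2 : i = a + 1
    · rw [h2, s2, hpb]
    by_cases h3 : i = G.partner a
    · rw [h3, hpa, G.partner_partner, G.partner_partner, s1]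
    by_cases h4 : i = G.partner (a + 1)
    · rw [h4, hpb, G.partner_partner, G.partner_partner, s2]
    have h5 : ∀ y, (y = q ∨ y = q + 1) → i ≠ y := fun y hy h => by
      rcases hpq y hy with h' | h'
      · exact h3 (h.trans h')
      · exact h4 (h.trans h')
    have h6 : ∀ y, (y = q ∨ y = q + 1) → G.partner i ≠ y := fun y hy h => by
      rcases hpq y hy with h' | h'
      · exact h1 (G.partner_injective (h.trans h'))
      · exact h2 (G.partner_injective (h.trans h'))
    rw [s5 i h1 h2 (h5 _ (Or.inl rfl)) (h5 _ (Or.inr rfl)), s5 _ (fun h => h3 (hp _ _ h))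
      (fun h => h4 (hp _ _ h)) (h6 _ (Or.inl rfl)) (h6 _ (Or.inr rfl))]
  · intro i
    by_cases h1 : i = a
    · rw [h1, s1, ha, hb]
    by_cases h2 : i = a + 1
    · rw [h2, s2, ha, hb]
    by_cases h3 : i = q
    · rw [h3, s3, hdq, hdq1]
    by_cases h4 : i = q + 1
    · rw [h4, s4, hdq, hdq1]
    rw [s5 i h1 h2 h3 h4]

/-- Invariance under the second Reidemeister move. -/
theorem stateSum_remove_r2 (hΓ : ∀ i, Γ i ≠ ConjClasses.mk 1) (G : RigidGauss π N) {a b : Pt N}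
    (h : G.IsR2 a b) : (G.remove {a, b}).stateSum Γ = G.stateSum Γ := by
  classical
  rw [RigidGauss.remove, stateSum_sub, RigidGauss.stateSum,
    ← Finset.sum_filter_add_sum_filter_not (G.states Γ) (fun c => G.jumps c ⊆ G.arrows \ {a, b}),
    left_eq_add]
  obtain ⟨E, hE, hm, hEe, hσa, hσb, hσ, hp, hd⟩ := h.exists_swap
  have hN := G.ne_zero_of_dir ((G.mem_arrows a).1 h.1)
  -- The extra states jump at exactly one of the two arrows. Each small edge has one end on the
  -- other arrow, where the color does not change: this is tameness.
  have hcase : ∀ c ∈ (G.states Γ).filter (fun c => ¬ G.jumps c ⊆ G.arrows \ {a, b}),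
      G.IsState Γ c ∧ (a ∈ G.jumps c ↔ b ∉ G.jumps c) ∧ IsTame E c := by
    intro c hc
    rw [Finset.mem_filter, RigidArrow.mem_states] at hc
    have h1 := h.not_both hΓ hc.1
    have h2 : a ∈ G.jumps c ∨ b ∈ G.jumps c := by
      by_contra hno
      push Not at hno
      refine hc.2 fun t ht => Finset.mem_sdiff.2 ⟨Finset.filter_subset _ _ ht, fun h => ?_⟩
      rcases Finset.mem_insert.1 h with rfl | h
      · exact hno.1 ht
      · rw [Finset.mem_singleton] at h
        exact hno.2 (h ▸ ht)
    refine ⟨hc.1, ⟨fun hA hB => h1 ⟨hA, hB⟩, fun hB => h2.resolve_right hB⟩, fun e he => ?_⟩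
    have h3 := jump_iff hc.1.coloring
    have hja : a ∉ G.jumps c → c (a - 1) = c a := fun hn => by
      by_contra hne
      exact hn (Naked.mem_jumps.2 ⟨(G.mem_arrows a).1 h.1, hne⟩)
    have hjb : b ∉ G.jumps c → c (b - 1) = c b := fun hn => by
      by_contra hne
      exact hn (Naked.mem_jumps.2 ⟨(G.mem_arrows b).1 h.2.1, hne⟩)
    obtain ⟨e1, e2, e3⟩ := hEe e he
    have key : ∀ j x, (x = j ∨ x = G.partner j) → c (j - 1) = c j → c (x - 1) = c x := by
      rintro j x (rfl | rfl) h
      · exact h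
      · exact (h3 j).1 h
    by_cases hA : a ∈ G.jumps c
    · have hB := hjb fun hB => h1 ⟨hA, hB⟩
      by_cases h4 : e = a ∨ e = G.partner a
      · right
        have := key b (e + 1) (e3.1 h4) hB
        rwa [add_sub_cancel_right] at this
      · left
        refine key b e ?_ hB
        rcases e1 with h | h | h | h
        exacts [absurd (Or.inl h) h4, Or.inl h, absurd (Or.inr h) h4, Or.inr h]
    · have hA := hja hA
      by_cases h4 : e = a ∨ e = G.partner a
      · left
        exact key a e h4 hA
      · right
        have h5 := mt e3.2 h4
        have := key a (e + 1) (by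
          rcases e2 with h | h | h | h
          exacts [Or.inl h, absurd (Or.inl h) h5, Or.inr h, absurd (Or.inr h) h5]) hA
        rwa [add_sub_cancel_right] at this
  have hjf : ∀ c : Pt N → Fin (n + 1), IsTame E c → G.jumps (flipColor E c) = (G.jumps c).image (swapPoint E) :=
    fun c hc => jumps_flipColor hE hc hd
  have hmemA : ∀ c : Pt N → Fin (n + 1), IsTame E c →
      (a ∈ G.jumps (flipColor E c) ↔ b ∈ G.jumps c) := fun c hc => by
    rw [hjf c hc, ← hσb, Function.Injective.mem_finset_image (swapPoint_injective hE)]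
  have hmemB : ∀ c : Pt N → Fin (n + 1), IsTame E c →
      (b ∈ G.jumps (flipColor E c) ↔ a ∈ G.jumps c) := fun c hc => by
    rw [hjf c hc, ← hσa, Function.Injective.mem_finset_image (swapPoint_injective hE)]
  -- Flipping transfers the jump from one arrow to the other, of opposite sign, and keeps the other
  -- jumps, so the weights cancel in pairs without fixed points.
  refine Finset.sum_involution (fun (c : Pt N → Fin (n + 1)) _ => flipColor E c) ?_ ?_ ?_ ?_
  · intro c hc
    obtain ⟨h1, h2, h3⟩ := hcase c hc
    rw [weight_flipColor hE h3 hd, RigidGauss.weight]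
    have key : ∀ x y : Pt N, (x = a ∧ y = b ∨ x = b ∧ y = a) → x ∈ G.jumps c → y ∉ G.jumps c →
        ∏ t ∈ G.jumps c, (G.writhe t : ℚ) + ∏ t ∈ G.jumps c, (G.writhe (swapPoint E t) : ℚ) = 0 := by
      intro x y hxy hx hy
      rw [← Finset.mul_prod_erase _ _ hx,
        ← Finset.mul_prod_erase _ (fun t => (G.writhe (swapPoint E t) : ℚ)) hx]
      have e1 : ∏ t ∈ (G.jumps c).erase x, (G.writhe (swapPoint E t) : ℚ) =
          ∏ t ∈ (G.jumps c).erase x, (G.writhe t : ℚ) := by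
        refine Finset.prod_congr rfl fun t ht => ?_
        obtain ⟨ht1, ht2⟩ := Finset.mem_erase.1 ht
        have ht3 : t ≠ y := by rintro rfl; exact hy ht2
        rw [hσ t (Naked.mem_jumps.1 ht2).1]
        · rcases hxy with ⟨rfl, rfl⟩ | ⟨rfl, rfl⟩ <;> assumption
        · rcases hxy with ⟨rfl, rfl⟩ | ⟨rfl, rfl⟩ <;> assumption
      have e2 : (G.writhe (swapPoint E x) : ℚ) = -(G.writhe x : ℚ) := by
        have h5 := h.2.2.2.1
        rcases hxy with ⟨rfl, rfl⟩ | ⟨rfl, rfl⟩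
        · rw [hσa, h5, SignType.coe_neg, neg_neg]
        · rw [hσb, h5, SignType.coe_neg]
      rw [e1, e2]
      ring
    by_cases hA : a ∈ G.jumps c
    · exact key a b (Or.inl ⟨rfl, rfl⟩) hA (h2.1 hA)
    · exact key b a (Or.inr ⟨rfl, rfl⟩) (not_not.1 (mt h2.2 hA)) hA
  · intro c hc _ heq
    obtain ⟨h1, h2, h3⟩ := hcase c hc
    have h4 := hmemA c h3
    rw [heq] at h4
    exact iff_not_self (h4.symm.trans h2)
  · intro c hc
    obtain ⟨h1, h2, h3⟩ := hcase c hc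
    rw [Finset.mem_filter, RigidArrow.mem_states]
    refine ⟨h1.flipColor hN hE h3 hp hd rfl hm, fun hsub => ?_⟩
    have h4 := hmemA c h3
    have h5 := hmemB c h3
    by_cases hA : a ∈ G.jumps c
    · have := hsub (h5.2 hA)
      simp at this
    · have := hsub (h4.2 (not_not.1 (mt h2.2 hA)))
      simp at this
  · intro c hc
    exact flipColor_flipColor hE (hcase c hc).2.2

end R2

/-! ### The local rules at three arrows that join three edges -/

section LocalRules

/-- The rule at an arrow with colors `l`, `r` at the tail and `hl`, `hr` at the head. -/
def Matches {K : Type*} [LinearOrder K] (l r hl hr : K) : Prop :=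
  (l = r ∧ hl = hr) ∨ (l < r ∧ hl = r ∧ hr = l)

/-- The rules at three arrows, from the first edge to the second (`a`) and third (`b`) edge, and
from the second to the third edge (`d`). The colors around the three edges are given, and `τ`, `μ`,
`β` tell which arrow comes first at each of them. -/
structure LocalRules {K : Type*} [LinearOrder K] (τ μ β : Prop) [Decidable τ] [Decidable μ]
    [Decidable β] (t₀ t₁ t₂ m₀ m₁ m₂ b₀ b₁ b₂ : K) : Prop where
  rule_a : Matches (if τ then t₁ else t₀) (if τ then t₂ else t₁) (if μ then m₀ else m₁)
    (if μ then m₁ else m₂)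
  rule_b : Matches (if τ then t₀ else t₁) (if τ then t₁ else t₂) (if β then b₁ else b₀)
    (if β then b₂ else b₁)
  rule_d : Matches (if μ then m₁ else m₀) (if μ then m₂ else m₁) (if β then b₀ else b₁)
    (if β then b₁ else b₂)

variable {K : Type*} [LinearOrder K] {τ μ β : Prop} [Decidable τ] [Decidable μ]
  [Decidable β] {t₀ t₁ t₂ m₀ m₁ m₂ b₀ b₁ b₂ : K}

theorem localRules_iff : LocalRules τ μ β t₀ t₁ t₂ m₀ m₁ m₂ b₀ b₁ b₂ ↔
    Matches (if τ then t₁ else t₀) (if τ then t₂ else t₁) (if μ then m₀ else m₁)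
      (if μ then m₁ else m₂) ∧
    Matches (if τ then t₀ else t₁) (if τ then t₁ else t₂) (if β then b₁ else b₀)
      (if β then b₂ else b₁) ∧
    Matches (if μ then m₁ else m₀) (if μ then m₂ else m₁) (if β then b₀ else b₁)
      (if β then b₁ else b₂) :=
  ⟨fun h => ⟨h.1, h.2, h.3⟩, fun h => ⟨h.1, h.2.1, h.2.2⟩⟩

/-- The two jumps share the middle color, so the order of the three outer colors is determined. Only
`τ` affects the outer colors; `μ` and `β` merely affect the colors forced on the small edges. This
is what makes the two sides of the move comparable. -/
theorem localRules_ab :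
    (LocalRules τ μ β t₀ t₁ t₂ m₀ m₁ m₂ b₀ b₁ b₂ ∧
      (if τ then t₁ else t₀) ≠ (if τ then t₂ else t₁) ∧
      (if τ then t₀ else t₁) ≠ (if τ then t₁ else t₂) ∧
      (if μ then m₁ else m₀) = (if μ then m₂ else m₁)) ↔
    (if τ then t₀ = b₂ ∧ t₂ = m₀ ∧ m₂ = b₀ ∧ t₀ < m₂ ∧ m₂ < t₂
      else t₂ = b₀ ∧ b₂ = m₀ ∧ m₂ = t₀ ∧ t₀ < m₀ ∧ m₀ < t₂) ∧
      t₁ = (if τ then b₀ else m₀) ∧ m₁ = (if μ then m₂ else m₀) ∧ b₁ = (if β then b₀ else b₂) := by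
  rw [localRules_iff]
  by_cases hτ : τ <;> by_cases hμ : μ <;> by_cases hβ : β <;>
    simp only [hτ, hμ, hβ, Matches, if_true, if_false] <;> grind

/-- Here the two jumps share an extreme color, the least or the greatest according to `μ`, and the
order of the other two colors is left free. The last condition excludes a double edge, which never
occurs in a state. -/
theorem localRules_ad :
    (LocalRules τ μ β t₀ t₁ t₂ m₀ m₁ m₂ b₀ b₁ b₂ ∧
      (if τ then t₁ else t₀) ≠ (if τ then t₂ else t₁) ∧
      (if μ then m₁ else m₀) ≠ (if μ then m₂ else m₁) ∧
      (if τ then t₀ else t₁) = (if τ then t₁ else t₂) ∧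
      ¬ ((if τ then t₁ else t₀) = (if μ then m₁ else m₀) ∧
        (if τ then t₂ else t₁) = (if μ then m₂ else m₁))) ↔
    (if μ then t₀ = b₂ ∧ t₂ = m₀ ∧ m₂ = b₀ ∧ t₀ < m₂ ∧ t₀ < t₂ ∧ m₂ ≠ t₂
      else t₂ = b₀ ∧ b₂ = m₀ ∧ m₂ = t₀ ∧ t₀ < t₂ ∧ m₀ < t₂ ∧ t₀ ≠ m₀) ∧
      t₁ = (if τ then t₀ else t₂) ∧ m₁ = (if μ then t₀ else t₂) ∧ b₁ = (if β then b₂ else b₀) := by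
  rw [localRules_iff]
  by_cases hτ : τ <;> by_cases hμ : μ <;> by_cases hβ : β <;>
    simp only [hτ, hμ, hβ, Matches, if_true, if_false] <;> grind

/-- The two jumps again share the middle color; the cyclic order of the outer colors is now dictated
by `β`. -/
theorem localRules_bd :
    (LocalRules τ μ β t₀ t₁ t₂ m₀ m₁ m₂ b₀ b₁ b₂ ∧
      (if τ then t₀ else t₁) ≠ (if τ then t₁ else t₂) ∧
      (if μ then m₁ else m₀) ≠ (if μ then m₂ else m₁) ∧
      (if τ then t₁ else t₀) = (if τ then t₂ else t₁)) ↔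
    (if β then t₀ = b₂ ∧ t₂ = m₀ ∧ m₂ = b₀ ∧ t₀ < t₂ ∧ t₂ < m₂
      else t₂ = b₀ ∧ b₂ = m₀ ∧ m₂ = t₀ ∧ m₀ < t₀ ∧ t₀ < t₂) ∧
      t₁ = (if τ then t₂ else t₀) ∧ m₁ = (if μ then m₀ else m₂) ∧ b₁ = (if β then m₀ else t₀) := by
  rw [localRules_iff]
  by_cases hτ : τ <;> by_cases hμ : μ <;> by_cases hβ : β <;>
    simp only [hτ, hμ, hβ, Matches, if_true, if_false] <;> grind

/-- If the color changes at the three arrows, then two of them join the same colors or the three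
edges can be recolored. -/
theorem LocalRules.of_three_jumps (h : LocalRules τ μ β t₀ t₁ t₂ m₀ m₁ m₂ b₀ b₁ b₂)
    (ha : (if τ then t₁ else t₀) ≠ (if τ then t₂ else t₁))
    (hb : (if τ then t₀ else t₁) ≠ (if τ then t₁ else t₂))
    (hd : (if μ then m₁ else m₀) ≠ (if μ then m₂ else m₁)) :
    ((if τ then t₁ else t₀) = (if μ then m₁ else m₀) ∧
      (if τ then t₂ else t₁) = (if μ then m₂ else m₁)) ∨
    ∃ v, LocalRules τ μ β t₀ v t₂ m₀ v m₂ b₀ v b₂ ∧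
      (if τ then t₀ else v) = (if τ then v else t₂) := by
  rw [localRules_iff] at h
  simp only [localRules_iff]
  by_cases hτ : τ <;> by_cases hμ : μ <;> by_cases hβ : β <;>
    simp only [hτ, hμ, hβ, Matches, if_true, if_false] at h ha hb hd ⊢ <;>
    first
    | (exfalso; grind)
    | (left; grind)
    -- The requirement that `b` stop jumping leaves one choice of `v`: `t₀` or `t₂`, according to
    -- `τ`.
    | (right; refine ⟨t₀, ?_⟩; grind)
    | (right; refine ⟨t₂, ?_⟩; grind)

end LocalRules

/-! ### Triangles -/

section Triangle

variable {N n : ℕ}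

/-- The arrows with tails `a`, `b`, `d` join the edges `p`, `q`, `r`. -/
structure Triangle (D : Naked N) (p q r a b d : Pt N) : Prop where
  dir_a : D.dir a = 1
  dir_b : D.dir b = 1
  dir_d : D.dir d = 1
  sparse : ∀ e ∈ ({p, q, r} : Finset (Pt N)), e + 1 ∉ ({p, q, r} : Finset (Pt N))
  p_ne_q : p ≠ q
  p_ne_r : p ≠ r
  q_ne_r : q ≠ r
  top : (b = p ∧ a = p + 1) ∨ (a = p ∧ b = p + 1)
  mid : (D.partner a = q ∧ d = q + 1) ∨ (d = q ∧ D.partner a = q + 1)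
  bot : (D.partner d = r ∧ D.partner b = r + 1) ∨ (D.partner b = r ∧ D.partner d = r + 1)

namespace Triangle

variable {D : Naked N} {p q r a b d : Pt N}

theorem size_ne_zero (h : Triangle D p q r a b d) : N ≠ 0 := D.ne_zero_of_dir h.dir_a

theorem separate (h : Triangle D p q r a b d) :
    p + 1 ≠ q ∧ p + 1 ≠ r ∧ q + 1 ≠ p ∧ q + 1 ≠ r ∧ r + 1 ≠ p ∧ r + 1 ≠ q := by
  have h1 := h.sparse p (by simp)
  have h2 := h.sparse q (by simp)
  have h3 := h.sparse r (by simp)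
  simp only [Finset.mem_insert, Finset.mem_singleton, not_or] at h1 h2 h3
  exact ⟨h1.2.1, h1.2.2, h2.1, h2.2.2, h3.1, h3.2.1⟩

/-- The edges next to the three edges are not among them. -/
theorem notMem (h : Triangle D p q r a b d) {e : Pt N} (he : e = p ∨ e = q ∨ e = r) :
    e - 1 ∉ ({p, q, r} : Finset (Pt N)) ∧ e + 1 ∉ ({p, q, r} : Finset (Pt N)) := by
  have : e ∈ ({p, q, r} : Finset (Pt N)) := by simpa using he
  exact ⟨sub_one_notMem h.sparse this, h.sparse e this⟩

theorem a_ne_b (h : Triangle D p q r a b d) : a ≠ b := by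
  have n := add_one_ne h.size_ne_zero p
  rcases h.top with ⟨rfl, rfl⟩ | ⟨rfl, rfl⟩
  · exact n
  · exact n.symm

theorem head_ne_tail {x y : Pt N} (hx : D.dir x = 1) (hy : D.dir y = 1) : D.partner x ≠ y := by
  intro h
  have := D.dir_partner x
  rw [h, hx, hy] at this
  exact absurd this (by decide)

theorem a_ne_d (h : Triangle D p q r a b d) : a ≠ d := by
  obtain ⟨s1, s2, s3, s4, s5, s6⟩ := h.separate
  have s := h.p_ne_q
  rcases h.top with ⟨-, h1⟩ | ⟨h1, -⟩ <;> rcases h.mid with ⟨-, h2⟩ | ⟨h2, -⟩ <;> rw [h1, h2]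
  · exact fun h => s (add_right_cancel h)
  · exact s1
  · exact s3.symm
  · exact s

theorem b_ne_d (h : Triangle D p q r a b d) : b ≠ d := by
  obtain ⟨s1, s2, s3, s4, s5, s6⟩ := h.separate
  have s := h.p_ne_q
  rcases h.top with ⟨h1, -⟩ | ⟨-, h1⟩ <;> rcases h.mid with ⟨-, h2⟩ | ⟨h2, -⟩ <;> rw [h1, h2]
  · exact s3.symm
  · exact s
  · exact fun h => s (add_right_cancel h)
  · exact s1

theorem eq_of_mem (h : Triangle D p q r a b d) {x : Pt N}
    (hx : x ∈ ({p, q, r} : Finset (Pt N)) ∨ x - 1 ∈ ({p, q, r} : Finset (Pt N))) :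
    x = a ∨ x = b ∨ x = d ∨ x = D.partner a ∨ x = D.partner b ∨ x = D.partner d := by
  simp only [Finset.mem_insert, Finset.mem_singleton, sub_eq_iff_eq_add] at hx
  have h1 := h.top
  have h2 := h.mid
  have h3 := h.bot
  rcases hx with (rfl | rfl | rfl) | (rfl | rfl | rfl)
  · rcases h1 with h1 | h1
    · exact Or.inr (Or.inl h1.1.symm)
    · exact Or.inl h1.1.symm
  · rcases h2 with h2 | h2
    · exact Or.inr (Or.inr (Or.inr (Or.inl h2.1.symm)))
    · exact Or.inr (Or.inr (Or.inl h2.1.symm))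
  · rcases h3 with h3 | h3
    · exact Or.inr (Or.inr (Or.inr (Or.inr (Or.inr h3.1.symm))))
    · exact Or.inr (Or.inr (Or.inr (Or.inr (Or.inl h3.1.symm))))
  · rcases h1 with h1 | h1
    · exact Or.inl h1.2.symm
    · exact Or.inr (Or.inl h1.2.symm)
  · rcases h2 with h2 | h2
    · exact Or.inr (Or.inr (Or.inl h2.2.symm))
    · exact Or.inr (Or.inr (Or.inr (Or.inl h2.2.symm)))
  · rcases h3 with h3 | h3
    · exact Or.inr (Or.inr (Or.inr (Or.inr (Or.inl h3.2.symm))))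
    · exact Or.inr (Or.inr (Or.inr (Or.inr (Or.inr h3.2.symm))))

theorem tail_mem (h : Triangle D p q r a b d) {x : Pt N} (hx : x = a ∨ x = b ∨ x = d) :
    x ∈ ({p, q, r} : Finset (Pt N)) ∨ x - 1 ∈ ({p, q, r} : Finset (Pt N)) := by
  simp only [Finset.mem_insert, Finset.mem_singleton, sub_eq_iff_eq_add]
  have h1 := h.top
  have h2 := h.mid
  rcases hx with rfl | rfl | rfl
  · rcases h1 with h1 | h1
    · exact Or.inr (Or.inl h1.2)
    · exact Or.inl (Or.inl h1.1)
  · rcases h1 with h1 | h1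
    · exact Or.inl (Or.inl h1.1)
    · exact Or.inr (Or.inl h1.2)
  · rcases h2 with h2 | h2
    · exact Or.inr (Or.inr (Or.inl h2.2))
    · exact Or.inl (Or.inr (Or.inl h2.1))

/-- The six end points of the three small edges are exhausted by the ends of the three arrows, so
any other arrow is untouched by the move. -/
theorem outside (h : Triangle D p q r a b d) {t : Pt N} (ht : D.dir t = 1) (ha : t ≠ a)
    (hb : t ≠ b) (hd : t ≠ d) :
    (t ∉ ({p, q, r} : Finset (Pt N)) ∧ t - 1 ∉ ({p, q, r} : Finset (Pt N))) ∧
    D.partner t ∉ ({p, q, r} : Finset (Pt N)) ∧ D.partner t - 1 ∉ ({p, q, r} : Finset (Pt N)) := by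
  rw [← not_or, ← not_or]
  refine ⟨fun hm => ?_, fun hm => ?_⟩
  · rcases h.eq_of_mem hm with h1 | h1 | h1 | h1 | h1 | h1
    · exact ha h1
    · exact hb h1
    · exact hd h1
    · exact head_ne_tail h.dir_a ht h1.symm
    · exact head_ne_tail h.dir_b ht h1.symm
    · exact head_ne_tail h.dir_d ht h1.symm
  · rcases h.eq_of_mem hm with h1 | h1 | h1 | h1 | h1 | h1
    · exact head_ne_tail ht h.dir_a h1
    · exact head_ne_tail ht h.dir_b h1
    · exact head_ne_tail ht h.dir_d h1
    · exact ha (D.partner_injective h1)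
    · exact hb (D.partner_injective h1)
    · exact hd (D.partner_injective h1)

variable {K : Type*}

theorem colors_a (h : Triangle D p q r a b d) (c : Pt N → K) :
    c (a - 1) = (if b = p then c p else c (p - 1)) ∧ c a = (if b = p then c (p + 1) else c p) := by
  rcases h.top with ⟨h1, h2⟩ | ⟨h1, h2⟩
  · rw [if_pos h1, if_pos h1, h2, add_sub_cancel_right]; exact ⟨rfl, rfl⟩
  · have : b ≠ p := by rw [h2]; exact add_one_ne h.size_ne_zero p
    rw [if_neg this, if_neg this, h1]; exact ⟨rfl, rfl⟩

theorem colors_b (h : Triangle D p q r a b d) (c : Pt N → K) :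
    c (b - 1) = (if b = p then c (p - 1) else c p) ∧ c b = (if b = p then c p else c (p + 1)) := by
  rcases h.top with ⟨h1, h2⟩ | ⟨h1, h2⟩
  · rw [if_pos h1, if_pos h1, h1]; exact ⟨rfl, rfl⟩
  · have : b ≠ p := by rw [h2]; exact add_one_ne h.size_ne_zero p
    rw [if_neg this, if_neg this, h2, add_sub_cancel_right]; exact ⟨rfl, rfl⟩

theorem colors_head_a (h : Triangle D p q r a b d) (c : Pt N → K) :
    c (D.partner a - 1) = (if D.partner a = q then c (q - 1) else c q) ∧
      c (D.partner a) = (if D.partner a = q then c q else c (q + 1)) := by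
  rcases h.mid with ⟨h1, h2⟩ | ⟨h1, h2⟩
  · rw [if_pos h1, if_pos h1, h1]; exact ⟨rfl, rfl⟩
  · have : D.partner a ≠ q := by rw [h2]; exact add_one_ne h.size_ne_zero q
    rw [if_neg this, if_neg this, h2, add_sub_cancel_right]; exact ⟨rfl, rfl⟩

theorem colors_d (h : Triangle D p q r a b d) (c : Pt N → K) :
    c (d - 1) = (if D.partner a = q then c q else c (q - 1)) ∧
      c d = (if D.partner a = q then c (q + 1) else c q) := by
  rcases h.mid with ⟨h1, h2⟩ | ⟨h1, h2⟩
  · rw [if_pos h1, if_pos h1, h2, add_sub_cancel_right]; exact ⟨rfl, rfl⟩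
  · have : D.partner a ≠ q := by rw [h2]; exact add_one_ne h.size_ne_zero q
    rw [if_neg this, if_neg this, h1]; exact ⟨rfl, rfl⟩

theorem colors_head_d (h : Triangle D p q r a b d) (c : Pt N → K) :
    c (D.partner d - 1) = (if D.partner d = r then c (r - 1) else c r) ∧
      c (D.partner d) = (if D.partner d = r then c r else c (r + 1)) := by
  rcases h.bot with ⟨h1, h2⟩ | ⟨h1, h2⟩
  · rw [if_pos h1, if_pos h1, h1]; exact ⟨rfl, rfl⟩
  · have : D.partner d ≠ r := by rw [h2]; exact add_one_ne h.size_ne_zero r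
    rw [if_neg this, if_neg this, h2, add_sub_cancel_right]; exact ⟨rfl, rfl⟩

theorem colors_head_b (h : Triangle D p q r a b d) (c : Pt N → K) :
    c (D.partner b - 1) = (if D.partner d = r then c r else c (r - 1)) ∧
      c (D.partner b) = (if D.partner d = r then c (r + 1) else c r) := by
  rcases h.bot with ⟨h1, h2⟩ | ⟨h1, h2⟩
  · rw [if_pos h1, if_pos h1, h2, add_sub_cancel_right]; exact ⟨rfl, rfl⟩
  · have : D.partner d ≠ r := by rw [h2]; exact add_one_ne h.size_ne_zero r
    rw [if_neg this, if_neg this, h1]; exact ⟨rfl, rfl⟩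

variable [LinearOrder K]

/-- The rules at the three arrows, in terms of the colors around the three edges. -/
theorem localRules_iff (h : Triangle D p q r a b d) (c : Pt N → K) :
    LocalRules (b = p) (D.partner a = q) (D.partner d = r) (c (p - 1)) (c p) (c (p + 1))
      (c (q - 1)) (c q) (c (q + 1)) (c (r - 1)) (c r) (c (r + 1)) ↔
    Matches (c (a - 1)) (c a) (c (D.partner a - 1)) (c (D.partner a)) ∧
    Matches (c (b - 1)) (c b) (c (D.partner b - 1)) (c (D.partner b)) ∧
    Matches (c (d - 1)) (c d) (c (D.partner d - 1)) (c (D.partner d)) := by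
  rw [GaussKnot.localRules_iff, (h.colors_a c).1, (h.colors_a c).2, (h.colors_b c).1,
    (h.colors_b c).2, (h.colors_d c).1, (h.colors_d c).2, (h.colors_head_a c).1,
    (h.colors_head_a c).2, (h.colors_head_b c).1, (h.colors_head_b c).2, (h.colors_head_d c).1,
    (h.colors_head_d c).2]

theorem isColoring_iff (h : Triangle D p q r a b d) (c : Pt N → K) :
    D.IsColoring c ↔
    LocalRules (b = p) (D.partner a = q) (D.partner d = r) (c (p - 1)) (c p) (c (p + 1))
      (c (q - 1)) (c q) (c (q + 1)) (c (r - 1)) (c r) (c (r + 1)) ∧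
    ∀ t, D.dir t = 1 → t ≠ a → t ≠ b → t ≠ d →
      Matches (c (t - 1)) (c t) (c (D.partner t - 1)) (c (D.partner t)) := by
  rw [h.localRules_iff]
  constructor
  · exact fun hc => ⟨⟨hc a h.dir_a, hc b h.dir_b, hc d h.dir_d⟩, fun t ht _ _ _ => hc t ht⟩
  · rintro ⟨⟨h1, h2, h3⟩, h4⟩ t ht
    by_cases ha : t = a
    · rw [ha]; exact h1
    by_cases hb : t = b
    · rw [hb]; exact h2
    by_cases hd : t = d
    · rw [hd]; exact h3
    exact h4 t ht ha hb hd

/-- The rules at the other arrows only depend on the colors of the other edges. -/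
theorem matches_congr (h : Triangle D p q r a b d) {c c' : Pt N → K}
    (hcc : ∀ e ∉ ({p, q, r} : Finset (Pt N)), c e = c' e) {t : Pt N} (ht : D.dir t = 1)
    (ha : t ≠ a) (hb : t ≠ b) (hd : t ≠ d) :
    Matches (c (t - 1)) (c t) (c (D.partner t - 1)) (c (D.partner t)) ↔
    Matches (c' (t - 1)) (c' t) (c' (D.partner t - 1)) (c' (D.partner t)) := by
  obtain ⟨⟨h1, h2⟩, h3, h4⟩ := h.outside ht ha hb hd
  rw [hcc _ h1, hcc _ h2, hcc _ h3, hcc _ h4]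

end Triangle

end Triangle

/-! ### Impossibility of three jumps at a triangle -/

section ThreeJumps

variable {π : Type u} [Group π] {N n : ℕ} {Γ : Fin (n + 1) → ConjClasses π}
  {p q r a b d : Pt N}

/-- The three arrows of a triangle are not all jumps of a state. -/
theorem Triangle.not_three_jumps (hΓ : ∀ i, Γ i ≠ ConjClasses.mk 1) {A : RigidArrow π N}
    (h : Triangle A.toNaked p q r a b d)
    (hm : ∀ e ∈ ({p, q, r} : Finset (Pt N)), A.mark.at e = 1) {c : Pt N → Fin (n + 1)}
    (hc : A.IsState Γ c) (ha : a ∈ A.jumps c) (hb : b ∈ A.jumps c) (hd : d ∈ A.jumps c) : False := by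
  have hs := Marking.surjective_of_colorProd hΓ hc.colorProd
  have h1 := (h.isColoring_iff c).1 hc.coloring
  have ja := (Naked.mem_jumps.1 ha).2
  have jb := (Naked.mem_jumps.1 hb).2
  have jd := (Naked.mem_jumps.1 hd).2
  rw [(h.colors_a c).1, (h.colors_a c).2] at ja
  rw [(h.colors_b c).1, (h.colors_b c).2] at jb
  rw [(h.colors_d c).1, (h.colors_d c).2] at jd
  -- Either `a` and `d` would be a double edge of the tree of colors, or one color `v` on the three
  -- small edges removes the jump `b` without creating any, against minimality.
  rcases h1.1.of_three_jumps ja jb jd with h2 | ⟨v, h2, h3⟩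
  · refine h.a_ne_d (hc.coloring.jump_injective hs hc.card_jumps ha hd ?_ ?_)
    · rw [(h.colors_a c).1, (h.colors_d c).1]; exact h2.1
    · rw [(h.colors_a c).2, (h.colors_d c).2]; exact h2.2
  · set c' : Pt N → Fin (n + 1) := fun e => if e ∈ ({p, q, r} : Finset (Pt N)) then v else c e
      with hc'
    have u0 : ∀ e ∉ ({p, q, r} : Finset (Pt N)), c' e = c e := fun e he => if_neg he
    have u1 : ∀ e ∈ ({p, q, r} : Finset (Pt N)), c' e = v := fun e he => if_pos he
    have np := h.notMem (e := p) (by simp)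
    have nq := h.notMem (e := q) (by simp)
    have nr := h.notMem (e := r) (by simp)
    have up := u1 p (by simp)
    have uq := u1 q (by simp)
    have ur := u1 r (by simp)
    refine hc.not_ssubset_jumps hΓ h.size_ne_zero (c' := c') ?_ ?_ ?_
    · rw [h.isColoring_iff, u0 _ np.1, u0 _ np.2, u0 _ nq.1, u0 _ nq.2, u0 _ nr.1, u0 _ nr.2, up,
        uq, ur]
      exact ⟨h2, fun t ht hta htb htd => (h.matches_congr u0 ht hta htb htd).2 (h1.2 t ht hta htb htd)⟩
    · intro e he
      by_cases heE : e ∈ ({p, q, r} : Finset (Pt N))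
      · exact hm e heE
      · exact absurd (u0 e heE) he
    · refine (Finset.ssubset_iff_of_subset fun t ht => ?_).2 ⟨b, hb, fun hb' => ?_⟩
      · by_cases hta : t = a
        · rw [hta]; exact ha
        by_cases htb : t = b
        · rw [htb]; exact hb
        by_cases htd : t = d
        · rw [htd]; exact hd
        rw [Naked.mem_jumps] at ht ⊢
        obtain ⟨⟨h4, h5⟩, -⟩ := h.outside ht.1 hta htb htd
        rw [← u0 _ h4, ← u0 _ h5]
        exact ht
      · refine (Naked.mem_jumps.1 hb').2 ?_
        rw [(h.colors_b c').1, (h.colors_b c').2, u0 _ np.1, u0 _ np.2, up]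
        exact h3

end ThreeJumps

/-! ### States with two jumps in a triangle -/

section TwoJumps

variable {π : Type u} [Group π] {N n : ℕ}

/-- The jumps at arrows that do not end at an edge of `E`. -/
def Naked.outerJumps {K : Type*} [DecidableEq K] (D : Naked N) (E : Finset (Pt N)) (c : Pt N → K) :
    Finset (Pt N) :=
  (D.jumps c).filter fun t => t ∉ E ∧ t - 1 ∉ E

/-- A coloring of the edges outside `E` that may be completed to a state with two more jumps. -/
structure RigidArrow.IsOuter (A : RigidArrow π N) (E : Finset (Pt N))
    (Γ : Fin (n + 1) → ConjClasses π) (c : Pt N → Fin (n + 1)) : Prop where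
  zero : ∀ e ∈ E, c e = 0
  rule : ∀ t, A.dir t = 1 → t ∉ E → t - 1 ∉ E →
    Matches (c (t - 1)) (c t) (c (A.partner t - 1)) (c (A.partner t))
  card_jumps : (A.outerJumps E c).card + 2 = n
  colorProd : ∀ k, A.mark.colorProd c k = Γ k

open Classical in
/-- The sum of the weights of the colorings outside `E` with the property `P`. -/
noncomputable def RigidGauss.outerSum (G : RigidGauss π N) (E : Finset (Pt N))
    (Γ : Fin (n + 1) → ConjClasses π) (P : (Pt N → Fin (n + 1)) → Prop) : ℚ :=
  ∑ c ∈ Finset.univ.filter (fun c => G.IsOuter E Γ c ∧ P c),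
    ∏ t ∈ G.outerJumps E c, (G.writhe t : ℚ)

theorem outerSum_or (G : RigidGauss π N) (E : Finset (Pt N)) (Γ : Fin (n + 1) → ConjClasses π)
    (P Q R : (Pt N → Fin (n + 1)) → Prop) (h : ∀ c, R c ↔ P c ∨ Q c) (h' : ∀ c, P c → ¬ Q c) :
    G.outerSum E Γ R = G.outerSum E Γ P + G.outerSum E Γ Q := by
  classical
  rw [RigidGauss.outerSum, RigidGauss.outerSum, RigidGauss.outerSum, ← Finset.sum_union]
  · refine Finset.sum_congr ?_ fun _ _ => rfl
    ext c
    simp only [Finset.mem_union, Finset.mem_filter, Finset.mem_univ, true_and, h, and_or_left]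
  · rw [Finset.disjoint_left]
    intro c hc hc'
    exact h' c (Finset.mem_filter.1 hc).2.2 (Finset.mem_filter.1 hc').2.2

/-- The outer sums only depend on the diagram outside `E`. -/
theorem outerSum_congr {G G' : RigidGauss π N} {E : Finset (Pt N)} (hm : G'.mark = G.mark)
    (h : ∀ t, t ∉ E → t - 1 ∉ E → (G.dir t = 1 → G'.partner t = G.partner t) ∧
      G'.dir t = G.dir t ∧ G'.writhe t = G.writhe t)
    (Γ : Fin (n + 1) → ConjClasses π) (P : (Pt N → Fin (n + 1)) → Prop) :
    G'.outerSum E Γ P = G.outerSum E Γ P := by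
  classical
  have hj : ∀ c : Pt N → Fin (n + 1), G'.outerJumps E c = G.outerJumps E c := by
    intro c
    ext t
    simp only [Naked.outerJumps, Finset.mem_filter, Naked.mem_jumps]
    refine and_congr_left fun ht => ?_
    rw [(h t ht.1 ht.2).2.1]
  have ho : ∀ c : Pt N → Fin (n + 1), G'.IsOuter E Γ c ↔ G.IsOuter E Γ c := by
    intro c
    refine ⟨fun H => ⟨H.zero, fun t ht h1 h2 => ?_, by rw [← hj, H.card_jumps],
        fun k => by rw [← hm, H.colorProd]⟩,
      fun H => ⟨H.zero, fun t ht h1 h2 => ?_, by rw [hj, H.card_jumps],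
        fun k => by rw [hm, H.colorProd]⟩⟩
    · have := H.rule t (by rw [(h t h1 h2).2.1, ht]) h1 h2
      rwa [(h t h1 h2).1 ht] at this
    · have ht' : G.dir t = 1 := by rw [← (h t h1 h2).2.1, ht]
      rw [(h t h1 h2).1 ht']
      exact H.rule t ht' h1 h2
  rw [RigidGauss.outerSum, RigidGauss.outerSum]
  refine Finset.sum_congr ?_ fun c _ => ?_
  · ext c
    simp only [Finset.mem_filter, ho]
  · rw [hj]
    refine Finset.prod_congr rfl fun t ht => ?_
    have := (Finset.mem_filter.1 ht).2
    rw [(h t this.1 this.2).2.2]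

variable {Γ : Fin (n + 1) → ConjClasses π} {p q r a b d : Pt N}

/-- The colors of the small edges are forced by the outer ones through `u`, so erasing them is a
bijection onto the outer colorings with property `P`. The pair of jumps is left arbitrary so that
one bijection serves all three pairs. -/
theorem Triangle.sum_two_jumps {G : RigidGauss π N} (h : Triangle G.toNaked p q r a b d)
    (hm : ∀ e ∈ ({p, q, r} : Finset (Pt N)), G.mark.at e = 1) {x y z : Pt N}
    (hperm : ∀ t, (t = x ∨ t = y ∨ t = z) ↔ (t = a ∨ t = b ∨ t = d)) (hxy : x ≠ y)
    {P : (Pt N → Fin (n + 1)) → Prop} {u : (Pt N → Fin (n + 1)) → Pt N → Fin (n + 1)}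
    (hP : ∀ c c' : Pt N → Fin (n + 1), (∀ e ∉ ({p, q, r} : Finset (Pt N)), c e = c' e) →
      (P c ↔ P c') ∧ u c = u c')
    (hto : ∀ c, G.IsState Γ c → c (x - 1) ≠ c x → c (y - 1) ≠ c y → c (z - 1) = c z →
      P c ∧ ∀ e ∈ ({p, q, r} : Finset (Pt N)), c e = u c e)
    (hfrom : ∀ c, P c → (∀ e ∈ ({p, q, r} : Finset (Pt N)), c e = u c e) →
      LocalRules (b = p) (G.partner a = q) (G.partner d = r) (c (p - 1)) (c p) (c (p + 1))
        (c (q - 1)) (c q) (c (q + 1)) (c (r - 1)) (c r) (c (r + 1)) ∧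
      c (x - 1) ≠ c x ∧ c (y - 1) ≠ c y ∧ c (z - 1) = c z) :
    ∑ c ∈ (G.states Γ).filter (fun c => c (x - 1) ≠ c x ∧ c (y - 1) ≠ c y ∧ c (z - 1) = c z),
      G.weight c = G.writhe x * G.writhe y * G.outerSum {p, q, r} Γ P := by
  classical
  set E : Finset (Pt N) := {p, q, r} with hE
  have hdir : ∀ t, (t = x ∨ t = y ∨ t = z) → G.dir t = 1 := by
    intro t ht
    rcases (hperm t).1 ht with rfl | rfl | rfl
    exacts [h.dir_a, h.dir_b, h.dir_d]
  have hin : ∀ t, (t = x ∨ t = y ∨ t = z) → ¬ (t ∉ E ∧ t - 1 ∉ E) := fun t ht hn => by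
    rcases h.tail_mem ((hperm t).1 ht) with h1 | h1
    · exact hn.1 h1
    · exact hn.2 h1
  have hout : ∀ t, G.dir t = 1 → ¬ (t = x ∨ t = y ∨ t = z) →
      t ∉ E ∧ t - 1 ∉ E := fun t ht hn => by
    rw [hperm, not_or, not_or] at hn
    exact (h.outside ht hn.1 hn.2.1 hn.2.2).1
  have hjumps : ∀ c : Pt N → Fin (n + 1), c (x - 1) ≠ c x → c (y - 1) ≠ c y → c (z - 1) = c z →
      G.jumps c = insert x (insert y (G.outerJumps E c)) := by
    intro c hx hy hz
    ext t
    simp only [Finset.mem_insert, Naked.outerJumps, Finset.mem_filter]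
    constructor
    · intro ht
      by_cases h1 : t = x
      · exact Or.inl h1
      by_cases h2 : t = y
      · exact Or.inr (Or.inl h2)
      refine Or.inr (Or.inr ⟨ht, hout t (Naked.mem_jumps.1 ht).1 ?_⟩)
      rintro (h3 | h3 | h3)
      · exact h1 h3
      · exact h2 h3
      · exact (Naked.mem_jumps.1 ht).2 (h3 ▸ hz)
    · rintro (rfl | rfl | ht)
      · exact Naked.mem_jumps.2 ⟨hdir _ (Or.inl rfl), hx⟩
      · exact Naked.mem_jumps.2 ⟨hdir _ (Or.inr (Or.inl rfl)), hy⟩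
      · exact ht.1
  have hxo : ∀ c : Pt N → Fin (n + 1), x ∉ insert y (G.outerJumps E c) := fun c hx => by
    rcases Finset.mem_insert.1 hx with hx | hx
    · exact hxy hx
    · exact hin x (Or.inl rfl) (Finset.mem_filter.1 hx).2
  have hyo : ∀ c : Pt N → Fin (n + 1), y ∉ G.outerJumps E c := fun c hy =>
    hin y (Or.inr (Or.inl rfl)) (Finset.mem_filter.1 hy).2
  have hocongr : ∀ c c' : Pt N → Fin (n + 1), (∀ e ∉ E, c e = c' e) →
      G.outerJumps E c = G.outerJumps E c' := by
    intro c c' hcc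
    ext t
    simp only [Naked.outerJumps, Finset.mem_filter, Naked.mem_jumps]
    refine and_congr_left fun ht => ?_
    rw [hcc _ ht.1, hcc _ ht.2]
  have hpcongr : ∀ c c' : Pt N → Fin (n + 1), (∀ e ∉ E, c e = c' e) → ∀ k,
      G.mark.colorProd c k = G.mark.colorProd c' k := fun c c' hcc k =>
    Marking.colorProd_congr h.size_ne_zero _ (fun e he => hm e (by
      by_contra heE; exact he (hcc e heE))) k
  set f : (Pt N → Fin (n + 1)) → Pt N → Fin (n + 1) := fun c e => if e ∈ E then 0 else c e with hf
  set g : (Pt N → Fin (n + 1)) → Pt N → Fin (n + 1) := fun c e => if e ∈ E then u c e else c e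
    with hg
  have hfo : ∀ c, ∀ e ∉ E, f c e = c e := fun c e he => if_neg he
  have hgo : ∀ c, ∀ e ∉ E, g c e = c e := fun c e he => if_neg he
  have hgE : ∀ c, ∀ e ∈ E, g c e = u (g c) e := fun c e he => by
    rw [(hP (g c) c (hgo c)).2]; exact if_pos he
  have hmatch : ∀ c c' : Pt N → Fin (n + 1), (∀ e ∉ E, c e = c' e) → ∀ t, G.dir t = 1 →
      t ∉ E → t - 1 ∉ E →
      Matches (c (t - 1)) (c t) (c (G.partner t - 1)) (c (G.partner t)) →
      Matches (c' (t - 1)) (c' t) (c' (G.partner t - 1)) (c' (G.partner t)) := by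
    intro c c' hcc t ht h1 h2
    have h3 : ¬ (t = a ∨ t = b ∨ t = d) := fun h3 => hin t ((hperm t).2 h3) ⟨h1, h2⟩
    rw [not_or, not_or] at h3
    exact (h.matches_congr hcc ht h3.1 h3.2.1 h3.2.2).1
  rw [RigidGauss.outerSum, Finset.mul_sum]
  refine Finset.sum_bij' (fun c _ => f c) (fun c _ => g c) ?_ ?_ ?_ ?_ ?_
  · intro c hc
    rw [Finset.mem_filter, RigidArrow.mem_states] at hc
    obtain ⟨hs, hx, hy, hz⟩ := hc
    have hcard := hs.card_jumps
    rw [hjumps c hx hy hz, Finset.card_insert_of_notMem (hxo c),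
      Finset.card_insert_of_notMem (hyo c)] at hcard
    rw [Finset.mem_filter, (hP _ _ (hfo c)).1]
    refine ⟨Finset.mem_univ _, ⟨fun e he => if_pos he, fun t ht h1 h2 => ?_, ?_, fun k => ?_⟩,
      (hto c hs hx hy hz).1⟩
    · exact hmatch c (f c) (fun e he => (hfo c e he).symm) t ht h1 h2 (hs.coloring t ht)
    · rw [hocongr _ _ (hfo c)]; exact hcard
    · rw [hpcongr _ _ (hfo c), hs.colorProd]
  · intro c hc
    obtain ⟨-, ho, hPc⟩ := Finset.mem_filter.1 hc
    obtain ⟨h1, hx, hy, hz⟩ := hfrom (g c) ((hP _ _ (hgo c)).1.2 hPc) (hgE c)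
    rw [Finset.mem_filter, RigidArrow.mem_states]
    refine ⟨⟨(h.isColoring_iff _).2 ⟨h1, fun t ht ha hb hd => ?_⟩, ?_, fun k => ?_⟩, hx, hy, hz⟩
    · obtain ⟨⟨h2, h3⟩, -⟩ := h.outside ht ha hb hd
      exact hmatch c (g c) (fun e he => (hgo c e he).symm) t ht h2 h3 (ho.rule t ht h2 h3)
    · rw [hjumps _ hx hy hz, Finset.card_insert_of_notMem (hxo _),
        Finset.card_insert_of_notMem (hyo _), hocongr _ _ (hgo c)]
      exact ho.card_jumps
    · rw [hpcongr _ _ (hgo c), ho.colorProd]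
  · intro c hc
    rw [Finset.mem_filter, RigidArrow.mem_states] at hc
    funext e
    by_cases he : e ∈ E
    · have h1 := (hto c hc.1 hc.2.1 hc.2.2.1 hc.2.2.2).2 e he
      simp only [hg, if_pos he]
      rw [(hP _ _ (hfo c)).2, ← h1]
    · rw [hgo _ e he, hfo c e he]
  · intro c hc
    obtain ⟨-, ho, -⟩ := Finset.mem_filter.1 hc
    funext e
    by_cases he : e ∈ E
    · rw [ho.zero e he]; exact if_pos he
    · rw [hfo _ e he, hgo c e he]
  · intro c hc
    obtain ⟨-, hx, hy, hz⟩ := Finset.mem_filter.1 hc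
    rw [RigidGauss.weight, hjumps c hx hy hz, Finset.prod_insert (hxo c),
      Finset.prod_insert (hyo c), hocongr _ _ (hfo c), mul_assoc]

end TwoJumps

/-! ### The third Reidemeister move -/

section CyclicOrder

variable {N : ℕ}

/-- Two arrows with adjacent ends cross exactly when their other ends come in the same order along
the circle. -/
theorem cross_add_one_iff (D : Naked N) (hN : N ≠ 0) {e : Pt N} (he : D.partner e ≠ e + 1) :
    D.Cross e (e + 1) ↔ D.partner e - e < D.partner (e + 1) - e := by
  have h1 := D.partner_ne (D.dir_ne_zero hN e)
  have h2 : D.OnArc e (e + 1) := by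
    rw [← D.onArc_pred (add_one_ne hN e) he.symm, add_sub_cancel_right]
    exact D.onArc_self (D.dir_ne_zero hN e)
  have h3 : D.partner e - e ≠ D.partner (e + 1) - e := fun h =>
    add_one_ne hN e (D.partner_injective (sub_left_injective h)).symm
  rw [Naked.Cross, iff_true_left h2, Naked.OnArc, not_lt]
  exact ⟨fun h => lt_of_le_of_ne h.2.2 h3, fun h => ⟨add_one_ne hN e, he.symm, h.le⟩⟩

/-- The small edges are disjoint, so the order in which they are met from `p` does not depend on
which of their ends is considered. -/
theorem sub_lt_sub_iff_of_pairs {p q r x y : Pt N} (hqp : q + 1 ≠ p) (hrp : r + 1 ≠ p)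
    (hqr : q ≠ r) (hqr' : q + 1 ≠ r) (hrq : r + 1 ≠ q) (hx : x = q ∨ x = q + 1)
    (hy : y = r ∨ y = r + 1) : x - p < y - p ↔ q - p < r - p := by
  have key : ∀ z : Pt N, z + 1 ≠ p → (z + 1 - p).val = (z - p).val + 1 := by
    intro z hz
    have h1 := fin_val_pred (z + 1 - p)
    rw [if_neg (sub_ne_zero.2 hz), sub_right_comm, add_sub_cancel_right] at h1
    have h2 : (z + 1 - p).val ≠ 0 := fun h => sub_ne_zero.2 hz (Fin.ext h)
    omega
  have hne : ∀ z w : Pt N, z ≠ w → (z - p).val ≠ (w - p).val := fun z w h h' =>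
    h (sub_left_injective (Fin.ext h'))
  have k1 := key q hqp
  have k2 := key r hrp
  have n1 := hne _ _ hqr
  have n2 := hne _ _ hqr'
  have n3 := hne _ _ hrq
  rw [Fin.lt_def, Fin.lt_def]
  rcases hx with rfl | rfl <;> rcases hy with rfl | rfl <;> omega

theorem cyclic_rotate {M : ℕ} {p q r : Fin M} (hpq : p ≠ q) (hpr : p ≠ r) (hqr : q ≠ r) :
    q - p < r - p ↔ r - q < p - q := by
  have h1 : p.val ≠ q.val := fun h => hpq (Fin.ext h)
  have h2 : p.val ≠ r.val := fun h => hpr (Fin.ext h)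
  have h3 : q.val ≠ r.val := fun h => hqr (Fin.ext h)
  have b1 := p.isLt
  have b2 := q.isLt
  have b3 := r.isLt
  simp only [Fin.lt_def, fin_val_sub]
  split_ifs <;> omega

theorem lt_swap {M : ℕ} {p q r : Fin M} [NeZero M] (hqr : q ≠ r) :
    r - p < q - p ↔ ¬ q - p < r - p := by
  have : q - p ≠ r - p := fun h => hqr (sub_left_injective h)
  rw [not_lt]
  exact ⟨le_of_lt, fun h => lt_of_le_of_ne h this.symm⟩

variable {D : Naked N} {p q r a b d : Pt N}

/-- Whether the arrows at a small edge cross depends only on which of them comes first there and on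
the cyclic order of the three edges. The same holds at `q` and `r`, after rotating the cyclic order.
-/
theorem Triangle.cross_p (h : Triangle D p q r a b d) :
    D.Cross p (p + 1) ↔ ¬ (b = p ↔ q - p < r - p) := by
  obtain ⟨s1, s2, s3, s4, s5, s6⟩ := h.separate
  have hN := h.size_ne_zero
  have hq : D.partner a = q ∨ D.partner a = q + 1 := h.mid.imp And.left And.right
  have hr : D.partner b = r ∨ D.partner b = r + 1 := h.bot.symm.imp And.left And.right
  rcases h.top with ⟨h1, h2⟩ | ⟨h1, h2⟩
  · rw [cross_add_one_iff D hN, ← h2, ← h1,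
      sub_lt_sub_iff_of_pairs (h1 ▸ s5) (h1 ▸ s3) h.q_ne_r.symm s6 s4 hr hq, lt_swap h.q_ne_r]
    · simp
    · rw [← h2, ← h1]
      exact head_ne_tail h.dir_b h.dir_a
  · have hb : b ≠ p := by rw [h2]; exact add_one_ne hN p
    rw [cross_add_one_iff D hN, ← h2, ← h1,
      sub_lt_sub_iff_of_pairs (h1 ▸ s3) (h1 ▸ s5) h.q_ne_r s4 s6 hq hr]
    · rw [← h1] at hb
      simp [hb]
    · rw [← h2, ← h1]
      exact head_ne_tail h.dir_a h.dir_b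

theorem Triangle.cross_q (h : Triangle D p q r a b d) :
    D.Cross q (q + 1) ↔ ¬ (D.partner a = q ↔ q - p < r - p) := by
  obtain ⟨s1, s2, s3, s4, s5, s6⟩ := h.separate
  have hN := h.size_ne_zero
  have hp : a = p ∨ a = p + 1 := h.top.symm.imp And.left And.right
  have hr : D.partner d = r ∨ D.partner d = r + 1 := h.bot.imp And.left And.right
  rw [cyclic_rotate h.p_ne_q h.p_ne_r h.q_ne_r]
  rcases h.mid with ⟨h1, h2⟩ | ⟨h1, h2⟩
  · have h3 : D.partner q = a := by rw [← h1, D.partner_partner]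
    rw [cross_add_one_iff D hN, h3, ← h2,
      sub_lt_sub_iff_of_pairs s1 s6 h.p_ne_r s2 s5 hp hr, lt_swap h.p_ne_r.symm]
    · simp [h1]
    · rw [h3, ← h2]
      exact h.a_ne_d
  · have h3 : D.partner (q + 1) = a := by rw [← h2, D.partner_partner]
    have hq : D.partner a ≠ q := by rw [h2]; exact add_one_ne hN q
    rw [cross_add_one_iff D hN, h3, ← h1,
      sub_lt_sub_iff_of_pairs (h1 ▸ s6) (h1 ▸ s1) h.p_ne_r.symm s5 s2 hr hp]
    · rw [← h1] at hq
      simp [hq]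
    · rw [← h2, ← h1]
      exact fun h' => h.a_ne_d (D.partner_injective h').symm

theorem Triangle.cross_r (h : Triangle D p q r a b d) :
    D.Cross r (r + 1) ↔ ¬ (D.partner d = r ↔ q - p < r - p) := by
  obtain ⟨s1, s2, s3, s4, s5, s6⟩ := h.separate
  have hN := h.size_ne_zero
  have hp : b = p ∨ b = p + 1 := h.top.imp And.left And.right
  have hq : d = q ∨ d = q + 1 := h.mid.symm.imp And.left And.right
  rw [cyclic_rotate h.p_ne_q h.p_ne_r h.q_ne_r,
    cyclic_rotate h.q_ne_r h.p_ne_q.symm h.p_ne_r.symm]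
  rcases h.bot with ⟨h1, h2⟩ | ⟨h1, h2⟩
  · have h3 : D.partner r = d := by rw [← h1, D.partner_partner]
    have h4 : D.partner (r + 1) = b := by rw [← h2, D.partner_partner]
    rw [cross_add_one_iff D hN, h3, h4,
      sub_lt_sub_iff_of_pairs s4 s2 h.p_ne_q.symm s3 s1 hq hp, lt_swap h.p_ne_q]
    · simp [h1]
    · rw [h3, ← h2]
      exact (head_ne_tail h.dir_b h.dir_d).symm
  · have h3 : D.partner r = b := by rw [← h1, D.partner_partner]
    have h4 : D.partner (r + 1) = d := by rw [← h2, D.partner_partner]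
    have hr : D.partner d ≠ r := by rw [h2]; exact add_one_ne hN r
    rw [cross_add_one_iff D hN, h3, h4,
      sub_lt_sub_iff_of_pairs s2 s4 h.p_ne_q s1 s3 hp hq]
    · simp [hr]
    · rw [h3, ← h2]
      exact (head_ne_tail h.dir_d h.dir_b).symm

end CyclicOrder

/-! ### Outer configurations of the states with two jumps -/

section R3

variable {π : Type u} [Group π] {N n : ℕ}

/-- Three regions meet at the edges `p`, `q`, `r`, in positive cyclic order, and the region between
`q` and `r` has the middle color. -/
def PosLow (p q r : Pt N) (c : Pt N → Fin (n + 1)) : Prop :=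
  c (p - 1) = c (r + 1) ∧ c (p + 1) = c (q - 1) ∧ c (q + 1) = c (r - 1) ∧
    c (p - 1) < c (q + 1) ∧ c (q + 1) < c (p + 1)

/-- Three regions meet at the edges `p`, `q`, `r`, in positive cyclic order, and the region between
`p` and `q` has the middle color. -/
def PosHigh (p q r : Pt N) (c : Pt N → Fin (n + 1)) : Prop :=
  c (p - 1) = c (r + 1) ∧ c (p + 1) = c (q - 1) ∧ c (q + 1) = c (r - 1) ∧
    c (p - 1) < c (p + 1) ∧ c (p + 1) < c (q + 1)

/-- Three regions meet at the edges `p`, `q`, `r`, in negative cyclic order, and the region between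
`r` and `q` has the middle color. -/
def NegLow (p q r : Pt N) (c : Pt N → Fin (n + 1)) : Prop :=
  c (p + 1) = c (r - 1) ∧ c (r + 1) = c (q - 1) ∧ c (q + 1) = c (p - 1) ∧
    c (p - 1) < c (q - 1) ∧ c (q - 1) < c (p + 1)

/-- Three regions meet at the edges `p`, `q`, `r`, in negative cyclic order, and the region between
`q` and `p` has the middle color. -/
def NegHigh (p q r : Pt N) (c : Pt N → Fin (n + 1)) : Prop :=
  c (p + 1) = c (r - 1) ∧ c (r + 1) = c (q - 1) ∧ c (q + 1) = c (p - 1) ∧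
    c (q - 1) < c (p - 1) ∧ c (p - 1) < c (p + 1)

/-- Colors on three edges. -/
def edgeColors {K : Type*} (p q : Pt N) (x y z : K) (e : Pt N) : K :=
  if e = p then x else if e = q then y else z

theorem eq_edgeColors_iff {K : Type*} {p q r : Pt N} (hpq : p ≠ q) (hpr : p ≠ r) (hqr : q ≠ r)
    (c : Pt N → K) (x y z : K) :
    (∀ e ∈ ({p, q, r} : Finset (Pt N)), c e = edgeColors p q x y z e) ↔
      c p = x ∧ c q = y ∧ c r = z := by
  simp [edgeColors, hpq.symm, hpr.symm, hqr.symm]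

variable {Γ : Fin (n + 1) → ConjClasses π} {p q r a b d : Pt N}

theorem Triangle.congr_near {D : Naked N} (h : Triangle D p q r a b d)
    {c c' : Pt N → Fin (n + 1)} (hcc : ∀ e ∉ ({p, q, r} : Finset (Pt N)), c e = c' e) :
    c (p - 1) = c' (p - 1) ∧ c (p + 1) = c' (p + 1) ∧ c (q - 1) = c' (q - 1) ∧
    c (q + 1) = c' (q + 1) ∧ c (r - 1) = c' (r - 1) ∧ c (r + 1) = c' (r + 1) := by
  have np := h.notMem (e := p) (by simp)
  have nq := h.notMem (e := q) (by simp)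
  have nr := h.notMem (e := r) (by simp)
  exact ⟨hcc _ np.1, hcc _ np.2, hcc _ nq.1, hcc _ nq.2, hcc _ nr.1, hcc _ nr.2⟩

theorem Triangle.sum_ab {G : RigidGauss π N} (h : Triangle G.toNaked p q r a b d)
    (hm : ∀ e ∈ ({p, q, r} : Finset (Pt N)), G.mark.at e = 1) :
    ∑ c ∈ (G.states Γ).filter (fun c => c (a - 1) ≠ c a ∧ c (b - 1) ≠ c b ∧ c (d - 1) = c d),
      G.weight c = G.writhe a * G.writhe b *
        (if b = p then G.outerSum {p, q, r} Γ (PosLow p q r)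
          else G.outerSum {p, q, r} Γ (NegLow p q r)) := by
  have key := h.sum_two_jumps (Γ := Γ) hm (x := a) (y := b) (z := d) (fun t => Iff.rfl) h.a_ne_b
    (P := fun c => if b = p then PosLow p q r c else NegLow p q r c)
    (u := fun c => edgeColors p q (if b = p then c (r - 1) else c (q - 1))
      (if G.partner a = q then c (q + 1) else c (q - 1))
      (if G.partner d = r then c (r - 1) else c (r + 1))) ?_ ?_ ?_
  · rw [key]
    split_ifs <;> rfl
  · intro c c' hcc
    obtain ⟨h1, h2, h3, h4, h5, h6⟩ := h.congr_near hcc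
    simp only [PosLow, NegLow, h1, h2, h3, h4, h5, h6, and_self]
  · intro c hc h1 h2 h3
    rw [(h.colors_a c).1, (h.colors_a c).2] at h1
    rw [(h.colors_b c).1, (h.colors_b c).2] at h2
    rw [(h.colors_d c).1, (h.colors_d c).2] at h3
    rw [eq_edgeColors_iff h.p_ne_q h.p_ne_r h.q_ne_r]
    exact localRules_ab.1 ⟨((h.isColoring_iff c).1 hc.coloring).1, h1, h2, h3⟩
  · intro c hP hu
    rw [eq_edgeColors_iff h.p_ne_q h.p_ne_r h.q_ne_r] at hu
    rw [(h.colors_a c).1, (h.colors_a c).2, (h.colors_b c).1, (h.colors_b c).2,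
      (h.colors_d c).1, (h.colors_d c).2]
    exact localRules_ab.2 ⟨hP, hu⟩

theorem Triangle.sum_bd {G : RigidGauss π N} (h : Triangle G.toNaked p q r a b d)
    (hm : ∀ e ∈ ({p, q, r} : Finset (Pt N)), G.mark.at e = 1) :
    ∑ c ∈ (G.states Γ).filter (fun c => c (b - 1) ≠ c b ∧ c (d - 1) ≠ c d ∧ c (a - 1) = c a),
      G.weight c = G.writhe b * G.writhe d *
        (if G.partner d = r then G.outerSum {p, q, r} Γ (PosHigh p q r)
          else G.outerSum {p, q, r} Γ (NegHigh p q r)) := by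
  have key := h.sum_two_jumps (Γ := Γ) hm (x := b) (y := d) (z := a) (fun t => by tauto) h.b_ne_d
    (P := fun c => if G.partner d = r then PosHigh p q r c else NegHigh p q r c)
    (u := fun c => edgeColors p q (if b = p then c (p + 1) else c (p - 1))
      (if G.partner a = q then c (q - 1) else c (q + 1))
      (if G.partner d = r then c (q - 1) else c (p - 1))) ?_ ?_ ?_
  · rw [key]
    split_ifs <;> rfl
  · intro c c' hcc
    obtain ⟨h1, h2, h3, h4, h5, h6⟩ := h.congr_near hcc
    simp only [PosHigh, NegHigh, h1, h2, h3, h4, h5, h6, and_self]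
  · intro c hc h1 h2 h3
    rw [(h.colors_a c).1, (h.colors_a c).2] at h3
    rw [(h.colors_b c).1, (h.colors_b c).2] at h1
    rw [(h.colors_d c).1, (h.colors_d c).2] at h2
    rw [eq_edgeColors_iff h.p_ne_q h.p_ne_r h.q_ne_r]
    exact localRules_bd.1 ⟨((h.isColoring_iff c).1 hc.coloring).1, h1, h2, h3⟩
  · intro c hP hu
    rw [eq_edgeColors_iff h.p_ne_q h.p_ne_r h.q_ne_r] at hu
    rw [(h.colors_a c).1, (h.colors_a c).2, (h.colors_b c).1, (h.colors_b c).2,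
      (h.colors_d c).1, (h.colors_d c).2]
    exact localRules_bd.2 ⟨hP, hu⟩

/-- The jumps `a` and `d` share an extreme color, so both positions of the middle color occur.
Equality of the other two colors would make a double edge, which `jump_injective` rules out. -/
theorem Triangle.sum_ad (hΓ : ∀ i, Γ i ≠ ConjClasses.mk 1) {G : RigidGauss π N}
    (h : Triangle G.toNaked p q r a b d)
    (hm : ∀ e ∈ ({p, q, r} : Finset (Pt N)), G.mark.at e = 1) :
    ∑ c ∈ (G.states Γ).filter (fun c => c (a - 1) ≠ c a ∧ c (d - 1) ≠ c d ∧ c (b - 1) = c b),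
      G.weight c = G.writhe a * G.writhe d *
        (if G.partner a = q
          then G.outerSum {p, q, r} Γ (PosLow p q r) + G.outerSum {p, q, r} Γ (PosHigh p q r)
          else G.outerSum {p, q, r} Γ (NegLow p q r) + G.outerSum {p, q, r} Γ (NegHigh p q r)) := by
  have key := h.sum_two_jumps (Γ := Γ) hm (x := a) (y := d) (z := b) (fun t => by tauto) h.a_ne_d
    (P := fun c => if G.partner a = q
      then c (p - 1) = c (r + 1) ∧ c (p + 1) = c (q - 1) ∧ c (q + 1) = c (r - 1) ∧
        c (p - 1) < c (q + 1) ∧ c (p - 1) < c (p + 1) ∧ c (q + 1) ≠ c (p + 1)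
      else c (p + 1) = c (r - 1) ∧ c (r + 1) = c (q - 1) ∧ c (q + 1) = c (p - 1) ∧
        c (p - 1) < c (p + 1) ∧ c (q - 1) < c (p + 1) ∧ c (p - 1) ≠ c (q - 1))
    (u := fun c => edgeColors p q (if b = p then c (p - 1) else c (p + 1))
      (if G.partner a = q then c (p - 1) else c (p + 1))
      (if G.partner d = r then c (r + 1) else c (r - 1))) ?_ ?_ ?_
  · rw [key]
    congr 1
    split_ifs
    · refine outerSum_or _ _ _ _ _ _ (fun c => ?_) fun c hc hc' => ?_
      · simp only [PosLow, PosHigh]; grind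
      · exact lt_asymm hc.2.2.2.2 hc'.2.2.2.2
    · refine outerSum_or _ _ _ _ _ _ (fun c => ?_) fun c hc hc' => ?_
      · simp only [NegLow, NegHigh]; grind
      · exact lt_asymm hc.2.2.2.1 hc'.2.2.2.1
  · intro c c' hcc
    obtain ⟨h1, h2, h3, h4, h5, h6⟩ := h.congr_near hcc
    simp only [h1, h2, h3, h4, h5, h6, and_self]
  · intro c hc h1 h2 h3
    have hinj : ¬ (c (a - 1) = c (d - 1) ∧ c a = c d) := fun h4 =>
      h.a_ne_d (hc.coloring.jump_injective (Marking.surjective_of_colorProd hΓ hc.colorProd)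
        hc.card_jumps (Naked.mem_jumps.2 ⟨h.dir_a, h1⟩) (Naked.mem_jumps.2 ⟨h.dir_d, h2⟩) h4.1 h4.2)
    rw [(h.colors_a c).1, (h.colors_a c).2] at h1 hinj
    rw [(h.colors_b c).1, (h.colors_b c).2] at h3
    rw [(h.colors_d c).1, (h.colors_d c).2] at h2 hinj
    rw [eq_edgeColors_iff h.p_ne_q h.p_ne_r h.q_ne_r]
    exact localRules_ad.1 ⟨((h.isColoring_iff c).1 hc.coloring).1, h1, h2, h3, hinj⟩
  · intro c hP hu
    rw [eq_edgeColors_iff h.p_ne_q h.p_ne_r h.q_ne_r] at hu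
    rw [(h.colors_a c).1, (h.colors_a c).2, (h.colors_b c).1, (h.colors_b c).2,
      (h.colors_d c).1, (h.colors_d c).2]
    have := localRules_ad.2 ⟨hP, hu⟩
    exact ⟨this.1, this.2.1, this.2.2.1, this.2.2.2.1⟩

end R3

/-! ### Comparison of the state sums before and after the third move -/

section R3

variable {π : Type u} [Group π] {N n : ℕ} {Γ : Fin (n + 1) → ConjClasses π}
  {G : RigidGauss π N} {p q r a b d : Pt N}

/-- A coloring is tame at a triangle if and only if at most one of the three arrows is a jump. -/
theorem Triangle.isTame_iff {D : Naked N} (h : Triangle D p q r a b d) {c : Pt N → Fin (n + 1)}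
    (hc : D.IsColoring c) : IsTame {p, q, r} c ↔
      (c (a - 1) = c a ∨ c (b - 1) = c b) ∧ (c (a - 1) = c a ∨ c (d - 1) = c d) ∧
        (c (b - 1) = c b ∨ c (d - 1) = c d) := by
  have hp : (c (p - 1) = c p ∨ c p = c (p + 1)) ↔ (c (a - 1) = c a ∨ c (b - 1) = c b) := by
    rcases h.top with ⟨h1, h2⟩ | ⟨h1, h2⟩ <;> rw [h1, h2, add_sub_cancel_right]
    exact or_comm
  have hq : (c (q - 1) = c q ∨ c q = c (q + 1)) ↔ (c (a - 1) = c a ∨ c (d - 1) = c d) := by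
    rw [jump_iff hc a]
    rcases h.mid with ⟨h1, h2⟩ | ⟨h1, h2⟩ <;> rw [h1, h2, add_sub_cancel_right]
    exact or_comm
  have hr : (c (r - 1) = c r ∨ c r = c (r + 1)) ↔ (c (b - 1) = c b ∨ c (d - 1) = c d) := by
    rw [jump_iff hc b, jump_iff hc d]
    rcases h.bot with ⟨h1, h2⟩ | ⟨h1, h2⟩ <;> rw [h1, h2, add_sub_cancel_right]
    exact or_comm
  rw [← hp, ← hq, ← hr]
  simp [IsTame]

open Classical in
/-- The tame states, and the states with two jumps at a triangle. -/
theorem Triangle.stateSum_eq (hΓ : ∀ i, Γ i ≠ ConjClasses.mk 1) (h : Triangle G.toNaked p q r a b d)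
    (hm : ∀ e ∈ ({p, q, r} : Finset (Pt N)), G.mark.at e = 1) :
    G.stateSum Γ = ∑ c ∈ (G.states Γ).filter (fun c => IsTame {p, q, r} c), G.weight c +
      G.writhe a * G.writhe b *
        (if b = p then G.outerSum {p, q, r} Γ (PosLow p q r)
          else G.outerSum {p, q, r} Γ (NegLow p q r)) +
      G.writhe a * G.writhe d *
        (if G.partner a = q
          then G.outerSum {p, q, r} Γ (PosLow p q r) + G.outerSum {p, q, r} Γ (PosHigh p q r)
          else G.outerSum {p, q, r} Γ (NegLow p q r) + G.outerSum {p, q, r} Γ (NegHigh p q r)) +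
      G.writhe b * G.writhe d *
        (if G.partner d = r then G.outerSum {p, q, r} Γ (PosHigh p q r)
          else G.outerSum {p, q, r} Γ (NegHigh p q r)) := by
  rw [← h.sum_ab hm, ← h.sum_ad hΓ hm, ← h.sum_bd hm, RigidGauss.stateSum]
  simp only [Finset.sum_filter]
  rw [← Finset.sum_add_distrib, ← Finset.sum_add_distrib, ← Finset.sum_add_distrib]
  refine Finset.sum_congr rfl fun c hc => ?_
  rw [RigidArrow.mem_states] at hc
  have h3 : ¬ (c (a - 1) ≠ c a ∧ c (b - 1) ≠ c b ∧ c (d - 1) ≠ c d) := fun h3 =>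
    h.not_three_jumps hΓ hm hc (Naked.mem_jumps.2 ⟨h.dir_a, h3.1⟩)
      (Naked.mem_jumps.2 ⟨h.dir_b, h3.2.1⟩) (Naked.mem_jumps.2 ⟨h.dir_d, h3.2.2⟩)
  rw [h.isTame_iff hc.coloring]
  by_cases hA : c (a - 1) = c a <;> by_cases hB : c (b - 1) = c b <;>
    by_cases hD : c (d - 1) = c d <;> simp_all

theorem writhe_cast_ne_zero (hN : N ≠ 0) (i : Pt N) : (G.writhe i : ℚ) ≠ 0 := by
  have h : G.writhe i ≠ 0 := fun h => hN ((G.writhe_eq_zero i).1 h)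
  revert h
  cases G.writhe i <;> simp

/-- If the arrows at `p` intersect, they are not both jumps. -/
theorem Triangle.outerSum_low (hΓ : ∀ i, Γ i ≠ ConjClasses.mk 1)
    (h : Triangle G.toNaked p q r a b d)
    (hm : ∀ e ∈ ({p, q, r} : Finset (Pt N)), G.mark.at e = 1) (hx : ¬ (b = p ↔ q - p < r - p)) :
    (if b = p then G.outerSum {p, q, r} Γ (PosLow p q r)
      else G.outerSum {p, q, r} Γ (NegLow p q r)) = 0 := by
  have key := h.sum_ab (Γ := Γ) hm
  rw [Finset.sum_eq_zero] at key
  · exact (mul_eq_zero.1 key.symm).resolve_left (mul_ne_zero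
      (writhe_cast_ne_zero h.size_ne_zero a) (writhe_cast_ne_zero h.size_ne_zero b))
  · intro c hc
    rw [Finset.mem_filter, RigidArrow.mem_states] at hc
    obtain ⟨hs, ha, hb, -⟩ := hc
    refine absurd (h.cross_p.2 hx) (hs.coloring.not_cross
      (Marking.surjective_of_colorProd hΓ hs.colorProd) hs.card_jumps ?_ ?_)
    · rcases h.top with ⟨h1, -⟩ | ⟨h1, -⟩ <;> rw [← h1] <;> assumption
    · rcases h.top with ⟨-, h1⟩ | ⟨-, h1⟩ <;> rw [← h1] <;> assumption

/-- If the arrows at `r` intersect, they are not both jumps. -/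
theorem Triangle.outerSum_high (hΓ : ∀ i, Γ i ≠ ConjClasses.mk 1)
    (h : Triangle G.toNaked p q r a b d)
    (hm : ∀ e ∈ ({p, q, r} : Finset (Pt N)), G.mark.at e = 1)
    (hx : ¬ (G.partner d = r ↔ q - p < r - p)) :
    (if G.partner d = r then G.outerSum {p, q, r} Γ (PosHigh p q r)
      else G.outerSum {p, q, r} Γ (NegHigh p q r)) = 0 := by
  have key := h.sum_bd (Γ := Γ) hm
  rw [Finset.sum_eq_zero] at key
  · exact (mul_eq_zero.1 key.symm).resolve_left (mul_ne_zero
      (writhe_cast_ne_zero h.size_ne_zero b) (writhe_cast_ne_zero h.size_ne_zero d))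
  · intro c hc
    rw [Finset.mem_filter, RigidArrow.mem_states] at hc
    obtain ⟨hs, hb, hd, -⟩ := hc
    rw [Ne, jump_iff hs.coloring] at hb hd
    refine absurd (h.cross_r.2 hx) (hs.coloring.not_cross
      (Marking.surjective_of_colorProd hΓ hs.colorProd) hs.card_jumps ?_ ?_)
    · rcases h.bot with ⟨h1, -⟩ | ⟨h1, -⟩ <;> rw [← h1] <;> assumption
    · rcases h.bot with ⟨-, h1⟩ | ⟨-, h1⟩ <;> rw [← h1] <;> assumption

/-! #### The moved triangle -/

section Permute

variable {σ : Equiv.Perm (Pt N)}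

theorem permute_partner (G : RigidGauss π N) (σ : Equiv.Perm (Pt N)) (i : Pt N) :
    (G.permute σ).partner (σ i) = σ (G.partner i) := by
  simp [RigidGauss.permute]

theorem permute_dir (G : RigidGauss π N) (σ : Equiv.Perm (Pt N)) (i : Pt N) :
    (G.permute σ).dir (σ i) = G.dir i := by
  simp [RigidGauss.permute]

theorem permute_writhe (G : RigidGauss π N) (σ : Equiv.Perm (Pt N)) (i : Pt N) :
    (G.permute σ).writhe (σ i) = G.writhe i := by
  simp [RigidGauss.permute]

theorem Triangle.permute (h : Triangle G.toNaked p q r a b d)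
    (hσ : ∀ i, σ i = swapPoint {p, q, r} i) :
    Triangle (G.permute σ).toNaked p q r (σ a) (σ b) (σ d) := by
  have s : ∀ e, (e = p ∨ e = q ∨ e = r) → σ e = e + 1 ∧ σ (e + 1) = e := fun e he => by
    have : e ∈ ({p, q, r} : Finset (Pt N)) := by simpa using he
    rw [hσ, hσ, swapPoint_of_mem this, swapPoint_add_one h.sparse this]
    exact ⟨rfl, rfl⟩
  have sp := s p (by simp)
  have sq := s q (by simp)
  have sr := s r (by simp)
  refine ⟨?_, ?_, ?_, h.sparse, h.p_ne_q, h.p_ne_r, h.q_ne_r, ?_, ?_, ?_⟩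
  · rw [permute_dir, h.dir_a]
  · rw [permute_dir, h.dir_b]
  · rw [permute_dir, h.dir_d]
  · rcases h.top with ⟨h1, h2⟩ | ⟨h1, h2⟩ <;> simp only [h1, h2, sp]
    · exact Or.inr ⟨trivial, trivial⟩
    · exact Or.inl ⟨trivial, trivial⟩
  · rw [permute_partner]
    rcases h.mid with ⟨h1, h2⟩ | ⟨h1, h2⟩ <;> simp only [h1, h2, sq]
    · exact Or.inr ⟨trivial, trivial⟩
    · exact Or.inl ⟨trivial, trivial⟩
  · rw [permute_partner, permute_partner]
    rcases h.bot with ⟨h1, h2⟩ | ⟨h1, h2⟩ <;> simp only [h1, h2, sr]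
    · exact Or.inr ⟨trivial, trivial⟩
    · exact Or.inl ⟨trivial, trivial⟩

theorem swapPoint_eq_iff {D : Naked N} (h : Triangle D p q r a b d)
    (hσ : ∀ i, σ i = swapPoint {p, q, r} i) {x e : Pt N} (he : e = p ∨ e = q ∨ e = r)
    (hx : x = e ∨ x = e + 1) : σ x = e ↔ ¬ x = e := by
  have he' : e ∈ ({p, q, r} : Finset (Pt N)) := by simpa using he
  have hne := add_one_ne h.size_ne_zero e
  rcases hx with rfl | rfl
  · rw [hσ, swapPoint_of_mem he']
    simp [hne]
  · rw [hσ, swapPoint_add_one h.sparse he']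
    simp [hne]

open Classical in
theorem Triangle.sum_tame_permute (h : Triangle G.toNaked p q r a b d)
    (hm : ∀ e ∈ ({p, q, r} : Finset (Pt N)), G.mark.at e = 1)
    (hσ : ∀ i, σ i = swapPoint {p, q, r} i) :
    ∑ c ∈ ((G.permute σ).states Γ).filter (fun c => IsTame {p, q, r} c), (G.permute σ).weight c =
      ∑ c ∈ (G.states Γ).filter (fun c => IsTame {p, q, r} c), G.weight c := by
  have hp : ∀ i, (G.permute σ).partner (swapPoint {p, q, r} i) =
      swapPoint {p, q, r} (G.partner i) := fun i => by rw [← hσ, ← hσ, permute_partner]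
  have hd : ∀ i, (G.permute σ).dir (swapPoint {p, q, r} i) = G.dir i := fun i => by
    rw [← hσ, permute_dir]
  have hs := swapPoint_swapPoint h.sparse
  have hp' : ∀ i, G.partner (swapPoint {p, q, r} i) =
      swapPoint {p, q, r} ((G.permute σ).partner i) := fun i => by
    conv_rhs => rw [← hs i, hp, hs]
  have hd' : ∀ i, G.dir (swapPoint {p, q, r} i) = (G.permute σ).dir i := fun i => by
    conv_rhs => rw [← hs i, hd]
  symm
  refine Finset.sum_bij' (fun (c : Pt N → Fin (n + 1)) _ => flipColor {p, q, r} c)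
    (fun (c : Pt N → Fin (n + 1)) _ => flipColor {p, q, r} c) ?_ ?_ ?_ ?_ ?_
  · intro c hc
    rw [Finset.mem_filter, RigidArrow.mem_states] at hc ⊢
    exact ⟨hc.1.flipColor h.size_ne_zero h.sparse hc.2 hp hd rfl hm, isTame_flipColor h.sparse⟩
  · intro c hc
    rw [Finset.mem_filter, RigidArrow.mem_states] at hc ⊢
    exact ⟨hc.1.flipColor h.size_ne_zero h.sparse hc.2 hp' hd' rfl hm, isTame_flipColor h.sparse⟩
  · intro c hc
    exact flipColor_flipColor h.sparse (Finset.mem_filter.1 hc).2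
  · intro c hc
    exact flipColor_flipColor h.sparse (Finset.mem_filter.1 hc).2
  · intro c hc
    rw [weight_flipColor h.sparse (Finset.mem_filter.1 hc).2 hd]
    refine Finset.prod_congr rfl fun t _ => ?_
    rw [← hσ, permute_writhe]

theorem Triangle.outerSum_permute (h : Triangle G.toNaked p q r a b d)
    (hσ : ∀ i, σ i = swapPoint {p, q, r} i) (P : (Pt N → Fin (n + 1)) → Prop) :
    (G.permute σ).outerSum {p, q, r} Γ P = G.outerSum {p, q, r} Γ P := by
  refine outerSum_congr (G := G) (G' := G.permute σ) rfl (fun t h1 h2 => ?_) Γ P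
  have ht : σ t = t := by rw [hσ, swapPoint_of_notMem h1 h2]
  have h3 := permute_partner G σ t
  have h4 := permute_dir G σ t
  have h5 := permute_writhe G σ t
  rw [ht] at h3 h4 h5
  have hne : ∀ x, (x = a ∨ x = b ∨ x = d) → t ≠ x := by
    rintro x hx rfl
    exact (h.tail_mem hx).elim h1 h2
  refine ⟨fun hd => ?_, h4, h5⟩
  obtain ⟨-, h6, h7⟩ := h.outside hd (hne a (by simp)) (hne b (by simp)) (hne d (by simp))
  rw [h3, hσ, swapPoint_of_notMem h6 h7]

end Permute

/-! #### The signs -/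

/-- The number of arrowheads is `0`, `1`, `2` at `p`, `q`, `r`, so only `q` gets an extra minus
sign; the remaining factor records whether the arrows cross. -/
theorem Triangle.sign_p (h : Triangle G.toNaked p q r a b d) :
    ((G.edgeWrithe p * G.eps p : ℤ) : ℚ) =
      G.writhe a * G.writhe b * (if b = p ↔ q - p < r - p then -1 else 1) := by
  have hd : G.dir p = 1 ∧ G.dir (p + 1) = 1 ∧
      ((G.writhe p : ℤ) * G.writhe (p + 1) : ℤ) = G.writhe a * G.writhe b := by
    rcases h.top with ⟨h1, h2⟩ | ⟨h1, h2⟩ <;> rw [← h2, ← h1] <;>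
      simp only [h.dir_a, h.dir_b, true_and]
    exact mul_comm _ _
  rw [RigidGauss.edgeWrithe, Naked.eps, Naked.heads, hd.1, hd.2.1, hd.2.2]
  simp only [h.cross_p, ite_not]
  split_ifs <;> simp_all

theorem Triangle.sign_q (h : Triangle G.toNaked p q r a b d) :
    ((G.edgeWrithe q * G.eps q : ℤ) : ℚ) =
      -(G.writhe a * G.writhe d * (if G.partner a = q ↔ q - p < r - p then -1 else 1)) := by
  have ha : G.dir (G.partner a) = -1 := by rw [G.dir_partner, h.dir_a]
  have hd : G.heads q = 1 ∧
      ((G.writhe q : ℤ) * G.writhe (q + 1) : ℤ) = G.writhe a * G.writhe d := by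
    rw [Naked.heads]
    rcases h.mid with ⟨h1, h2⟩ | ⟨h1, h2⟩ <;> rw [← h2, ← h1] <;>
      simp only [h.dir_d, ha, G.writhe_partner]
    · exact ⟨rfl, trivial⟩
    · exact ⟨rfl, mul_comm _ _⟩
  rw [RigidGauss.edgeWrithe, Naked.eps, hd.1, hd.2]
  simp only [h.cross_q, ite_not]
  split_ifs <;> simp_all

theorem Triangle.sign_r (h : Triangle G.toNaked p q r a b d) :
    ((G.edgeWrithe r * G.eps r : ℤ) : ℚ) =
      G.writhe b * G.writhe d * (if G.partner d = r ↔ q - p < r - p then -1 else 1) := by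
  have hb : G.dir (G.partner b) = -1 := by rw [G.dir_partner, h.dir_b]
  have hdd : G.dir (G.partner d) = -1 := by rw [G.dir_partner, h.dir_d]
  have hd : G.heads r = 2 ∧
      ((G.writhe r : ℤ) * G.writhe (r + 1) : ℤ) = G.writhe b * G.writhe d := by
    rw [Naked.heads]
    rcases h.bot with ⟨h1, h2⟩ | ⟨h1, h2⟩ <;> rw [← h2, ← h1] <;>
      simp only [hb, hdd, G.writhe_partner]
    · exact ⟨rfl, mul_comm _ _⟩
    · exact ⟨rfl, trivial⟩
  rw [RigidGauss.edgeWrithe, Naked.eps, hd.1, hd.2]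
  simp only [h.cross_r, ite_not]
  split_ifs <;> simp_all

/-- Here `x`, `y`, `z` are the products of signs of the pairs of arrows, `s`, `t` the outer sums in
positive cyclic order, and `s'`, `t'` those in negative order; the move negates `A`, `B` and `C`.
Once the sums of the wrong order vanish, the difference of the two sides has as coefficients of the
two surviving sums exactly the quantities that the two sign conditions equate to zero. -/
theorem exchange_identity {A B C O : Prop} [Decidable A] [Decidable B] [Decidable C] [Decidable O]
    {x y z s t s' t' : ℚ}
    (hxy : x * (if A ↔ O then -1 else 1) = -(y * (if B ↔ O then -1 else 1)))
    (hyz : -(y * (if B ↔ O then -1 else 1)) = z * (if C ↔ O then -1 else 1))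
    (hO : O → s' = 0 ∧ t' = 0) (hO' : ¬ O → s = 0 ∧ t = 0) :
    x * (if ¬ A then s else s') + y * (if ¬ B then s + t else s' + t') +
        z * (if ¬ C then t else t') =
      x * (if A then s else s') + y * (if B then s + t else s' + t') + z * (if C then t else t') := by
  by_cases hOO : O
  · obtain ⟨rfl, rfl⟩ := hO hOO
    by_cases hA : A <;> by_cases hB : B <;> by_cases hC : C <;>
      simp only [hOO, hA, hB, hC, if_true, if_false, not_true, not_false_iff, iff_true,
        iff_self] at hxy hyz ⊢ <;>
      linear_combination s * hxy - t * hyz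
  · obtain ⟨rfl, rfl⟩ := hO' hOO
    by_cases hA : A <;> by_cases hB : B <;> by_cases hC : C <;>
      simp only [hOO, hA, hB, hC, if_true, if_false, not_true, not_false_iff, iff_self,
        iff_false] at hxy hyz ⊢ <;>
      linear_combination s' * hxy - t' * hyz

/-- Moving a strand across a crossing does not change the state sum. -/
theorem Triangle.stateSum_permute (hΓ : ∀ i, Γ i ≠ ConjClasses.mk 1)
    (h : Triangle G.toNaked p q r a b d)
    (hm : ∀ e ∈ ({p, q, r} : Finset (Pt N)), G.mark.at e = 1)
    (hpq : G.edgeWrithe p * G.eps p = G.edgeWrithe q * G.eps q)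
    (hqr : G.edgeWrithe q * G.eps q = G.edgeWrithe r * G.eps r) {σ : Equiv.Perm (Pt N)}
    (hσ : ∀ i, σ i = swapPoint {p, q, r} i) :
    (G.permute σ).stateSum Γ = G.stateSum Γ := by
  have h' := h.permute hσ
  have hβ := swapPoint_eq_iff h hσ (e := p) (Or.inl rfl) (h.top.imp And.left And.right)
  have hμ := swapPoint_eq_iff h hσ (e := q) (Or.inr (Or.inl rfl)) (h.mid.imp And.left And.right)
  have hδ := swapPoint_eq_iff h hσ (e := r) (Or.inr (Or.inr rfl)) (h.bot.imp And.left And.right)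
  -- The move reverses whether the arrows at `p` cross, and likewise at `r`. Each crossing version
  -- forces an outer sum to vanish; using both diagrams, the sums that disagree with the actual
  -- cyclic order of `p`, `q`, `r` are zero in all cases.
  have l1 := h.outerSum_low hΓ hm
  have l2 := h'.outerSum_low hΓ hm
  have u1 := h.outerSum_high hΓ hm
  have u2 := h'.outerSum_high hΓ hm
  rw [permute_partner] at u2
  simp only [hβ, hδ, h.outerSum_permute hσ] at l2 u2
  rw [h'.stateSum_eq hΓ hm, h.stateSum_eq hΓ hm, h.sum_tame_permute hm hσ]
  simp only [permute_partner, permute_writhe, hβ, hμ, hδ, h.outerSum_permute hσ, add_assoc]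
  congr 1
  simp only [← add_assoc]
  refine exchange_identity (O := q - p < r - p) ?_ ?_ (fun hO => ⟨?_, ?_⟩) (fun hO => ⟨?_, ?_⟩)
  · rw [← h.sign_p, ← h.sign_q, hpq]
  · rw [← h.sign_q, ← h.sign_r, hqr]
  · by_cases hb : b = p <;> simp_all
  · by_cases hb : G.partner d = r <;> simp_all
  · by_cases hb : b = p <;> simp_all
  · by_cases hb : G.partner d = r <;> simp_all

end R3

/-! #### The arrows of a third Reidemeister move -/

section Unpack

variable {π : Type u} [Group π] {N n : ℕ} {Γ : Fin (n + 1) → ConjClasses π} {G : RigidGauss π N}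

theorem swapEnds_apply {e : Fin 3 → Pt N}
    (h : Function.Injective (fun p : Fin 3 × Bool => if p.2 then e p.1 + 1 else e p.1)) (i : Pt N) :
    swapEnds e i = swapPoint {e 0, e 1, e 2} i := by
  have h1 : ∀ k l, k ≠ l → e k ≠ e l := fun k l hkl he =>
    hkl (congrArg Prod.fst (@h (k, false) (l, false) (by simpa using he)))
  have h2 : ∀ k l, e k + 1 ≠ e l := fun k l he => by
    have := @h (k, true) (l, false) (by simpa using he)
    simp at this
  have a1 := h1 0 1 (by decide)
  have a2 := h1 0 2 (by decide)
  have a3 := h1 1 2 (by decide)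
  have b1 := h2 0 0
  have b2 := h2 0 1
  have b3 := h2 0 2
  have b4 := h2 1 0
  have b5 := h2 1 1
  have b6 := h2 1 2
  have b7 := h2 2 0
  have b8 := h2 2 1
  have b9 := h2 2 2
  have c : ∀ x y : Pt N, x - 1 = y ↔ x = y + 1 := fun x y => sub_eq_iff_eq_add
  simp only [swapEnds, Equiv.Perm.mul_apply, Equiv.swap_apply_def, swapPoint, Finset.mem_insert,
    Finset.mem_singleton, c]
  have c' : ∀ x y : Pt N, x = y + 1 → x - 1 = y := fun x y => (c x y).2
  have d1 : e 0 + 1 ≠ e 1 + 1 := fun h => a1 (add_right_cancel h)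
  have d2 : e 0 + 1 ≠ e 2 + 1 := fun h => a2 (add_right_cancel h)
  have d3 : e 1 + 1 ≠ e 2 + 1 := fun h => a3 (add_right_cancel h)
  grind

/-- The numbers of arrowheads are distinct and at most `2`, so they are `0`, `1`, `2`. This orders
the edges, and every joining arrow goes from the edge with fewer heads to the one with more. -/
theorem RigidGauss.IsR3.exists_triangle {e : Fin 3 → Pt N} (h : G.IsR3 e) :
    ∃ i j k, ({e i, e j, e k} : Finset (Pt N)) = {e 0, e 1, e 2} ∧
      ∃ a b d, Triangle G.toNaked (e i) (e j) (e k) a b d := by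
  obtain ⟨hinj, -, hj, -, hh⟩ := h
  have h1 : ∀ k l, k ≠ l → e k ≠ e l := fun k l hkl he =>
    hkl (congrArg Prod.fst (@hinj (k, false) (l, false) (by simpa using he)))
  have h2 : ∀ k l, e k + 1 ≠ e l := fun k l he => by
    have := @hinj (k, true) (l, false) (by simpa using he)
    simp at this
  have hN : N ≠ 0 := by
    rintro rfl
    exact h1 0 1 (by decide) (Subsingleton.elim (α := Fin 1) _ _)
  have hlt : ∀ k, G.heads (e k) < 3 := fun k => by
    unfold Naked.heads
    split_ifs <;> omega
  have hs : Function.Surjective fun k => (⟨G.heads (e k), hlt k⟩ : Fin 3) :=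
    Finite.injective_iff_surjective.1 fun k l hkl => by
      by_contra hne
      exact hh k l hne (Fin.ext_iff.1 hkl)
  obtain ⟨i, hi⟩ := hs 0
  obtain ⟨j, hj'⟩ := hs 1
  obtain ⟨k, hk⟩ := hs 2
  have hij : i ≠ j := by rintro rfl; exact absurd (hi.symm.trans hj') (by decide)
  have hik : i ≠ k := by rintro rfl; exact absurd (hi.symm.trans hk) (by decide)
  have hjk : j ≠ k := by rintro rfl; exact absurd (hj'.symm.trans hk) (by decide)
  have hall : ∀ l, l = i ∨ l = j ∨ l = k := by omega
  have hi' : G.heads (e i) = 0 := Fin.ext_iff.1 hi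
  have hk' : G.heads (e k) = 2 := Fin.ext_iff.1 hk
  have hE : ∀ x : Pt N, (x = e i ∨ x = e j ∨ x = e k) ↔ ∃ l, x = e l := fun x => by
    constructor
    · rintro (h | h | h) <;> exact ⟨_, h⟩
    · rintro ⟨l, rfl⟩
      rcases hall l with rfl | rfl | rfl <;> simp
  have tail : ∀ x, x = e i ∨ x = e i + 1 → G.dir x = 1 := fun x hx => by
    have h3 := G.dir_ne_zero hN x
    have h4 : G.dir x ≠ -1 := fun h4 => by
      unfold Naked.heads at hi'
      rcases hx with rfl | rfl <;> simp [h4] at hi'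
    revert h3 h4
    cases G.dir x <;> decide
  have head : ∀ x, x = e k ∨ x = e k + 1 → G.dir x = -1 := fun x hx => by
    unfold Naked.heads at hk'
    by_contra h4
    rcases hx with rfl | rfl <;> rw [if_neg h4] at hk' <;> split_ifs at hk' <;> omega
  have sep : ∀ {l m x y}, l ≠ m → (x = e l ∨ x = e l + 1) → (y = e m ∨ y = e m + 1) → x ≠ y := by
    intro l m x y hlm hx hy hxy
    subst hxy
    rcases hx with rfl | rfl <;> rcases hy with hy | hy
    · exact h1 _ _ hlm hy
    · exact h2 _ _ hy.symm
    · exact h2 _ _ hy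
    · exact h1 _ _ hlm (add_right_cancel hy)
  have two : ∀ {l x y}, x ≠ y → (x = e l ∨ x = e l + 1) → (y = e l ∨ y = e l + 1) →
      (x = e l ∧ y = e l + 1) ∨ (y = e l ∧ x = e l + 1) := by
    rintro l x y hxy (rfl | rfl) (rfl | rfl)
    · exact absurd rfl hxy
    · exact Or.inl ⟨rfl, rfl⟩
    · exact Or.inr ⟨rfl, rfl⟩
    · exact absurd rfl hxy
  obtain ⟨a, ha, ha'⟩ := hj i j hij
  obtain ⟨b, hb, hb'⟩ := hj i k hik
  obtain ⟨d, hd, hd'⟩ := hj j k hjk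
  have hdd : G.dir d = 1 := by
    have := head _ hd'
    rw [G.dir_partner] at this
    rw [← neg_neg (G.dir d), this, neg_neg]
  refine ⟨i, j, k, ?_, a, b, d, tail a ha, tail b hb, hdd, ?_, h1 _ _ hij, h1 _ _ hik, h1 _ _ hjk,
    two ?_ hb ha, two ?_ ha' hd, two ?_ hd' hb'⟩
  · ext x
    simp only [Finset.mem_insert, Finset.mem_singleton, hE]
    rw [Fin.exists_fin_succ]
    simp [Fin.exists_fin_two]
  · intro x hx hx'
    simp only [Finset.mem_insert, Finset.mem_singleton, hE] at hx hx'
    obtain ⟨l, rfl⟩ := hx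
    obtain ⟨m, hm⟩ := hx'
    exact h2 _ _ hm
  · rintro rfl
    exact sep hjk ha' hb' rfl
  · exact Triangle.head_ne_tail (tail a ha) hdd
  · exact fun h => sep hij hb hd (G.partner_injective h).symm

theorem stateSum_permute_r3 (hΓ : ∀ i, Γ i ≠ ConjClasses.mk 1) {e : Fin 3 → Pt N} (h : G.IsR3 e) :
    (G.permute (swapEnds e)).stateSum Γ = G.stateSum Γ := by
  obtain ⟨i, j, k, hE, a, b, d, ht⟩ := h.exists_triangle
  refine ht.stateSum_permute hΓ (fun x hx => ?_) (h.2.2.2.1 i j) (h.2.2.2.1 j k) fun x => ?_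
  · simp only [Finset.mem_insert, Finset.mem_singleton] at hx
    rcases hx with rfl | rfl | rfl <;> exact h.2.1 _
  · rw [swapEnds_apply h.1, hE]

end Unpack

/-- The state sum is invariant under all moves. -/
theorem stateSum_move {π : Type u} [Group π] {n : ℕ} {Γ : Fin (n + 1) → ConjClasses π}
    (hΓ : ∀ i, Γ i ≠ ConjClasses.mk 1) {w : π →* ℤˣ} (hw : ∀ g, w g = 1)
    {x y : Σ n : ℕ, RigidGauss π n} (h : Move w x y) : x.2.stateSum Γ = y.2.stateSum Γ := by
  cases h with
  | rotate G k => exact (stateSum_smul G k).symm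
  | r1 G a h => exact (stateSum_remove_r1 hΓ G h).symm
  | r2 G a b h => exact (stateSum_remove_r2 hΓ G h).symm
  | r3 G e h => exact (stateSum_permute_r3 hΓ h).symm
  | conj G i hi g => exact (stateSum_conjugate hΓ G hw hi g).symm

end GaussKnot

theorem mainTheorem6 {π : Type*} [Group π] (w : π →* ℤˣ) (hw : ∀ g, w g = 1)
    (n : ℕ) (Γ : Fin (n + 1) → ConjClasses π) (hΓ : ∀ i, Γ i ≠ ConjClasses.mk 1) :
    GaussKnot.IsArrowDiagramFormula w
      (GaussKnot.signedSymPres (GaussKnot.liftedPlanarChain Γ)) :=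
  ⟨⟨Quot.lift (fun x => x.2.stateSum Γ) fun _ _ h => GaussKnot.stateSum_move hΓ hw h,
    fun _ G => (GaussKnot.pairing_subdiagramSum hΓ G).symm⟩, _, rfl⟩
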